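/- **Conventions.** All rings are commutative. Let $(A,\mathfrak m)$ be a Cohen–Macaulay (Noetherian) local ring of dimension $d>0$. A canonical module of $A$ is a finitely generated $A$-module $K$ such that $\ell_A(\operatorname{Ext}^i_A(A/\mathfrak m,K))$ equals $1$ for $i=d$ and $0$ for $i\neq d$, i.e. a maximal Cohen–Macaulay module of type one and finite injective dimension. A canonical ideal of $A$ is an ideal $I\neq A$ that is, as an $A$-module, a canonical module. For ideals $Q\subseteq J$ of $A$ put $\mathcal R=A[Jt]$ and $\mathcal T=A[Qt]$ (Rees algebras inside $A[t]$); the Sally module is the graded $\mathcal T$-module $\mathcal S_Q(J)=J\mathcal R/J\mathcal T\cong\bigoplus_{i\ge1}J^{i+1}/JQ^i$. Its rank is $\ell_{\mathcal T_{\mathfrak p}}(\mathcal S_Q(J)_{\mathfrak p})$, where $\mathfrak p=\mathfrak m\mathcal T$ is a prime ideal. For an integer $n\ge0$, the ring $A$ is called *$n$-Goto* if it admits a canonical ideal $I$ and a parameter ideal $Q=(a_1,\dots,a_d)$ with $a_1\in I$ such that, for $J=I+Q$, the module $\mathcal S_Q(J)$ has rank $n$ and is generated over $\mathcal T$ by its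 homogeneous elements of degree one. **Theorem 6.1.** Let $R$ and $S$ be one-dimensional Cohen–Macaulay local rings with a common infinite residue field $k$, and let $f:R\to k$ and $g:S\to k$ be the canonical surjections. Let $A=R\times_kS=\{(a,b)\in R\times S : f(a)=g(b)\}$ and let $n\ge2$ be an integer. Then $A$ is $n$-Goto if and only if one of the following conditions holds: (i) $R$ is Gorenstein and $S$ is $n$-Goto; (ii) $R$ is $n$-Goto and $S$ is Gorenstein; (iii) $R$ is $p$-Goto and $S$ is $q$-Goto for some integers $p,q>0$ with $p+q=n+1$. -/

import Mathlib

open Polynomial CategoryTheory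

universe u v w

/-- Cohen-Macaulay local rings: Noetherian local rings that possess a regular sequence in the
maximal ideal whose length is the Krull dimension (that is, depth equals dimension). -/
class IsCohenMacaulayLocalRing (A : Type u) [CommRing A] : Prop extends
    IsLocalRing A, IsNoetherian A A where
  exists_isRegular : ∃ rs : List A, RingTheory.Sequence.IsRegular A rs ∧
    (∀ r ∈ rs, r ∈ IsLocalRing.maximalIdeal A) ∧
    (rs.length : WithBot ℕ∞) = ringKrullDim A

/-- Gorenstein local rings: Noetherian local rings of finite injective dimension over
themselves. -/
def IsGorensteinLocalRing (A : Type u) [CommRing A] : Prop :=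
  IsLocalRing A ∧ IsNoetherianRing A ∧ ∃ i : ℕ, HasInjectiveDimensionLE (ModuleCat.of A A) i

/-- Canonical modules of a Cohen-Macaulay local ring `(A, 𝔪)` of dimension `d`: the finitely
generated modules `K` with `ℓ_A(Ext^i_A(A/𝔪, K)) = δ_{i d}`; that is, the maximal Cohen-Macaulay
modules of type one and of finite injective dimension. -/
def IsCanonicalModule (A : Type u) [CommRing A] [IsCohenMacaulayLocalRing A]
    (K : Type u) [AddCommGroup K] [Module A K] : Prop :=
  Module.Finite A K ∧
    ∀ i : ℕ, Module.length A
      (Abelian.Ext (ModuleCat.of A (IsLocalRing.ResidueField A)) (ModuleCat.of A K) i) =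
        if (i : WithBot ℕ∞) = ringKrullDim A then 1 else 0

/-- Canonical ideals: proper ideals that are isomorphic to a canonical module. -/
def IsCanonicalIdeal {A : Type u} [CommRing A] [IsCohenMacaulayLocalRing A] (I : Ideal A) : Prop :=
  I ≠ ⊤ ∧ IsCanonicalModule A I

/-- The elements `a 0, …, a (d - 1)` are a system of parameters of the local ring `A`: their number
is the dimension and they generate an ideal that is primary to the maximal ideal. -/
def IsParameterSystem {A : Type u} [CommRing A] [IsLocalRing A] {d : ℕ} (a : Fin d → A) : Prop :=
  ringKrullDim A = d ∧ (Ideal.span (Set.range a)).radical = IsLocalRing.maximalIdeal A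

/-- The quotient `N / (N ∩ P)` for submodules `N` and `P` of a module; it is `N / P` if `P ⊆ N`. -/
abbrev SubmoduleQuotient {T : Type u} {M : Type v} [CommRing T] [AddCommGroup M] [Module T M]
    (N P : Submodule T M) : Type v :=
  N ⧸ P.submoduleOf N

section Sally

variable {A : Type u} [CommRing A] (Q J : Ideal A)

/-- `J𝓡`, where `𝓡 = A[Jt] ⊆ A[t]` is the Rees algebra of `J`, as a module over the
Rees algebra `𝓣 = A[Qt]` of `Q` (for `Q ⊆ J`). -/
noncomputable def sallyNumerator : Submodule (reesAlgebra Q) A[X] :=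
  Submodule.span (reesAlgebra Q) {p | ∃ x ∈ J, ∃ r ∈ reesAlgebra J, p = C x * r}

/-- `J𝓣`, where `𝓣 = A[Qt] ⊆ A[t]` is the Rees algebra of `Q`. -/
noncomputable def sallyDenominator : Submodule (reesAlgebra Q) A[X] :=
  Submodule.span (reesAlgebra Q) {p | ∃ x ∈ J, p = C x}

/-- The Sally module `J𝓡 / J𝓣` of `J` with respect to `Q`, a module over `𝓣`. Its homogeneous
component of degree `i` is `J ^ (i + 1) / J Q ^ i`. -/
abbrev SallyModule : Type u :=
  SubmoduleQuotient (sallyNumerator Q J) (sallyDenominator Q J)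

/-- The homogeneous component of degree one of the Sally module: the classes of the elements
`x t` with `x ∈ J ^ 2`. -/
def sallyDegreeOne : Set (SallyModule Q J) :=
  {s | ∃ x ∈ J ^ 2, ∃ h : monomial 1 x ∈ sallyNumerator Q J,
    s = Submodule.Quotient.mk ⟨monomial 1 x, h⟩}

/-- The Sally module is generated over `𝓣` by its homogeneous elements of degree one. -/
def SallyGeneratedInDegreeOne : Prop :=
  Submodule.span (reesAlgebra Q) (sallyDegreeOne Q J) = ⊤

/-- The Sally module has rank `n`: with `𝔭 = 𝔪𝓣`, a prime ideal of `𝓣`, the localization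
at `𝔭` of the Sally module has length `n` over `𝓣_𝔭`. -/
def SallyRankEq [IsLocalRing A] (n : ℕ) : Prop :=
  ∃ _ : ((IsLocalRing.maximalIdeal A).map (algebraMap A (reesAlgebra Q))).IsPrime,
    Module.length
      (Localization.AtPrime ((IsLocalRing.maximalIdeal A).map (algebraMap A (reesAlgebra Q))))
      (LocalizedModule
        ((IsLocalRing.maximalIdeal A).map (algebraMap A (reesAlgebra Q))).primeCompl
        (SallyModule Q J)) = n

end Sally

/-- `n`-Goto rings: Cohen-Macaulay local rings `A` of positive dimension `d + 1` that admit a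
canonical ideal `I` and a parameter ideal `Q = (a 0, …, a d)` with `a 0 ∈ I` such that, for
`J = I + Q`, the Sally module of `J` with respect to `Q` has rank `n` and is generated by
its homogeneous elements of degree one. -/
def IsGotoRing (n : ℕ) (A : Type u) [CommRing A] : Prop :=
  ∃ _ : IsCohenMacaulayLocalRing A, ∃ I : Ideal A, IsCanonicalIdeal I ∧
    ∃ (d : ℕ) (a : Fin (d + 1) → A), IsParameterSystem a ∧ a 0 ∈ I ∧
      SallyRankEq (Ideal.span (Set.range a)) (I ⊔ Ideal.span (Set.range a)) n ∧
      SallyGeneratedInDegreeOne (Ideal.span (Set.range a)) (I ⊔ Ideal.span (Set.range a))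

/-! In dimension one the Goto property is a statement about fractional ideals. There `Q = (c)` with
`c ∈ I`, so `J = I`. Generation of the Sally module in degree one means `I³ = cI²`, and the module
is then `𝓣 ⊗ I²/cI` with `𝓣 = A[ct]` a polynomial ring, so that its rank is `ℓ(I²/cI)`. Putting `K =
c⁻¹I`, the ring is `n`-Goto iff some canonical fractional ideal `K ∋ 1` has `K³ = K²` and `ℓ(K²/K) =
n` (`isGotoRing_iff`). Being canonical amounts to `ℓ((K : 𝔪)/K) = 1` (`isCanonicalModule_iff`), and
being Gorenstein to the same condition on the ring itself (`isGorensteinLocalRing_iff`).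

Let `K ∋ 1` be a fractional ideal of `A = R ×_k S` inside the product of the total quotient rings,
let `F` and `G` be its intersections with the two factors, and write `L_F = F : 𝔪_R`, `L_G = G :
𝔪_S`. Since `𝔪_A = 𝔪_R × 𝔪_S`, one gets `K : 𝔪_A = L_F × L_G`. A length count shows that if `K` has
type one, then so have `F` and `G`, and `K` projects onto `L_F` and onto `L_G`
(`HasTypeOne.components`). Conversely `F × G + A·(1,1)` is such a `K` as soon as `1` lies in `L_F`
but not in `F`, and in `L_G` but not in `G`. If `F·L_F = L_F²` or `G·L_G = L_G²`, then `K² = L_F² ×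
L_G²`. As `ℓ(K/(F × G)) = 1`, the numbers `p = ℓ(L_F²/F)` and `q = ℓ(L_G²/G)` satisfy `p + q =
ℓ(K²/K) + 1`.

It remains to interpret `p` for `F` of type one with `1 ∈ L` and `L³ = L²`, where `L = F : 𝔪`. The
duality `F : –` preserves lengths (`HasTypeOne.relLength_div`). It yields that either `FL = L²`, or
`L = R` and `F = 𝔪` is principal; and that `F² = FL` unless `F` is principal. If `FL = L²`, then `F`
contains a unit of the ring `L²`, because the residue field is infinite. After division by this unit
either `F² = L²`, so that `R` is `p`-Goto, or `F = R`, so that `R` is Gorenstein and `p = 1`. In the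
other direction, rescaling by units of `L²` produces a suitable `F` from any `p`-Goto ring with `p >
0`, and from any Gorenstein ring with `p = 1`. The assumption `n ≥ 2` rules out `p = q = 1`. -/

/-! ### Lengths of quotients of submodules -/

section RelLength

variable {A M N : Type*} [CommRing A] [AddCommGroup M] [Module A M] [AddCommGroup N] [Module A N]

/-- The length of `G / (F ∩ G)`. -/
noncomputable def relLength (F G : Submodule A M) : ℕ∞ :=
  Module.length A (G ⧸ F.submoduleOf G)

theorem relLength_eq_length_of_ker {F G : Submodule A M} (φ : G →ₗ[A] N)
    (hφ : Function.Surjective φ) (hker : ∀ g : G, φ g = 0 ↔ (g : M) ∈ F) :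
    relLength F G = Module.length A N := by
  have h : LinearMap.ker φ = F.submoduleOf G := by
    ext g
    exact hker g
  rw [relLength, ← h]
  exact (φ.quotKerEquivOfSurjective hφ).length_eq

theorem relLength_eq_of_linearMap {F G : Submodule A M} {F' G' : Submodule A N} (φ : M →ₗ[A] N)
    (hmap : ∀ g ∈ G, φ g ∈ G') (hsurj : ∀ y ∈ G', ∃ g ∈ G, φ g = y)
    (hker : ∀ g ∈ G, φ g ∈ F' ↔ g ∈ F) : relLength F G = relLength F' G' := by
  refine relLength_eq_length_of_ker ((F'.submoduleOf G').mkQ ∘ₗ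
    (φ.comp G.subtype).codRestrict G' fun g => hmap g g.2) ?_ ?_
  · refine (Submodule.mkQ_surjective _).comp ?_
    rintro ⟨y, hy⟩
    obtain ⟨g, hg, rfl⟩ := hsurj y hy
    exact ⟨⟨g, hg⟩, rfl⟩
  · intro g
    exact (Submodule.Quotient.mk_eq_zero _).trans (hker g g.2)

theorem relLength_le_length_of_ker {F G : Submodule A M} (φ : G →ₗ[A] N)
    (hker : ∀ g : G, φ g = 0 → (g : M) ∈ F) :
    relLength F G ≤ Module.length A N := by
  have h : LinearMap.ker φ ≤ F.submoduleOf G := fun g hg => hker g hg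
  refine le_trans (Module.length_le_of_surjective (Submodule.factor h)
    (Submodule.factor_surjective h)) ?_
  rw [φ.quotKerEquivRange.length_eq]
  exact Module.length_le_of_injective (LinearMap.range φ).subtype (Submodule.subtype_injective _)

theorem relLength_eq_zero_iff {F G : Submodule A M} : relLength F G = 0 ↔ G ≤ F := by
  rw [relLength, Module.length_eq_zero_iff, Submodule.Quotient.subsingleton_iff,
    Submodule.submoduleOf_eq_top]

theorem relLength_add {F G H : Submodule A M} (hFG : F ≤ G) (hGH : G ≤ H) :
    relLength F H = relLength F G + relLength G H := by
  have h1 : F.submoduleOf G ≤ (F.submoduleOf H).comap (Submodule.inclusion hGH) :=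
    fun g hg => hg
  have h2 : F.submoduleOf H ≤ G.submoduleOf H := fun g hg => hFG hg
  refine Module.length_eq_add_of_exact (Submodule.mapQ _ _ (Submodule.inclusion hGH) h1)
    (Submodule.factor h2) ?_ (Submodule.factor_surjective h2) ?_
  · rw [← LinearMap.ker_eq_bot, LinearMap.ker_eq_bot']
    intro q hq
    obtain ⟨g, rfl⟩ := Submodule.Quotient.mk_surjective _ q
    rw [Submodule.mapQ_apply, Submodule.Quotient.mk_eq_zero] at hq
    rw [Submodule.Quotient.mk_eq_zero]
    exact hq
  · intro q
    obtain ⟨h, rfl⟩ := Submodule.Quotient.mk_surjective _ q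
    change (Submodule.Quotient.mk h : H ⧸ G.submoduleOf H) = 0 ↔ _
    rw [Submodule.Quotient.mk_eq_zero]
    constructor
    · intro hh
      exact ⟨Submodule.Quotient.mk ⟨h, hh⟩, rfl⟩
    · rintro ⟨q, hq⟩
      obtain ⟨g, rfl⟩ := Submodule.Quotient.mk_surjective _ q
      rw [Submodule.mapQ_apply, Submodule.Quotient.eq] at hq
      have h3 : ((g : M) - h) ∈ F := hq
      have h4 : (h : M) ∈ G := by simpa using G.sub_mem g.2 (hFG h3)
      exact h4

theorem relLength_mono_right {F G H : Submodule A M} (hGH : G ≤ H) :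
    relLength F G ≤ relLength F H := by
  refine relLength_le_length_of_ker ((F.submoduleOf H).mkQ ∘ₗ Submodule.inclusion hGH) ?_
  intro g hg
  have := (Submodule.Quotient.mk_eq_zero _).1 hg
  exact this

theorem relLength_anti_left {F G H : Submodule A M} (hFG : F ≤ G) :
    relLength G H ≤ relLength F H := by
  refine relLength_le_length_of_ker ((F.submoduleOf H).mkQ) ?_
  intro g hg
  have := (Submodule.Quotient.mk_eq_zero _).1 hg
  exact hFG this

theorem relLength_map {F G : Submodule A M} (e : M →ₗ[A] N) (he : Function.Injective e) :
    relLength (F.map e) (G.map e) = relLength F G := by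
  symm
  refine relLength_eq_of_linearMap e (fun g hg => ⟨g, hg, rfl⟩) (fun y hy => hy) fun g _ => ?_
  simp [he.eq_iff]

theorem eq_of_relLength_eq_zero {F G : Submodule A M} (h : F ≤ G) (h0 : relLength F G = 0) :
    F = G :=
  le_antisymm h (relLength_eq_zero_iff.1 h0)

/-- There is no submodule strictly between `F` and `G` if `G / F` has length one. -/
theorem eq_or_eq_of_relLength_eq_one {F G H : Submodule A M} (hFG : F ≤ G) (hGH : G ≤ H)
    (h1 : relLength F H = 1) : F = G ∨ G = H := by
  rw [relLength_add hFG hGH] at h1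
  have h : relLength F G = 0 ∨ relLength G H = 0 := by
    by_contra! hc
    have h2 := add_le_add (Order.one_le_iff_ne_zero.2 hc.1) (Order.one_le_iff_ne_zero.2 hc.2)
    rw [h1] at h2
    exact absurd h2 (by decide)
  exact h.imp (eq_of_relLength_eq_zero hFG) (eq_of_relLength_eq_zero hGH)

theorem not_le_of_relLength_eq_one {F G : Submodule A M} (h1 : relLength F G = 1) : ¬ G ≤ F :=
  fun h => by simp [relLength_eq_zero_iff.2 h] at h1

theorem relLength_sup_right (F G : Submodule A M) : relLength F (F ⊔ G) = relLength F G := by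
  symm
  refine relLength_eq_length_of_ker ((F.submoduleOf (F ⊔ G)).mkQ ∘ₗ
    Submodule.inclusion le_sup_right) ?_ ?_
  · intro q
    obtain ⟨⟨h, hh⟩, rfl⟩ := Submodule.Quotient.mk_surjective _ q
    obtain ⟨f, hf, g, hg, rfl⟩ := Submodule.mem_sup.1 hh
    refine ⟨⟨g, hg⟩, ?_⟩
    change Submodule.Quotient.mk _ = _
    rw [Submodule.Quotient.eq]
    change g - (f + g) ∈ F
    simpa using hf
  · intro g
    exact Submodule.Quotient.mk_eq_zero _

/-- If `G` is generated over `F` by one element that is annihilated by the maximal ideal modulo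
`F`, then `G / F` has length one. -/
theorem relLength_sup_span_singleton [IsLocalRing A] {F : Submodule A M} {e : M} (he : e ∉ F)
    (hm : ∀ r ∈ IsLocalRing.maximalIdeal A, r • e ∈ F) :
    relLength F (F ⊔ Submodule.span A {e}) = 1 := by
  rw [relLength_sup_right]
  have h : relLength F (Submodule.span A {e}) =
      Module.length A (A ⧸ IsLocalRing.maximalIdeal A) := by
    -- The annihilator of `e` modulo `F` is exactly `𝔪`, so the quotient is a copy of `A/𝔪`.
    have key : ∀ r : A, r • e ∈ F ↔ r ∈ IsLocalRing.maximalIdeal A := fun r =>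
      ⟨fun hr => by
        rw [IsLocalRing.mem_maximalIdeal]
        intro hu
        exact he ((Submodule.smul_mem_iff_of_isUnit F hu).1 hr), hm r⟩
    refine (LinearEquiv.length_eq (LinearEquiv.symm ?_))
    refine (LinearEquiv.symm (Submodule.quotEquivOfEq _ _ ?_)).trans
      (LinearMap.quotKerEquivOfSurjective
        ((F.submoduleOf (Submodule.span A {e})).mkQ ∘ₗ
          (LinearMap.toSpanSingleton A M e).codRestrict (Submodule.span A {e})
            (fun r => Submodule.smul_mem _ _ (Submodule.mem_span_singleton_self e))) ?_)
    · ext r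
      rw [LinearMap.mem_ker, ← key]
      exact Submodule.Quotient.mk_eq_zero _
    · refine (Submodule.mkQ_surjective _).comp ?_
      rintro ⟨g, hg⟩
      obtain ⟨r, rfl⟩ := Submodule.mem_span_singleton.1 hg
      exact ⟨r, rfl⟩
  rw [h, Module.length_eq_one_iff]
  exact isSimpleModule_iff_isCoatom.2 (IsLocalRing.maximalIdeal.isMaximal A).out

end RelLength

/-! ### Modules of finite length and their socles -/

section FiniteLength

variable {A M : Type*} [CommRing A] [AddCommGroup M] [Module A M]

/-- A finitely generated module that is annihilated by an element `b` has finite length if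
`A / b` has. -/
theorem isFiniteLength_of_smul_eq_zero [Module.Finite A M] {b : A}
    (hb : IsFiniteLength A (A ⧸ Ideal.span {b})) (h : ∀ m : M, b • m = 0) :
    IsFiniteLength A M := by
  obtain ⟨n, s, hs⟩ := Module.Finite.exists_fin (R := A) (M := M)
  have hpi : IsFiniteLength A (Fin n → A ⧸ Ideal.span {b}) := by
    rw [← Module.length_ne_top_iff] at hb ⊢
    rw [Module.length_pi_of_fintype]
    obtain ⟨m, hm⟩ := ENat.ne_top_iff_exists.1 hb
    simp only [← hm, Finset.sum_const, Finset.card_univ, Fintype.card_fin, nsmul_eq_mul]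
    exact_mod_cast ENat.natCast_ne_top (n * m)
  let φ : (Fin n → A ⧸ Ideal.span {b}) →ₗ[A] M :=
    LinearMap.lsum A (fun _ => A ⧸ Ideal.span {b}) A fun i =>
      Submodule.liftQ (Ideal.span {b}) (LinearMap.toSpanSingleton A M (s i)) (by
        rw [Ideal.span, Submodule.span_le]
        intro c hc
        rw [Set.mem_singleton_iff.1 hc]
        simpa using h (s i))
  refine hpi.of_surjective (f := φ) ?_
  rw [← LinearMap.range_eq_top, eq_top_iff, ← hs, Submodule.span_le]
  rintro _ ⟨i, rfl⟩
  refine ⟨Pi.single i (Submodule.Quotient.mk 1), ?_⟩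
  simp [φ, Pi.single_apply, apply_ite]
  exact one_smul A (s i)

/-- A nonzero module of finite length has a simple submodule, and `𝔪` kills it by Nakayama.
Adjoining such elements one at a time climbs from `F` to `G` in steps of length one. -/
theorem exists_socle_element [IsLocalRing A] [IsNoetherianRing A] {F G : Submodule A M}
    (hFG : ¬ G ≤ F) (hfin : relLength F G ≠ ⊤) :
    ∃ e ∈ G, e ∉ F ∧ ∀ r ∈ IsLocalRing.maximalIdeal A, r • e ∈ F := by
  rw [relLength, Module.length_ne_top_iff, isFiniteLength_iff_isNoetherian_isArtinian] at hfin
  obtain ⟨_, _⟩ := hfin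
  have : Nontrivial (G ⧸ F.submoduleOf G) := by
    rw [Submodule.Quotient.nontrivial_iff, Ne, Submodule.submoduleOf_eq_top]
    exact hFG
  obtain ⟨S, hS, -⟩ := (eq_bot_or_exists_atom_le (⊤ : Submodule A (G ⧸ F.submoduleOf G))).resolve_left
    top_ne_bot
  obtain ⟨q, hq, hq0⟩ := S.exists_mem_ne_zero_of_ne_bot hS.1
  obtain ⟨⟨e, he⟩, rfl⟩ := Submodule.Quotient.mk_surjective _ q
  refine ⟨e, he, fun h => hq0 ((Submodule.Quotient.mk_eq_zero _).2 h), fun r hr => ?_⟩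
  have h1 : IsLocalRing.maximalIdeal A • S = ⊥ := by
    by_contra h
    have h2 := (hS.le_iff.1 (Submodule.smul_le_right : IsLocalRing.maximalIdeal A • S ≤ S)).resolve_left h
    exact hS.1 (Submodule.eq_bot_of_le_smul_of_le_jacobson_bot _ _ (IsNoetherian.noetherian S) h2.ge
      (IsLocalRing.maximalIdeal_le_jacobson _))
  have h2 : r • (Submodule.Quotient.mk ⟨e, he⟩ : G ⧸ F.submoduleOf G) = 0 := by
    rw [← Submodule.mem_bot A, ← h1]
    exact Submodule.smul_mem_smul hr hq
  exact (Submodule.Quotient.mk_eq_zero (F.submoduleOf G)).1 h2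

end FiniteLength

/-! ### Fractional modules over one-dimensional rings -/

/-- The ring `A` has the properties of a one-dimensional Cohen-Macaulay ring, and `V` contains
its total quotient ring. -/
class IsOneDimExtension (A V : Type*) [CommRing A] [CommRing V] [Algebra A V] [IsLocalRing A] :
    Prop where
  injective : Function.Injective (algebraMap A V)
  isUnit : ∀ b ∈ nonZeroDivisors A, IsUnit (algebraMap A V b)
  isFiniteLength : ∀ b ∈ nonZeroDivisors A, IsFiniteLength A (A ⧸ Ideal.span {b})
  exists_mem : ∃ b ∈ IsLocalRing.maximalIdeal A, b ∈ nonZeroDivisors A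

section Fractional

variable {A V : Type*} [CommRing A] [CommRing V] [Algebra A V]

/-- A submodule of `V` that has a common denominator in `A` and contains a unit of `V`. -/
def IsRegularFractional (K : Submodule A V) : Prop :=
  (∃ b ∈ nonZeroDivisors A, ∀ v ∈ K, b • v ∈ (1 : Submodule A V)) ∧ ∃ u ∈ K, IsUnit u

theorem relLength_scale (u : Vˣ) (F G : Submodule A V) :
    relLength (Submodule.span A {(u : V)} * F) (Submodule.span A {(u : V)} * G) =
      relLength F G := by
  have h : ∀ H : Submodule A V, Submodule.span A {(u : V)} * H =
      H.map (LinearMap.mulLeft A (u : V)) := by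
    intro H
    ext x
    simp [Submodule.mem_span_singleton_mul]
  rw [h, h]
  refine relLength_map _ ?_
  intro x y hxy
  exact u.isUnit.mul_left_cancel hxy

theorem span_unit_mul_span_inv (u : Vˣ) :
    Submodule.span A {(u : V)} * Submodule.span A {((u⁻¹ : Vˣ) : V)} = 1 := by
  rw [Submodule.span_mul_span, Set.singleton_mul_singleton, Units.mul_inv, Submodule.one_eq_span]

theorem span_inv_mul_span_unit (u : Vˣ) :
    Submodule.span A {((u⁻¹ : Vˣ) : V)} * Submodule.span A {(u : V)} = 1 := by
  rw [mul_comm, span_unit_mul_span_inv]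

theorem mem_scale {u : Vˣ} {F : Submodule A V} {x : V} :
    x ∈ Submodule.span A {(u : V)} * F ↔ ((u⁻¹ : Vˣ) : V) * x ∈ F := by
  rw [Submodule.mem_span_singleton_mul]
  constructor
  · rintro ⟨z, hz, rfl⟩
    simpa using hz
  · intro h
    exact ⟨_, h, by simp⟩

theorem scale_div (u : Vˣ) (F G : Submodule A V) :
    (Submodule.span A {(u : V)} * F) / G = Submodule.span A {(u : V)} * (F / G) := by
  ext x
  simp only [mem_scale, Submodule.mem_div_iff_forall_mul_mem, mul_assoc]

theorem div_scale (u : Vˣ) (F G : Submodule A V) :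
    F / (Submodule.span A {(u : V)} * G) = Submodule.span A {((u⁻¹ : Vˣ) : V)} * (F / G) := by
  ext x
  simp only [mem_scale, Submodule.mem_div_iff_forall_mul_mem, inv_inv]
  constructor
  · intro h g hg
    rw [mul_assoc, mul_left_comm]
    exact h _ (by simpa using hg)
  · intro h g hg
    have := h _ hg
    rwa [mul_mul_mul_comm, Units.mul_inv, one_mul] at this

theorem div_div_eq (F G H : Submodule A V) : F / G / H = F / (G * H) := by
  refine le_antisymm ?_ ?_
  · rw [Submodule.le_div_iff_mul_le, mul_comm G H, ← mul_assoc, ← Submodule.le_div_iff_mul_le,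
      ← Submodule.le_div_iff_mul_le]
  · rw [Submodule.le_div_iff_mul_le, Submodule.le_div_iff_mul_le, mul_assoc, mul_comm H G,
      ← Submodule.le_div_iff_mul_le]

theorem div_anti {F G : Submodule A V} (K : Submodule A V) (h : F ≤ G) : K / G ≤ K / F :=
  fun _ hv => Submodule.mem_div_iff_forall_mul_mem.2 fun y hy =>
    Submodule.mem_div_iff_forall_mul_mem.1 hv y (h hy)

theorem le_div_div (K F : Submodule A V) : F ≤ K / (K / F) := by
  rw [Submodule.le_div_iff_mul_le, mul_comm, ← Submodule.le_div_iff_mul_le]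

theorem div_one_eq (K : Submodule A V) : K / 1 = K := by
  ext x
  rw [Submodule.mem_div_iff_forall_mul_mem]
  constructor
  · intro h
    simpa using h 1 (Submodule.one_le.1 le_rfl)
  · intro h y hy
    obtain ⟨r, rfl⟩ := Submodule.mem_one.1 hy
    rw [mul_comm, ← Algebra.smul_def]
    exact K.smul_mem r h

variable [IsLocalRing A]

variable (A V) in
/-- The maximal ideal of `A` as a submodule of `V`. -/
def maximalSubmodule : Submodule A V :=
  Submodule.map (Algebra.linearMap A V) (IsLocalRing.maximalIdeal A)

/-- The module `K : 𝔪`. -/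
def socleHull (K : Submodule A V) : Submodule A V :=
  K / maximalSubmodule A V

/-- The module `(K : 𝔪) / K` has length one. -/
def HasTypeOne (K : Submodule A V) : Prop :=
  relLength K (socleHull K) = 1

theorem mem_socleHull {K : Submodule A V} {v : V} :
    v ∈ socleHull K ↔ ∀ r ∈ IsLocalRing.maximalIdeal A, r • v ∈ K := by
  simp only [socleHull, maximalSubmodule, Submodule.mem_div_iff_forall_mul_mem]
  constructor
  · intro h r hr
    rw [Algebra.smul_def, mul_comm]
    exact h _ ⟨r, hr, rfl⟩
  · rintro h _ ⟨r, hr, rfl⟩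
    rw [mul_comm, Algebra.linearMap_apply, ← Algebra.smul_def]
    exact h r hr

theorem le_socleHull (K : Submodule A V) : K ≤ socleHull K :=
  fun _ hv => mem_socleHull.2 fun r _ => K.smul_mem r hv

end Fractional

section Fractional

variable {A V : Type*} [CommRing A] [CommRing V] [Algebra A V]

theorem algebraMap_mem_one (r : A) : algebraMap A V r ∈ (1 : Submodule A V) :=
  Submodule.mem_one.2 ⟨r, rfl⟩

theorem IsRegularFractional.one : IsRegularFractional (1 : Submodule A V) :=
  ⟨⟨1, one_mem _, fun v hv => by simpa using hv⟩, 1, Submodule.one_le.1 le_rfl, isUnit_one⟩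

theorem IsRegularFractional.mul {F G : Submodule A V} (hF : IsRegularFractional F)
    (hG : IsRegularFractional G) : IsRegularFractional (F * G) := by
  obtain ⟨⟨b, hb, hbF⟩, u, hu, hu'⟩ := hF
  obtain ⟨⟨c, hc, hcG⟩, w, hw, hw'⟩ := hG
  refine ⟨⟨b * c, mul_mem hb hc, fun v hv => ?_⟩, u * w, Submodule.mul_mem_mul hu hw, hu'.mul hw'⟩
  induction hv using Submodule.mul_induction_on' with
  | mem_mul_mem x hx y hy =>
    have := Submodule.mul_mem_mul (hbF x hx) (hcG y hy)
    rwa [one_mul, smul_mul_smul_comm] at this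
  | add x _ y _ h1 h2 => rw [smul_add]; exact add_mem h1 h2

theorem IsRegularFractional.of_le_of_le {F G H : Submodule A V} (hF : IsRegularFractional F)
    (hH : IsRegularFractional H) (hFG : F ≤ G) (hGH : G ≤ H) : IsRegularFractional G := by
  obtain ⟨-, u, hu, hu'⟩ := hF
  obtain ⟨⟨c, hc, hcG⟩, -⟩ := hH
  exact ⟨⟨c, hc, fun v hv => hcG v (hGH hv)⟩, u, hFG hu, hu'⟩

theorem IsRegularFractional.span_unit {F : Submodule A V} (hF : IsRegularFractional F)
    {u : Vˣ} (hu : (u : V) ∈ F) : IsRegularFractional (Submodule.span A {(u : V)}) := by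
  obtain ⟨⟨b, hb, hbF⟩, -⟩ := hF
  refine ⟨⟨b, hb, fun v hv => hbF v ?_⟩, u, Submodule.mem_span_singleton_self _, u.isUnit⟩
  exact (Submodule.span_singleton_le_iff_mem _ _).2 hu hv

theorem scale_le {u : Vˣ} {c : A} (hu : (u : V) = algebraMap A V c) (F : Submodule A V) :
    Submodule.span A {(u : V)} * F ≤ F := by
  intro x hx
  obtain ⟨z, hz, rfl⟩ := Submodule.mem_span_singleton_mul.1 hx
  rw [hu, ← Algebra.smul_def]
  exact F.smul_mem c hz

theorem IsRegularFractional.scale {u : Vˣ} {c : A} (hu : (u : V) = algebraMap A V c)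
    {F : Submodule A V} (hF : IsRegularFractional F) :
    IsRegularFractional (Submodule.span A {(u : V)} * F) :=
  (IsRegularFractional.one.span_unit (hu ▸ algebraMap_mem_one c)).mul hF

variable [IsLocalRing A] [IsOneDimExtension A V]

/-- A unit of `V` in a regular fractional module is a quotient of two regular elements. -/
theorem IsRegularFractional.exists_smul_eq {F : Submodule A V} (hF : IsRegularFractional F)
    {u : V} (hu : u ∈ F) (hu' : IsUnit u) :
    ∃ b ∈ nonZeroDivisors A, ∃ c ∈ nonZeroDivisors A, b • u = algebraMap A V c := by
  obtain ⟨⟨b, hb, hbF⟩, -⟩ := hF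
  obtain ⟨c, hc⟩ := Submodule.mem_one.1 (hbF u hu)
  refine ⟨b, hb, c, ?_, hc.symm⟩
  have h1 : IsUnit (algebraMap A V c) := by
    rw [hc, Algebra.smul_def]
    exact (IsOneDimExtension.isUnit b hb).mul hu'
  rw [mem_nonZeroDivisors_iff_right]
  intro x hx
  apply IsOneDimExtension.injective (A := A) (V := V)
  rw [map_zero]
  exact (h1.mul_left_eq_zero).1 (by rw [← map_mul, hx, map_zero])

theorem IsRegularFractional.span_inv {F : Submodule A V} (hF : IsRegularFractional F)
    {u : Vˣ} (hu : (u : V) ∈ F) :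
    IsRegularFractional (Submodule.span A {((u⁻¹ : Vˣ) : V)}) := by
  obtain ⟨b, hb, c, hc, h⟩ := hF.exists_smul_eq hu u.isUnit
  refine ⟨⟨c, hc, fun v hv => ?_⟩, _, Submodule.mem_span_singleton_self _, (u⁻¹).isUnit⟩
  obtain ⟨r, rfl⟩ := Submodule.mem_span_singleton.1 hv
  rw [smul_comm]
  refine Submodule.smul_mem _ _ ?_
  rw [Algebra.smul_def, ← h, smul_mul_assoc, Units.mul_inv, ← Algebra.algebraMap_eq_smul_one]
  exact algebraMap_mem_one b

/-- A regular fractional module contains a multiple of any other one. -/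
theorem IsRegularFractional.exists_smul_le {F G : Submodule A V} (hF : IsRegularFractional F)
    (hG : IsRegularFractional G) :
    ∃ c ∈ nonZeroDivisors A, ∀ g ∈ G, c • g ∈ F := by
  obtain ⟨u, hu, hu'⟩ := hF.2
  obtain ⟨b, -, c, hc, h⟩ := hF.exists_smul_eq hu hu'
  obtain ⟨⟨d, hd, hdG⟩, -⟩ := hG
  refine ⟨c * d, mul_mem hc hd, fun g hg => ?_⟩
  obtain ⟨r, hr⟩ := Submodule.mem_one.1 (hdG g hg)
  rw [mul_smul, ← hr, Algebra.smul_def, mul_comm, ← Algebra.smul_def, ← h]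
  exact F.smul_mem r (F.smul_mem b hu)

theorem IsRegularFractional.div {F G : Submodule A V} (hF : IsRegularFractional F)
    (hG : IsRegularFractional G) : IsRegularFractional (F / G) := by
  refine ⟨?_, ?_⟩
  · obtain ⟨u, hu, hu'⟩ := hG.2
    obtain ⟨b, hb, c, hc, h⟩ := hG.exists_smul_eq hu hu'
    obtain ⟨d, hd, hdF⟩ := hF.1
    refine ⟨d * c, mul_mem hd hc, fun v hv => ?_⟩
    have h1 := hdF _ (Submodule.mem_div_iff_forall_mul_mem.1 hv u hu)
    have h2 : (d * c) • v = b • d • (v * u) := by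
      rw [mul_smul, Algebra.smul_def c v, ← h, smul_mul_assoc, smul_comm, mul_comm u v]
    rw [h2]
    exact Submodule.smul_mem _ _ h1
  · obtain ⟨c, hc, h⟩ := hF.exists_smul_le hG
    refine ⟨algebraMap A V c, ?_, IsOneDimExtension.isUnit c hc⟩
    rw [Submodule.mem_div_iff_forall_mul_mem]
    intro g hg
    rw [← Algebra.smul_def]
    exact h g hg

theorem isRegularFractional_maximalSubmodule : IsRegularFractional (maximalSubmodule A V) := by
  obtain ⟨x, hx, hx'⟩ := IsOneDimExtension.exists_mem (A := A) (V := V)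
  refine ⟨⟨1, one_mem _, ?_⟩, algebraMap A V x, ⟨x, hx, rfl⟩, IsOneDimExtension.isUnit x hx'⟩
  rintro _ ⟨r, -, rfl⟩
  rw [one_smul]
  exact algebraMap_mem_one r

theorem IsRegularFractional.socleHull {F : Submodule A V} (hF : IsRegularFractional F) :
    IsRegularFractional (socleHull F) :=
  hF.div isRegularFractional_maximalSubmodule

theorem IsRegularFractional.fg [IsNoetherianRing A] {F : Submodule A V}
    (hF : IsRegularFractional F) : Module.Finite A F := by
  obtain ⟨b, hb, h⟩ := hF.1
  let e : F →ₗ[A] (1 : Submodule A V) :=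
    ((LinearMap.lsmul A V b).comp F.subtype).codRestrict 1 fun v => h v v.2
  have he : Function.Injective e := by
    intro x y hxy
    have h1 : b • (x : V) = b • (y : V) := congrArg Subtype.val hxy
    rw [Algebra.smul_def, Algebra.smul_def] at h1
    exact Subtype.ext ((IsOneDimExtension.isUnit b hb).mul_left_cancel h1)
  have : IsNoetherian A (1 : Submodule A V) := by
    rw [Submodule.one_eq_range]
    infer_instance
  exact Module.Finite.of_injective e he

/-- Some regular `c` has `cG ⊆ F`, so the quotient is a finitely generated module over `A/c`, which
has finite length. -/
theorem relLength_ne_top [IsNoetherianRing A] {F G : Submodule A V}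
    (hF : IsRegularFractional F) (hG : IsRegularFractional G) : relLength F G ≠ ⊤ := by
  obtain ⟨c, hc, h⟩ := hF.exists_smul_le hG
  have := hG.fg
  rw [relLength, Module.length_ne_top_iff]
  refine isFiniteLength_of_smul_eq_zero (IsOneDimExtension.isFiniteLength (V := V) c hc) ?_
  intro m
  obtain ⟨g, rfl⟩ := Submodule.Quotient.mk_surjective _ m
  exact (Submodule.Quotient.mk_eq_zero (F.submoduleOf G)).2 (h g g.2)

end Fractional

/-! ### Canonical duality `F ↦ K : F` for `K` of type one -/

section Duality

variable {A V : Type*} [CommRing A] [CommRing V] [Algebra A V] [IsLocalRing A]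

/-- Multiplication by `e` sends `K : F` into `K : 𝔪`, and what lands in `K` multiplies `F + Ae` into
`K`. The quotient thus embeds in `(K : 𝔪)/K`. -/
theorem HasTypeOne.relLength_div_sup_span_singleton_le {K F : Submodule A V} (hK : HasTypeOne K)
    {e : V} (he : ∀ r ∈ IsLocalRing.maximalIdeal A, r • e ∈ F) :
    relLength (K / (F ⊔ Submodule.span A {e})) (K / F) ≤ 1 := by
  rw [← hK, relLength]
  let φ : ↥(K / F) →ₗ[A] ↥(socleHull K) :=
    ((LinearMap.mulRight A e).comp (K / F).subtype).codRestrict _ fun v =>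
      mem_socleHull.2 fun r hr => by
        have := Submodule.mem_div_iff_forall_mul_mem.1 v.2 _ (he r hr)
        rwa [mul_smul_comm] at this
  refine relLength_le_length_of_ker ((K.submoduleOf (socleHull K)).mkQ ∘ₗ φ) ?_
  intro v hv
  have h : (v : V) * e ∈ K := (Submodule.Quotient.mk_eq_zero (K.submoduleOf _)).1 hv
  rw [Submodule.mem_div_iff_forall_mul_mem]
  intro y hy
  obtain ⟨f, hf, z, hz, rfl⟩ := Submodule.mem_sup.1 hy
  obtain ⟨r, rfl⟩ := Submodule.mem_span_singleton.1 hz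
  rw [mul_add, mul_smul_comm]
  exact add_mem (Submodule.mem_div_iff_forall_mul_mem.1 v.2 f hf) (K.smul_mem r h)

variable [IsNoetherianRing A]

/-- Induction along a chain from `F` to `G` with steps of length one, each of which contributes at
most one on the dual side. -/
theorem HasTypeOne.relLength_div_le {K F G : Submodule A V} (hK : HasTypeOne K) (hFG : F ≤ G)
    (hfin : relLength F G ≠ ⊤) : relLength (K / G) (K / F) ≤ relLength F G := by
  obtain ⟨n, hn⟩ := ENat.ne_top_iff_exists.1 hfin
  induction n generalizing F with
  | zero =>
    rw [eq_of_relLength_eq_zero hFG hn.symm, relLength_eq_zero_iff.2 le_rfl]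
    exact zero_le
  | succ n ih =>
    have hne : ¬ G ≤ F := fun h => by
      rw [relLength_eq_zero_iff.2 h] at hn
      exact absurd hn (by simp)
    obtain ⟨e, heG, heF, he⟩ := exists_socle_element hne hfin
    have h1 := relLength_sup_span_singleton heF he
    have hle : F ⊔ Submodule.span A {e} ≤ G :=
      sup_le hFG ((Submodule.span_singleton_le_iff_mem _ _).2 heG)
    have h2 := relLength_add (le_sup_left : F ≤ F ⊔ Submodule.span A {e}) hle
    rw [h1, ← hn] at h2
    have h3 : (n : ℕ∞) = relLength (F ⊔ Submodule.span A {e}) G := by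
      have h4 : (1 : ℕ∞) + n = 1 + relLength (F ⊔ Submodule.span A {e}) G := by
        rw [← h2]; push_cast; rw [add_comm]
      exact ENat.add_right_injective_of_ne_top (by decide) h4
    have h5 := ih hle (by rw [← h3]; exact ENat.natCast_ne_top n) h3
    rw [relLength_add (div_anti K hle) (div_anti K le_sup_left), ← hn, ← h3] at *
    push_cast
    exact add_le_add h5 (hK.relLength_div_sup_span_singleton_le he)

variable [IsOneDimExtension A V]

/-- With `u` the image of `c`, the length of `G/uF` can be computed through `F` or through `uG`.
Since `uG/uF` has the length of `G/F`, this finite term cancels. -/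
theorem relLength_scale_self_of_le {u : Vˣ} {c : A} (hu : (u : V) = algebraMap A V c)
    {F G : Submodule A V} (hF : IsRegularFractional F) (hG : IsRegularFractional G) (h : F ≤ G) :
    relLength (Submodule.span A {(u : V)} * F) F = relLength (Submodule.span A {(u : V)} * G) G := by
  have h1 := relLength_add (scale_le hu F) h
  have h2 := relLength_add (mul_le_mul_right h (Submodule.span A {(u : V)})) (scale_le hu G)
  rw [h1, relLength_scale, add_comm] at h2
  exact ENat.add_right_injective_of_ne_top (relLength_ne_top hF hG) h2

/-- The multiplicity `ℓ(F / cF)` is the same for all regular fractional modules `F`. -/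
theorem relLength_scale_self {u : Vˣ} {c : A} (hu : (u : V) = algebraMap A V c)
    {F G : Submodule A V} (hF : IsRegularFractional F) (hG : IsRegularFractional G) :
    relLength (Submodule.span A {(u : V)} * F) F = relLength (Submodule.span A {(u : V)} * G) G := by
  obtain ⟨d, hd, h⟩ := hF.exists_smul_le hG
  obtain ⟨w, hw⟩ := IsOneDimExtension.isUnit (V := V) d hd
  have hle : Submodule.span A {(w : V)} * G ≤ F := by
    intro x hx
    obtain ⟨z, hz, rfl⟩ := Submodule.mem_span_singleton_mul.1 hx
    rw [hw, ← Algebra.smul_def]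
    exact h z hz
  rw [← relLength_scale_self_of_le hu (hG.scale hw) hF hle, mul_left_comm, relLength_scale]

/-- Duality with respect to a regular fractional module of type one. -/
theorem HasTypeOne.relLength_div {K F G : Submodule A V} (hK : HasTypeOne K)
    (hK' : IsRegularFractional K) (hF : IsRegularFractional F) (hG : IsRegularFractional G)
    (hFG : F ≤ G) : relLength (K / G) (K / F) = relLength F G := by
  obtain ⟨c, hc, h⟩ := hF.exists_smul_le hG
  obtain ⟨u, hu⟩ := IsOneDimExtension.isUnit (V := V) c hc
  have hle : Submodule.span A {(u : V)} * G ≤ F := by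
    intro x hx
    obtain ⟨z, hz, rfl⟩ := Submodule.mem_span_singleton_mul.1 hx
    rw [hu, ← Algebra.smul_def]
    exact h z hz
  have hcG := hG.scale hu
  -- The pair `uG ⊆ G` satisfies the equality, because multiplicities do not depend on the module.
  -- As `F` lies in between, the inequalities for `uG ⊆ F` and `F ⊆ G` add up to this equality, so
  -- both are equalities.
  have h1 : relLength (K / G) (K / (Submodule.span A {(u : V)} * G)) =
      relLength (Submodule.span A {(u : V)} * G) G := by
    rw [← relLength_scale_self hu (hK'.div hG) hG, div_scale, ← relLength_scale u (K / G),
      ← mul_assoc, span_unit_mul_span_inv, one_mul]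
  rw [relLength_add hle hFG, relLength_add (div_anti K hFG) (div_anti K hle), add_comm] at h1
  have h2 := hK.relLength_div_le hle (relLength_ne_top hcG hF)
  have h3 := hK.relLength_div_le hFG (relLength_ne_top hF hG)
  have h4 := relLength_ne_top hF hG
  have h5 := relLength_ne_top hcG hF
  refine le_antisymm h3 ?_
  generalize relLength F G = a at *
  generalize relLength (Submodule.span A {(u : V)} * G) F = b at *
  generalize relLength (K / G) (K / F) = a' at *
  lift a to ℕ using h4
  lift b to ℕ using h5
  have h6 := (ENat.natCast_toNat (ne_top_of_le_ne_top (ENat.natCast_ne_top a) h3))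
  have h7 := (ENat.natCast_toNat (ne_top_of_le_ne_top (ENat.natCast_ne_top b) h2))
  rw [← h6] at h1 h3 ⊢
  rw [← h7] at h1 h2
  norm_cast at *
  omega

/-- `F` and its bidual have the same dual, so duality gives their quotient length zero. -/
theorem HasTypeOne.div_div {K F : Submodule A V} (hK : HasTypeOne K)
    (hK' : IsRegularFractional K) (hF : IsRegularFractional F) : K / (K / F) = F := by
  have hFF := hK'.div (hK'.div hF)
  have h := hK.relLength_div hK' hF hFF (le_div_div K F)
  have h1 : K / (K / (K / F)) = K / F :=
    le_antisymm (div_anti K (le_div_div K F)) (le_div_div K (K / F))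
  rw [h1, relLength_eq_zero_iff.2 le_rfl] at h
  exact (eq_of_relLength_eq_zero (le_div_div K F) h.symm).symm

theorem HasTypeOne.div_self {K : Submodule A V} (hK : HasTypeOne K)
    (hK' : IsRegularFractional K) : K / K = 1 := by
  have := hK.div_div hK' IsRegularFractional.one
  rwa [div_one_eq] at this

theorem HasTypeOne.div_socleHull {K : Submodule A V} (hK : HasTypeOne K)
    (hK' : IsRegularFractional K) : K / socleHull K = maximalSubmodule A V :=
  hK.div_div hK' isRegularFractional_maximalSubmodule

theorem HasTypeOne.eq_of_div_eq {K F G : Submodule A V} (hK : HasTypeOne K)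
    (hK' : IsRegularFractional K) (hF : IsRegularFractional F) (hG : IsRegularFractional G)
    (h : K / F = K / G) : F = G := by
  rw [← hK.div_div hK' hF, h, hK.div_div hK' hG]

end Duality

/-! ### Units from an infinite residue field -/

section Avoidance

variable {A B : Type*} [CommRing A] [CommRing B] [Algebra A B] [IsLocalRing A]

theorem finite_setOf_isMaximal [Module.Finite A B] : {M : Ideal B | M.IsMaximal}.Finite := by
  refine (Algebra.QuasiFinite.finite_primesOver (S := B) (IsLocalRing.maximalIdeal A)).subset ?_
  intro M (hM : M.IsMaximal)
  refine ⟨hM.isPrime, ⟨?_⟩⟩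
  have := Ideal.isMaximal_comap_of_isIntegral_of_isMaximal (R := A) M
  exact (IsLocalRing.eq_maximalIdeal this).symm

variable [Infinite (IsLocalRing.ResidueField A)]

/-- Pigeonhole: otherwise two scalars with different residues put `u + cv` into the same ideal of
the finite set. Their difference is a unit, so that ideal contains `v`, hence also `u`. -/
theorem exists_forall_add_smul_notMem {s : Set (Ideal B)} (hs : s.Finite) (u v : B)
    (h : ∀ M ∈ s, u ∉ M ∨ v ∉ M) : ∃ c : A, ∀ M ∈ s, u + c • v ∉ M := by
  by_contra! hc
  choose φ hφ hmem using hc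
  have := hs.to_subtype
  obtain ⟨a, b, hab, heq⟩ := Finite.exists_ne_map_eq_of_infinite
    (fun k : IsLocalRing.ResidueField A =>
      (⟨φ (Function.surjInv IsLocalRing.residue_surjective k), hφ _⟩ : s))
  set a' := Function.surjInv (IsLocalRing.residue_surjective (R := A)) a with ha'
  set b' := Function.surjInv (IsLocalRing.residue_surjective (R := A)) b with hb'
  have heq' : φ a' = φ b' := congrArg Subtype.val heq
  have hunit : IsUnit (a' - b') := by
    rw [← IsLocalRing.residue_ne_zero_iff_isUnit, map_sub, ha', hb', Function.surjInv_eq IsLocalRing.residue_surjective,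
      Function.surjInv_eq IsLocalRing.residue_surjective, sub_ne_zero]
    exact hab
  have h1 := hmem a'
  have h2 := hmem b'
  rw [← heq'] at h2
  have h3 : (a' - b') • v ∈ φ a' := by
    have := (φ a').sub_mem h1 h2
    rwa [add_sub_add_left_eq_sub, ← sub_smul] at this
  have h4 : v ∈ φ a' := by
    rw [Algebra.smul_def] at h3
    exact ((φ a').unit_mul_mem_iff_mem (hunit.map (algebraMap A B))).1 h3
  have h5 : u ∈ φ a' := by
    rw [Algebra.smul_def] at h1
    exact ((φ a').add_mem_iff_left ((φ a').mul_mem_left _ h4)).1 h1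
  rcases h _ (hφ a') with h6 | h6
  · exact h6 h5
  · exact h6 h4

theorem exists_mem_forall_notMem {s : Set (Ideal B)} (hs : s.Finite) (K : Submodule A B)
    (h : ∀ M ∈ s, ∃ x ∈ K, x ∉ M) : ∃ u ∈ K, ∀ M ∈ s, u ∉ M := by
  induction s, hs using Set.Finite.induction_on with
  | empty => exact ⟨0, K.zero_mem, by simp⟩
  | @insert M s _ hs ih =>
    obtain ⟨u, hu, hu'⟩ := ih fun M hM => h M (Set.mem_insert_of_mem _ hM)
    obtain ⟨v, hv, hv'⟩ := h M (Set.mem_insert _ _)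
    obtain ⟨c, hc⟩ := exists_forall_add_smul_notMem (A := A) (hs.insert M) u v (by
      rintro N (rfl | hN)
      · exact Or.inr hv'
      · exact Or.inl (hu' N hN))
    exact ⟨_, K.add_mem hu (K.smul_mem c hv), hc⟩

theorem exists_isUnit_mem [Module.Finite A B] (K : Submodule A B)
    (h : ∀ M : Ideal B, M.IsMaximal → ∃ x ∈ K, x ∉ M) : ∃ u ∈ K, IsUnit u := by
  obtain ⟨u, hu, hu'⟩ := exists_mem_forall_notMem (finite_setOf_isMaximal (A := A)) K h
  exact ⟨u, hu, not_not.1 fun hn =>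
    let ⟨M, hM, huM⟩ := exists_max_ideal_of_mem_nonunits hn; hu' M hM huM⟩

theorem exists_isUnit_add_smul_one [Module.Finite A B] (e : B) :
    ∃ c : A, IsUnit (e + c • (1 : B)) := by
  obtain ⟨c, hc⟩ := exists_forall_add_smul_notMem (A := A) (finite_setOf_isMaximal (A := A)
    (B := B)) e 1 (fun M (hM : M.IsMaximal) => Or.inr ((Ideal.ne_top_iff_one M).1 hM.ne_top))
  exact ⟨c, not_not.1 fun hn =>
    let ⟨M, hM, huM⟩ := exists_max_ideal_of_mem_nonunits hn; hc M hM huM⟩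

end Avoidance

/-! ### Fractional modules that are rings -/

section FractionalRing

variable {A V : Type*} [CommRing A] [CommRing V] [Algebra A V]

theorem scale_eq_self {C : Submodule A V} (hC : C * C = C) {u : Vˣ} (hu : (u : V) ∈ C)
    (hu' : ((u⁻¹ : Vˣ) : V) ∈ C) : Submodule.span A {(u : V)} * C = C := by
  refine le_antisymm ?_ ?_
  · conv_rhs => rw [← hC]
    exact mul_le_mul_left ((Submodule.span_singleton_le_iff_mem _ _).2 hu) C
  · intro x hx
    rw [mem_scale, ← hC]
    exact Submodule.mul_mem_mul hu' hx

variable [IsLocalRing A] [IsNoetherianRing A] [IsOneDimExtension A V]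

/-- If `b` were in `𝔪`, then `C = bC ⊆ 𝔪C`, and Nakayama would give `C = 0`. -/
theorem isUnit_of_mul_eq_one_of_mem {C : Submodule A V} (h1 : 1 ∈ C) (hC : C * C = C)
    (hC' : IsRegularFractional C) {b : A} {y : V} (hy : y ∈ C) (hby : algebraMap A V b * y = 1) :
    IsUnit b := by
  by_contra hb
  have := hC'.fg
  have h2 : C ≤ IsLocalRing.maximalIdeal A • C := by
    intro x hx
    have h3 : x = b • (y * x) := by
      rw [Algebra.smul_def, ← mul_assoc, hby, one_mul]
    rw [h3]
    refine Submodule.smul_mem_smul ((IsLocalRing.mem_maximalIdeal b).2 hb) ?_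
    rw [← hC]
    exact Submodule.mul_mem_mul hy hx
  have h4 := Submodule.eq_bot_of_le_smul_of_le_jacobson_bot _ C
    (Module.Finite.iff_fg.1 this) h2 (IsLocalRing.maximalIdeal_le_jacobson _)
  rw [h4, Submodule.mem_bot] at h1
  apply hb
  have h5 : algebraMap A V b = algebraMap A V 0 := by
    rw [map_zero, ← mul_one (algebraMap A V b), h1, mul_zero]
  have h6 : (1 : A) = 0 := IsOneDimExtension.injective (A := A) (V := V) (by
    rw [map_one, map_zero, h1])
  exact absurd h6 one_ne_zero

variable [Infinite (IsLocalRing.ResidueField A)]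

/-- Because `K` generates the unit ideal of the semilocal ring `C`, no maximal ideal of `C` contains
it, and avoidance finds an element of `K` outside all of them. -/
theorem exists_unit_mem_of_mul_eq {K C : Submodule A V} (h1 : 1 ∈ C) (hC : C * C = C)
    (hC' : IsRegularFractional C) (hKC : K ≤ C) (hK : K * C = C) :
    ∃ u : Vˣ, (u : V) ∈ K ∧ ((u⁻¹ : Vˣ) : V) ∈ C := by
  let B : Subalgebra A V := C.toSubalgebra h1 fun x y hx hy => hC ▸ Submodule.mul_mem_mul hx hy
  have : Module.Finite A B := hC'.fg
  obtain ⟨u, hu, hu'⟩ := exists_isUnit_mem (K.comap B.val.toLinearMap) (by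
    intro M hM
    by_contra! h
    apply hM.ne_top
    rw [Ideal.eq_top_iff_one]
    have h2 : ∀ x (hx : x ∈ K * C), (⟨x, hK.le hx⟩ : B) ∈ M := by
      intro x hx
      induction hx using Submodule.mul_induction_on' with
      | mem_mul_mem x hx y hy =>
        exact M.mul_mem_right (⟨y, hy⟩ : B) (h ⟨x, hKC hx⟩ hx)
      | add x hx y hy h3 h4 => exact M.add_mem h3 h4
    exact h2 1 (hK.symm ▸ h1))
  obtain ⟨w, rfl⟩ := hu'
  refine ⟨Units.map B.val.toMonoidHom w, hu, ?_⟩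
  exact ((w⁻¹ : Bˣ) : B).2

theorem exists_unit_add_smul_one {C : Submodule A V} (h1 : 1 ∈ C) (hC : C * C = C)
    (hC' : IsRegularFractional C) {e : V} (he : e ∈ C) :
    ∃ (c : A) (u : Vˣ), (u : V) = e + c • (1 : V) ∧ ((u⁻¹ : Vˣ) : V) ∈ C := by
  let B : Subalgebra A V := C.toSubalgebra h1 fun x y hx hy => hC ▸ Submodule.mul_mem_mul hx hy
  have : Module.Finite A B := hC'.fg
  obtain ⟨c, w, hw⟩ := exists_isUnit_add_smul_one (A := A) (⟨e, he⟩ : B)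
  refine ⟨c, Units.map B.val.toMonoidHom w, ?_, ((w⁻¹ : Bˣ) : B).2⟩
  exact congrArg Subtype.val hw

end FractionalRing

/-! ### Rescaling canonical fractional ideals -/

section TypeOne

variable {A V : Type*} [CommRing A] [CommRing V] [Algebra A V]

variable (A V) in
/-- The fractional form of the `n`-Goto property in dimension one: there is a canonical fractional
ideal `K` containing `1` with `K ^ 2 = K ^ 3` such that `K ^ 2 / K` has length `n`. -/
def IsFractionalGoto [IsLocalRing A] (n : ℕ) : Prop :=
  ∃ K : Submodule A V, 1 ∈ K ∧ IsRegularFractional K ∧ HasTypeOne K ∧ K * K * K = K * K ∧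
    relLength K (K * K) = n

theorem eq_of_scale_eq {u : Vˣ} {F G : Submodule A V}
    (h : Submodule.span A {(u : V)} * F = G) : F = Submodule.span A {((u⁻¹ : Vˣ) : V)} * G := by
  rw [← h, ← mul_assoc, span_inv_mul_span_unit, one_mul]

theorem scale_cancel {u : Vˣ} {F G : Submodule A V}
    (h : Submodule.span A {(u : V)} * F = Submodule.span A {(u : V)} * G) : F = G := by
  rw [eq_of_scale_eq h, ← mul_assoc, span_inv_mul_span_unit, one_mul]

theorem mul_mul_self_eq {L : Submodule A V} (hL : L * L * L = L * L) : L * L * (L * L) = L * L := by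
  rw [← mul_assoc, hL, hL]

theorem mul_le_of_one_mem {F G : Submodule A V} (h : 1 ∈ F) : G ≤ G * F := fun x hx => by
  simpa using Submodule.mul_mem_mul hx h

variable [IsLocalRing A]

theorem socleHull_scale (u : Vˣ) (K : Submodule A V) :
    socleHull (Submodule.span A {(u : V)} * K) = Submodule.span A {(u : V)} * socleHull K :=
  scale_div u K _

theorem HasTypeOne.scale {K : Submodule A V} (hK : HasTypeOne K) (u : Vˣ) :
    HasTypeOne (Submodule.span A {(u : V)} * K) := by
  rw [HasTypeOne, socleHull_scale, relLength_scale]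
  exact hK

theorem maximalSubmodule_le_one : maximalSubmodule A V ≤ 1 := by
  rintro _ ⟨r, -, rfl⟩
  exact algebraMap_mem_one r

theorem socleHull_mul_maximalSubmodule_le (K : Submodule A V) :
    socleHull K * maximalSubmodule A V ≤ K :=
  Submodule.le_div_iff_mul_le.1 le_rfl

theorem exists_isUnit_of_not_le {F : Submodule A V} (h1 : F ≤ 1)
    (h2 : ¬ F ≤ maximalSubmodule A V) : ∃ a : A, IsUnit a ∧ algebraMap A V a ∈ F := by
  obtain ⟨x, hx, hx'⟩ := SetLike.not_le_iff_exists.1 h2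
  obtain ⟨a, rfl⟩ := Submodule.mem_one.1 (h1 hx)
  refine ⟨a, not_not.1 fun ha => hx' ⟨a, ?_, rfl⟩, hx⟩
  exact (IsLocalRing.mem_maximalIdeal a).2 ha

/-- If the product of two submodules lies in `A` but not in `𝔪`, then both are principal. -/
theorem exists_scale_eq_one {F G : Submodule A V} (h1 : F * G ≤ 1)
    (h2 : ¬ F * G ≤ maximalSubmodule A V) :
    ∃ u : Vˣ, (u : V) ∈ F ∧ Submodule.span A {(u : V)} * G = 1 := by
  have h3 : ∃ x ∈ F, ∃ y ∈ G, x * y ∉ maximalSubmodule A V := by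
    by_contra! h
    exact h2 (Submodule.mul_le.2 h)
  obtain ⟨x, hx, y, hy, hxy⟩ := h3
  have h4 : Submodule.span A {x * y} ≤ 1 :=
    (Submodule.span_singleton_le_iff_mem _ _).2 (h1 (Submodule.mul_mem_mul hx hy))
  obtain ⟨a, ha, ha'⟩ := exists_isUnit_of_not_le h4 fun h =>
    hxy (h (Submodule.mem_span_singleton_self _))
  obtain ⟨r, hr⟩ := Submodule.mem_span_singleton.1 ha'
  have hu : IsUnit x := by
    have h5 : IsUnit (algebraMap A V r * (x * y)) := by
      rw [← Algebra.smul_def, hr]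
      exact ha.map _
    exact isUnit_of_mul_isUnit_left (isUnit_of_mul_isUnit_right h5)
  obtain ⟨u, rfl⟩ := hu
  refine ⟨u, hx, le_antisymm ?_ ?_⟩
  · refine le_trans ?_ h1
    exact mul_le_mul_left ((Submodule.span_singleton_le_iff_mem _ _).2 hx) G
  · obtain ⟨b, rfl⟩ := ha
    rw [Submodule.one_le]
    have h6 : (1 : V) = ((b⁻¹ : Aˣ) : A) • r • ((u : V) * y) := by
      rw [hr, Algebra.smul_def, ← map_mul, Units.inv_mul, map_one]
    rw [h6]
    exact Submodule.smul_mem _ _ (Submodule.smul_mem _ _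
      (Submodule.mul_mem_mul (Submodule.mem_span_singleton_self _) hy))

theorem HasTypeOne.exists_mem_notMem {K : Submodule A V} (hK : HasTypeOne K) :
    ∃ e ∈ socleHull K, e ∉ K :=
  SetLike.not_le_iff_exists.1 (not_le_of_relLength_eq_one hK)

variable [IsNoetherianRing A] [IsOneDimExtension A V]

/-- For a regular `c ∈ 𝔪`, the nonzero module `c⁻¹A/A` has finite length, so it has a socle. -/
theorem exists_mem_socleHull_one_notMem :
    ∃ e ∈ socleHull (1 : Submodule A V), e ∉ (1 : Submodule A V) := by
  obtain ⟨c, hc, hc'⟩ := IsOneDimExtension.exists_mem (A := A) (V := V)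
  obtain ⟨u, hu⟩ := IsOneDimExtension.isUnit (V := V) c hc'
  have h1 : IsRegularFractional (Submodule.span A {((u⁻¹ : Vˣ) : V)}) :=
    IsRegularFractional.one.span_inv (hu ▸ algebraMap_mem_one c)
  obtain ⟨e, -, he, he'⟩ := exists_socle_element (F := (1 : Submodule A V))
    (G := Submodule.span A {((u⁻¹ : Vˣ) : V)}) (fun h => by
      obtain ⟨b, hb⟩ := Submodule.mem_one.1 (h (Submodule.mem_span_singleton_self _))
      have h2 : algebraMap A V (c * b) = algebraMap A V 1 := by
        rw [map_mul, hb, ← hu, Units.mul_inv, map_one]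
      have h3 := IsOneDimExtension.injective h2
      exact (IsLocalRing.mem_maximalIdeal c).1 hc (IsUnit.of_mul_eq_one b h3))
    (relLength_ne_top .one h1)
  exact ⟨e, mem_socleHull.2 he', he⟩

/-- If `𝔪` has type one and `𝔪 : 𝔪 = A`, then `𝔪` is principal. -/
theorem exists_scale_maximalSubmodule_eq_one
    (h : maximalSubmodule A V / maximalSubmodule A V = 1) :
    ∃ u : Vˣ, Submodule.span A {(u : V)} * maximalSubmodule A V = 1 := by
  obtain ⟨e, he, he'⟩ := exists_mem_socleHull_one_notMem (A := A) (V := V)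
  -- The product `(A : 𝔪)𝔪` lies in `A`. If it lay in `𝔪`, then `A : 𝔪` would be inside `𝔪 : 𝔪 = A`,
  -- contradicting the choice of `e`.
  obtain ⟨u, -, hu⟩ := exists_scale_eq_one
    (socleHull_mul_maximalSubmodule_le (1 : Submodule A V)) (fun hle => by
    rw [← Submodule.le_div_iff_mul_le, h] at hle
    exact he' (hle he))
  exact ⟨u, hu⟩

/-- For a canonical fractional ideal `K` with `L = K : 𝔪` such that `L ^ 2` is a ring, either
`K L = L ^ 2`, or `L = A` and `K = 𝔪` is principal. -/
theorem HasTypeOne.mul_socleHull_eq_or {K : Submodule A V} (hK : HasTypeOne K)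
    (hK' : IsRegularFractional K)
    (hL : socleHull K * socleHull K * socleHull K = socleHull K * socleHull K) :
    K * socleHull K = socleHull K * socleHull K ∨
      (socleHull K = 1 ∧ K = maximalSubmodule A V ∧ HasTypeOne (1 : Submodule A V)) := by
  by_cases heq : K * socleHull K = socleHull K * socleHull K
  · exact Or.inl heq
  right
  have hL' := hK'.socleHull
  -- The `K`-duals of `KL` and `L²` are `𝔪 : K` and `𝔪 : L`, so `KL ≠ L²` makes these different.
  have h1 : ¬ maximalSubmodule A V / K ≤ maximalSubmodule A V / socleHull K := by
    intro h
    apply heq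
    refine hK.eq_of_div_eq hK' (hK'.mul hL') (hL'.mul hL') ?_
    rw [mul_comm K, ← div_div_eq, ← div_div_eq, hK.div_socleHull hK']
    exact le_antisymm h (div_anti _ (le_socleHull K))
  -- The product `(𝔪 : K)L` maps `K` into `𝔪L ⊆ K`, so it lies in `K : K = A`; by the previous step
  -- it is not inside `𝔪`.
  obtain ⟨u, -, hu⟩ := exists_scale_eq_one (F := maximalSubmodule A V / K) (G := socleHull K)
    (by
      rw [← hK.div_self hK', Submodule.le_div_iff_mul_le, mul_assoc, mul_comm (socleHull K),
        ← mul_assoc]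
      refine le_trans (mul_le_mul_left (Submodule.le_div_iff_mul_le.1 le_rfl) _) ?_
      rw [mul_comm]
      exact socleHull_mul_maximalSubmodule_le K)
    (by rwa [← Submodule.le_div_iff_mul_le])
  -- `L = u⁻¹A` is principal, and `L³ = L²` then forces `L = A`.
  have hL1 : socleHull K = 1 := by
    have h2 : Submodule.span A {(u : V)} * (Submodule.span A {(u : V)} *
        (socleHull K * socleHull K * socleHull K)) = Submodule.span A {(u : V)} *
        (Submodule.span A {(u : V)} * (socleHull K * socleHull K)) := by rw [hL]
    have h3 : Submodule.span A {(u : V)} * (Submodule.span A {(u : V)} *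
        (socleHull K * socleHull K)) = 1 := by
      rw [← mul_assoc (Submodule.span A {(u : V)}) (socleHull K), hu, one_mul, hu]
    rwa [h3, ← mul_assoc, ← mul_assoc, mul_assoc (Submodule.span A {(u : V)}), h3, one_mul] at h2
  have hKm : K = maximalSubmodule A V := by
    rw [← hK.div_socleHull hK', hL1, div_one_eq]
  refine ⟨hL1, hKm, ?_⟩
  -- Since `K = 𝔪`, also `𝔪 : 𝔪 = K : K = A`. Hence `𝔪` is principal, and `A` is a multiple of `K`.
  obtain ⟨w, hw⟩ := exists_scale_maximalSubmodule_eq_one (by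
    rw [← hKm, hK.div_self hK'] : maximalSubmodule A V / maximalSubmodule A V = 1)
  rw [← hw, ← hKm]
  exact hK.scale w

/-- The products `K ^ 2` and `K (K : 𝔪)` agree for a canonical fractional ideal `K` that is not
principal. -/
theorem HasTypeOne.mul_self_eq {K : Submodule A V} (hK : HasTypeOne K)
    (hK' : IsRegularFractional K) (h : 1 / K * K ≤ maximalSubmodule A V) :
    K * K = K * socleHull K := by
  -- The `K`-duals of the two sides are `A : K` and `𝔪 : K`. They agree because `(A : K)K ⊆ 𝔪`.
  refine hK.eq_of_div_eq hK' (hK'.mul hK') (hK'.mul hK'.socleHull) ?_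
  rw [mul_comm K (socleHull K), ← div_div_eq, ← div_div_eq, hK.div_self hK', hK.div_socleHull hK']
  exact le_antisymm (Submodule.le_div_iff_mul_le.2 h) fun x hx =>
    Submodule.mem_div_iff_forall_mul_mem.2 fun y hy =>
      maximalSubmodule_le_one (Submodule.mem_div_iff_forall_mul_mem.1 hx y hy)

variable [Infinite (IsLocalRing.ResidueField A)]

/-- If `L = K : 𝔪` contains `1` and `L ^ 2 = K L` is a ring, then either `K` is principal or it has
a multiple that shows the Goto property. -/
theorem HasTypeOne.hasTypeOne_one_or_isFractionalGoto {K : Submodule A V} (hK : HasTypeOne K)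
    (hK' : IsRegularFractional K) (h1 : 1 ∈ socleHull K)
    (hL : socleHull K * socleHull K * socleHull K = socleHull K * socleHull K)
    (hKL : K * socleHull K = socleHull K * socleHull K) {p : ℕ}
    (hp : relLength K (socleHull K * socleHull K) = p) :
    (HasTypeOne (1 : Submodule A V) ∧ p = 1) ∨ IsFractionalGoto A V p := by
  set L := socleHull K with hLdef
  have hC := mul_mul_self_eq hL
  have hC1 : (1 : V) ∈ L * L := by simpa using Submodule.mul_mem_mul h1 h1
  have hL' : IsRegularFractional L := hK'.socleHull
  have hC' := hL'.mul hL'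
  -- Here `C = L²` is a ring with `K·C = (KL)L = L³ = C`. Dividing by a unit of `C` that lies in `K`
  -- leaves `C` unchanged and brings `1` into `K`.
  obtain ⟨u, huK, huC⟩ := exists_unit_mem_of_mul_eq (K := K) hC1 hC hC'
    ((le_socleHull K).trans (mul_le_of_one_mem h1)) (by rw [← mul_assoc, hKL, hL])
  have huC' : (u : V) ∈ L * L := (le_socleHull K).trans (mul_le_of_one_mem h1) huK
  have hscale : Submodule.span A {((u⁻¹ : Vˣ) : V)} * (L * L) = L * L :=
    scale_eq_self hC huC (by rwa [inv_inv])
  set K₁ := Submodule.span A {((u⁻¹ : Vˣ) : V)} * K with hK₁def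
  set L₁ := Submodule.span A {((u⁻¹ : Vˣ) : V)} * L with hL₁def
  have hK₁ : HasTypeOne K₁ := hK.scale u⁻¹
  have hK₁' : IsRegularFractional K₁ := (hK'.span_inv huK).mul hK'
  have hL₁ : socleHull K₁ = L₁ := socleHull_scale _ _
  have h1K : (1 : V) ∈ K₁ := mem_scale.2 (by simpa using huK)
  have hLL : L₁ * L₁ = L * L := by
    rw [hL₁def, mul_mul_mul_comm, mul_assoc, hscale, hscale]
  have hKL₁ : K₁ * L₁ = L * L := by
    rw [hL₁def, hK₁def, mul_mul_mul_comm, mul_assoc, hKL, hscale, hscale]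
  have hp₁ : relLength K₁ (L * L) = p := by
    rw [← hscale, hK₁def, relLength_scale, hp]
  have hK₁L₁ : K₁ ≤ L * L := by
    rw [← hKL₁]
    exact mul_le_of_one_mem (hL₁ ▸ le_socleHull K₁ h1K)
  by_cases hle : 1 / K₁ * K₁ ≤ maximalSubmodule A V
  · right
    have h2 : K₁ * K₁ = L * L := by rw [hK₁.mul_self_eq hK₁' hle, hL₁, hKL₁]
    refine ⟨K₁, h1K, hK₁', hK₁, ?_, by rw [h2, hp₁]⟩
    rw [h2]
    refine le_antisymm ?_ (mul_le_of_one_mem h1K)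
    conv_rhs => rw [← hC]
    exact mul_le_mul_right hK₁L₁ _
  · left
    obtain ⟨x, -, hx⟩ := exists_scale_eq_one (Submodule.le_div_iff_mul_le.1 le_rfl) hle
    have h2 : K₁ = Submodule.span A {((x⁻¹ : Vˣ) : V)} := by rw [eq_of_scale_eq hx, mul_one]
    have h3 : (x : V) ∈ (1 : Submodule A V) := by
      rw [← hx]
      simpa using Submodule.mul_mem_mul (Submodule.mem_span_singleton_self (R := A) (x : V)) h1K
    obtain ⟨b, hb⟩ := Submodule.mem_one.1 h3
    -- In the principal case `K₁ = x⁻¹A`, where `x ∈ A` because `1 ∈ K₁`, and `x⁻¹` lies in the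
    -- finite ring `C`. So `x` is a unit of `A` and `K₁ = A`.
    have hbu : IsUnit b := isUnit_of_mul_eq_one_of_mem hC1 hC hC'
      (hK₁L₁ (h2 ▸ Submodule.mem_span_singleton_self _ : ((x⁻¹ : Vˣ) : V) ∈ K₁))
      (by rw [hb, Units.mul_inv])
    have h4 : K₁ = 1 := by
      refine scale_cancel (u := x) (hx.trans ?_)
      rw [mul_one, ← hb, Submodule.one_eq_span]
      obtain ⟨c, rfl⟩ := hbu
      refine le_antisymm ?_ ?_
      · rw [Submodule.span_singleton_le_iff_mem, Submodule.mem_span_singleton]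
        exact ⟨((c⁻¹ : Aˣ) : A), by rw [Algebra.smul_def, ← map_mul, Units.inv_mul, map_one]⟩
      · rw [Submodule.span_singleton_le_iff_mem, ← Submodule.one_eq_span]
        exact algebraMap_mem_one _
    rw [h4] at hK₁ hKL₁ hp₁ hL₁
    refine ⟨hK₁, ?_⟩
    rw [one_mul] at hKL₁
    rw [← hKL₁, ← hL₁] at hp₁
    exact_mod_cast hp₁.symm.trans hK₁

/-- A canonical fractional ideal `K` that contains `1` can be rescaled so that `1` belongs to
`K : 𝔪` but not to `K`. -/
theorem HasTypeOne.exists_normalized {K : Submodule A V} (hK : HasTypeOne K)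
    (hK' : IsRegularFractional K) (h1 : 1 ∈ K)
    (hC : socleHull K * socleHull K * (socleHull K * socleHull K) = socleHull K * socleHull K) :
    ∃ K₁ : Submodule A V, IsRegularFractional K₁ ∧ HasTypeOne K₁ ∧ 1 ∈ socleHull K₁ ∧ 1 ∉ K₁ ∧
      socleHull K₁ * socleHull K₁ = socleHull K * socleHull K ∧
      (K * socleHull K = socleHull K * socleHull K →
        K₁ * socleHull K₁ = socleHull K₁ * socleHull K₁) ∧
      relLength K₁ (socleHull K₁ * socleHull K₁) =
        relLength K (socleHull K * socleHull K) := by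
  set L := socleHull K with hLdef
  have h1L : (1 : V) ∈ L := le_socleHull K h1
  have hC1 : (1 : V) ∈ L * L := by simpa using Submodule.mul_mem_mul h1L h1L
  have hL' : IsRegularFractional L := hK'.socleHull
  obtain ⟨e, he, he'⟩ := hK.exists_mem_notMem
  -- With `e ∈ L` outside `K`, some `u = e + c` is a unit of `C = L²`. As `1 ∈ K`, it still lies in
  -- `L` but not in `K`; the new ideal is `u⁻¹K`.
  obtain ⟨c, u, hu, huC⟩ := exists_unit_add_smul_one hC1 hC (hL'.mul hL')
    (mul_le_of_one_mem h1L he)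
  have huL : (u : V) ∈ L := by
    rw [hu]
    exact L.add_mem he (L.smul_mem c h1L)
  have huK : (u : V) ∉ K := by
    rw [hu]
    exact fun h => he' ((K.add_mem_iff_left (K.smul_mem c h1)).1 h)
  have hscale : Submodule.span A {((u⁻¹ : Vˣ) : V)} * (L * L) = L * L :=
    scale_eq_self hC huC (by rw [inv_inv]; exact mul_le_of_one_mem h1L huL)
  have hL₁ : socleHull (Submodule.span A {((u⁻¹ : Vˣ) : V)} * K) =
      Submodule.span A {((u⁻¹ : Vˣ) : V)} * L := socleHull_scale _ _
  have hLL : Submodule.span A {((u⁻¹ : Vˣ) : V)} * L * (Submodule.span A {((u⁻¹ : Vˣ) : V)} * L) =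
      L * L := by
    rw [mul_mul_mul_comm, mul_assoc, hscale, hscale]
  refine ⟨Submodule.span A {((u⁻¹ : Vˣ) : V)} * K, (hL'.span_inv huL).mul hK', hK.scale _, ?_, ?_,
    ?_, ?_, ?_⟩
  · rw [hL₁, mem_scale]
    simpa using huL
  · rw [mem_scale]
    simpa using huK
  · rw [hL₁, hLL]
  · intro h
    rw [hL₁, hLL, mul_mul_mul_comm, mul_assoc, h, hscale, hscale]
  · rw [hL₁, hLL, ← relLength_scale u⁻¹ K, hscale]

/-- A principal `K` with `K³ = K²` is `A` and gives `p = 0`. So for `p > 0` one has `K² = KL`,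
whence `L² = K²`, and the rescaling that moves `1` from `K` into `L` only applies. -/
theorem IsFractionalGoto.exists_normalized {p : ℕ} (hp : 0 < p) (h : IsFractionalGoto A V p) :
    ∃ K : Submodule A V, IsRegularFractional K ∧ HasTypeOne K ∧ 1 ∈ socleHull K ∧ 1 ∉ K ∧
      socleHull K * socleHull K * (socleHull K * socleHull K) = socleHull K * socleHull K ∧
      K * socleHull K = socleHull K * socleHull K ∧
      relLength K (socleHull K * socleHull K) = p := by
  obtain ⟨K, h1, hK', hK, hKK, hlen⟩ := h
  have hle : 1 / K * K ≤ maximalSubmodule A V := by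
    by_contra hle
    obtain ⟨x, -, hx⟩ := exists_scale_eq_one (Submodule.le_div_iff_mul_le.1 le_rfl) hle
    have h2 : Submodule.span A {(x : V)} * (Submodule.span A {(x : V)} * (K * K)) = 1 := by
      rw [← mul_assoc (Submodule.span A {(x : V)}) K, hx, one_mul, hx]
    have h3 : K = 1 := by
      have h4 : Submodule.span A {(x : V)} * (Submodule.span A {(x : V)} * (K * K * K)) = K := by
        rw [← mul_assoc, ← mul_assoc, mul_assoc (Submodule.span A {(x : V)}), h2, one_mul]
      rw [← h4, hKK, h2]
    rw [h3, one_mul, relLength_eq_zero_iff.2 le_rfl] at hlen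
    exact hp.ne (by exact_mod_cast hlen)
  have hKL := hK.mul_self_eq hK' hle
  have hC := mul_mul_self_eq hKK
  have hLC : socleHull K ≤ K * K := by
    rw [hKL, mul_comm]
    exact mul_le_of_one_mem h1
  have hLL : socleHull K * socleHull K = K * K := by
    refine le_antisymm ?_ ?_
    · conv_rhs => rw [← hC]
      exact mul_le_mul' hLC hLC
    · exact mul_le_mul' (le_socleHull K) (le_socleHull K)
  obtain ⟨K₁, h2, h3, h4, h5, h6, h7, h8⟩ := hK.exists_normalized hK' h1 (by rw [hLL, hC])
  refine ⟨K₁, h2, h3, h4, h5, ?_, h7 (by rw [hLL, hKL]), ?_⟩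
  · rw [h6, hLL, hC]
  · rw [h8, hLL, hlen]

/-- A Gorenstein ring takes part with the number one. Either `A : 𝔪 = 𝔪 : 𝔪` is a ring and `A` gets
rescaled, or `𝔪` is principal and `K = 𝔪`, `K : 𝔪 = A` is already normalized. In the latter case `KL
= L²` fails, so that equality is not claimed. -/
theorem HasTypeOne.exists_normalized_of_one (h : HasTypeOne (1 : Submodule A V)) :
    ∃ K : Submodule A V, IsRegularFractional K ∧ HasTypeOne K ∧ 1 ∈ socleHull K ∧ 1 ∉ K ∧
      socleHull K * socleHull K * (socleHull K * socleHull K) = socleHull K * socleHull K ∧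
      relLength K (socleHull K * socleHull K) = 1 := by
  by_cases hle : socleHull (1 : Submodule A V) * maximalSubmodule A V ≤ maximalSubmodule A V
  · have hLL : socleHull (1 : Submodule A V) * socleHull (1 : Submodule A V) =
        socleHull (1 : Submodule A V) := by
      refine le_antisymm ?_ (mul_le_of_one_mem (le_socleHull 1 (Submodule.one_le.1 le_rfl)))
      refine Submodule.le_div_iff_mul_le.2 ?_
      rw [mul_assoc]
      exact (mul_le_mul_right hle _).trans (hle.trans maximalSubmodule_le_one)
    obtain ⟨K₁, h2, h3, h4, h5, h6, -, h8⟩ := h.exists_normalized .one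
      (Submodule.one_le.1 le_rfl) (by rw [hLL, hLL])
    refine ⟨K₁, h2, h3, h4, h5, by rw [h6, hLL, hLL], ?_⟩
    rw [h8, hLL]
    exact h
  · obtain ⟨x, -, hx⟩ := exists_scale_eq_one (socleHull_mul_maximalSubmodule_le 1) hle
    have hm : maximalSubmodule A V = Submodule.span A {((x⁻¹ : Vˣ) : V)} * 1 := eq_of_scale_eq hx
    have h1 : HasTypeOne (maximalSubmodule A V) := by
      rw [hm]
      exact h.scale _
    have hL : socleHull (maximalSubmodule A V) = 1 := h1.div_self isRegularFractional_maximalSubmodule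
    refine ⟨maximalSubmodule A V, isRegularFractional_maximalSubmodule, h1, ?_, ?_, ?_, ?_⟩
    · rw [hL]
      exact Submodule.one_le.1 le_rfl
    · rintro ⟨r, hr, hr'⟩
      have h2 : r = 1 := IsOneDimExtension.injective (A := A) (V := V) (by simpa using hr')
      exact (IsLocalRing.mem_maximalIdeal r).1 hr (h2 ▸ isUnit_one)
    · rw [hL, one_mul, one_mul]
    · rw [hL, one_mul, ← hL]
      exact h1

end TypeOne

/-! ### Fiber products and submodules of the product extension -/

/-- The local ring `A` is the fiber product of its quotients `R` and `S` over the residue field. -/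
class IsFiberProduct (A R S : Type*) [CommRing A] [CommRing R] [CommRing S] [IsLocalRing R]
    [IsLocalRing S] [Algebra A R] [Algebra A S] : Prop where
  surjective_left : Function.Surjective (algebraMap A R)
  surjective_right : Function.Surjective (algebraMap A S)
  exists_left : ∀ r ∈ IsLocalRing.maximalIdeal R, ∃ a, algebraMap A R a = r ∧ algebraMap A S a = 0
  exists_right : ∀ s ∈ IsLocalRing.maximalIdeal S, ∃ a, algebraMap A R a = 0 ∧ algebraMap A S a = s
  eq_zero : ∀ a, algebraMap A R a = 0 → algebraMap A S a = 0 → a = 0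

theorem mem_maximalIdeal_iff_of_surjective {A R : Type*} [CommRing A] [CommRing R] [IsLocalRing A]
    [IsLocalRing R] [Algebra A R] (h : Function.Surjective (algebraMap A R)) (a : A) :
    a ∈ IsLocalRing.maximalIdeal A ↔ algebraMap A R a ∈ IsLocalRing.maximalIdeal R := by
  have := IsLocalRing.maximalIdeal.isMaximal R
  have h1 := Ideal.comap_isMaximal_of_surjective (algebraMap A R) h
    (K := IsLocalRing.maximalIdeal R)
  rw [← IsLocalRing.eq_maximalIdeal h1, Ideal.mem_comap]

section Extend

variable {A R W : Type*} [CommRing A] [CommRing R] [Algebra A R] [AddCommGroup W] [Module A W]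
  [Module R W] [IsScalarTower A R W]

/-- An `A`-submodule as a module over a quotient ring `R` of `A`. -/
def extendSubmodule (h : Function.Surjective (algebraMap A R)) (N : Submodule A W) :
    Submodule R W where
  __ := N.toAddSubmonoid
  smul_mem' := by
    intro r x hx
    obtain ⟨a, rfl⟩ := h r
    rw [algebraMap_smul]
    exact N.smul_mem a hx

@[simp]
theorem mem_extendSubmodule {h : Function.Surjective (algebraMap A R)} {N : Submodule A W} {x : W} :
    x ∈ extendSubmodule h N ↔ x ∈ N :=
  Iff.rfl

theorem relLength_restrictScalars (h : Function.Surjective (algebraMap A R)) (F G : Submodule R W) :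
    relLength (F.restrictScalars A) (G.restrictScalars A) = relLength F G := by
  rw [relLength, relLength, ← Module.length_eq_of_surjective h]
  rfl

end Extend

section FiberProduct

variable {A R S VR VS : Type*} [CommRing A] [CommRing R] [CommRing S] [CommRing VR] [CommRing VS]
  [Algebra A R] [Algebra A S] [Algebra A VR] [Algebra A VS]

section Left

variable [Algebra R VR] [IsScalarTower A R VR] [IsLocalRing R] [IsLocalRing S]
  [IsFiberProduct A R S]

variable (R S) in
/-- The elements `r` with `(r, 0) ∈ K`. -/
def leftKernel (K : Submodule A (VR × VS)) : Submodule R VR :=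
  extendSubmodule (IsFiberProduct.surjective_left S) (K.comap (LinearMap.inl A VR VS))

variable (R S) in
/-- The first components of the elements of `K`. -/
def leftImage (K : Submodule A (VR × VS)) : Submodule R VR :=
  extendSubmodule (IsFiberProduct.surjective_left S) (K.map (LinearMap.fst A VR VS))

variable (R S) in
theorem mem_leftKernel {K : Submodule A (VR × VS)} {r : VR} :
    r ∈ leftKernel R S K ↔ (r, (0 : VS)) ∈ K := Iff.rfl

variable (R S) in
theorem mem_leftImage {K : Submodule A (VR × VS)} {r : VR} :
    r ∈ leftImage R S K ↔ ∃ s : VS, (r, s) ∈ K :=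
  ⟨fun ⟨v, hv, h⟩ => ⟨v.2, by rw [← show v.1 = r from h]; exact hv⟩, fun ⟨s, hs⟩ => ⟨(r, s), hs, rfl⟩⟩

variable (R S) in
theorem leftKernel_le_leftImage (K : Submodule A (VR × VS)) : leftKernel R S K ≤ leftImage R S K :=
  fun _ hr => (mem_leftImage R S).2 ⟨0, hr⟩

variable (R S) in
theorem leftImage_mul (K K' : Submodule A (VR × VS)) :
    leftImage R S (K * K') = leftImage R S K * leftImage R S K' := by
  refine le_antisymm ?_ ?_
  · have h : K * K' ≤ ((leftImage R S K * leftImage R S K').restrictScalars A).comap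
        (LinearMap.fst A VR VS) :=
      Submodule.mul_le.2 fun x hx y hy =>
        Submodule.mul_mem_mul ((mem_leftImage R S).2 ⟨_, hx⟩) ((mem_leftImage R S).2 ⟨_, hy⟩)
    rintro _ ⟨v, hv, rfl⟩
    exact h hv
  · refine Submodule.mul_le.2 fun x hx y hy => ?_
    obtain ⟨x', hx'⟩ := (mem_leftImage R S).1 hx
    obtain ⟨y', hy'⟩ := (mem_leftImage R S).1 hy
    exact (mem_leftImage R S).2 ⟨_, Submodule.mul_mem_mul hx' hy'⟩

variable (R S) in
theorem leftKernel_mul_leftImage_le (K : Submodule A (VR × VS)) :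
    leftKernel R S K * leftImage R S K ≤ leftKernel R S (K * K) := by
  refine Submodule.mul_le.2 fun x hx y hy => ?_
  obtain ⟨y', hy'⟩ := (mem_leftImage R S).1 hy
  rw [mem_leftKernel] at *
  simpa using Submodule.mul_mem_mul hx hy'

end Left

section Right

variable [Algebra S VS] [IsScalarTower A S VS] [IsLocalRing R] [IsLocalRing S]
  [IsFiberProduct A R S]

variable (R S) in
/-- The elements `s` with `(0, s) ∈ K`. -/
def rightKernel (K : Submodule A (VR × VS)) : Submodule S VS :=
  extendSubmodule (IsFiberProduct.surjective_right R) (K.comap (LinearMap.inr A VR VS))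

variable (R S) in
/-- The second components of the elements of `K`. -/
def rightImage (K : Submodule A (VR × VS)) : Submodule S VS :=
  extendSubmodule (IsFiberProduct.surjective_right R) (K.map (LinearMap.snd A VR VS))

variable (R S) in
theorem mem_rightKernel {K : Submodule A (VR × VS)} {s : VS} :
    s ∈ rightKernel R S K ↔ ((0 : VR), s) ∈ K := Iff.rfl

variable (R S) in
theorem mem_rightImage {K : Submodule A (VR × VS)} {s : VS} :
    s ∈ rightImage R S K ↔ ∃ r : VR, (r, s) ∈ K :=
  ⟨fun ⟨v, hv, h⟩ => ⟨v.1, by rw [← show v.2 = s from h]; exact hv⟩, fun ⟨r, hr⟩ => ⟨(r, s), hr, rfl⟩⟩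

variable (R S) in
theorem rightKernel_le_rightImage (K : Submodule A (VR × VS)) :
    rightKernel R S K ≤ rightImage R S K :=
  fun _ hr => (mem_rightImage R S).2 ⟨0, hr⟩

variable (R S) in
theorem rightImage_mul (K K' : Submodule A (VR × VS)) :
    rightImage R S (K * K') = rightImage R S K * rightImage R S K' := by
  refine le_antisymm ?_ ?_
  · have h : K * K' ≤ ((rightImage R S K * rightImage R S K').restrictScalars A).comap
        (LinearMap.snd A VR VS) :=
      Submodule.mul_le.2 fun x hx y hy =>
        Submodule.mul_mem_mul ((mem_rightImage R S).2 ⟨_, hx⟩) ((mem_rightImage R S).2 ⟨_, hy⟩)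
    rintro _ ⟨v, hv, rfl⟩
    exact h hv
  · refine Submodule.mul_le.2 fun x hx y hy => ?_
    obtain ⟨x', hx'⟩ := (mem_rightImage R S).1 hx
    obtain ⟨y', hy'⟩ := (mem_rightImage R S).1 hy
    exact (mem_rightImage R S).2 ⟨_, Submodule.mul_mem_mul hx' hy'⟩

variable (R S) in
theorem rightKernel_mul_rightImage_le (K : Submodule A (VR × VS)) :
    rightKernel R S K * rightImage R S K ≤ rightKernel R S (K * K) := by
  refine Submodule.mul_le.2 fun x hx y hy => ?_
  obtain ⟨y', hy'⟩ := (mem_rightImage R S).1 hy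
  rw [mem_rightKernel] at *
  simpa using Submodule.mul_mem_mul hx hy'

end Right

variable [Algebra R VR] [Algebra S VS] [IsScalarTower A R VR] [IsScalarTower A S VS]

variable (A) in
/-- The product of two submodules as a submodule over `A`. -/
def prodSubmodule (F : Submodule R VR) (G : Submodule S VS) : Submodule A (VR × VS) :=
  (F.restrictScalars A).prod (G.restrictScalars A)

theorem mem_prodSubmodule {F : Submodule R VR} {G : Submodule S VS} {v : VR × VS} :
    v ∈ prodSubmodule A F G ↔ v.1 ∈ F ∧ v.2 ∈ G :=
  Iff.rfl

theorem prodSubmodule_mono {F F' : Submodule R VR} {G G' : Submodule S VS} (h : F ≤ F')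
    (h' : G ≤ G') : prodSubmodule A F G ≤ prodSubmodule A F' G' :=
  fun _ hv => ⟨h hv.1, h' hv.2⟩

theorem prodSubmodule_mul_le (F F' : Submodule R VR) (G G' : Submodule S VS) :
    prodSubmodule A F G * prodSubmodule A F' G' ≤ prodSubmodule A (F * F') (G * G') := by
  refine Submodule.mul_le.2 fun x hx y hy => ?_
  rw [mem_prodSubmodule] at *
  rw [Prod.fst_mul, Prod.snd_mul]
  exact ⟨Submodule.mul_mem_mul hx.1 hy.1, Submodule.mul_mem_mul hx.2 hy.2⟩

variable (A) in
theorem relLength_prodSubmodule (hR : Function.Surjective (algebraMap A R))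
    (hS : Function.Surjective (algebraMap A S)) {F F' : Submodule R VR} {G G' : Submodule S VS}
    (h : F ≤ F') (h' : G ≤ G') :
    relLength (prodSubmodule A F G) (prodSubmodule A F' G') = relLength F F' + relLength G G' := by
  have h1 : relLength (prodSubmodule A F G') (prodSubmodule A F' G') = relLength F F' := by
    refine Eq.trans ?_ (relLength_restrictScalars hR F F')
    refine relLength_eq_of_linearMap (F := prodSubmodule A F G') (G := prodSubmodule A F' G')
      (F' := F.restrictScalars A) (G' := F'.restrictScalars A) (LinearMap.fst A VR VS)
      (fun v hv => hv.1) (fun y hy => ⟨(y, 0), ⟨hy, G'.zero_mem⟩, rfl⟩) fun v hv =>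
        ⟨fun h => ⟨h, hv.2⟩, fun h => h.1⟩
  have h2 : relLength (prodSubmodule A F G) (prodSubmodule A F G') = relLength G G' := by
    refine Eq.trans ?_ (relLength_restrictScalars hS G G')
    refine relLength_eq_of_linearMap (F := prodSubmodule A F G) (G := prodSubmodule A F G')
      (F' := G.restrictScalars A) (G' := G'.restrictScalars A) (LinearMap.snd A VR VS)
      (fun v hv => hv.2) (fun y hy => ⟨(0, y), ⟨F.zero_mem, hy⟩, rfl⟩) fun v hv =>
        ⟨fun h => ⟨hv.1, h⟩, fun h => h.2⟩
  have h3 := relLength_add (prodSubmodule_mono (A := A) (le_refl F) h')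
    (prodSubmodule_mono (A := A) h (le_refl G'))
  rw [h3, h1, h2, add_comm]

variable [IsLocalRing R] [IsLocalRing S] [IsFiberProduct A R S]

variable {K : Submodule A (VR × VS)}

variable (R S) in
theorem prodSubmodule_kernel_le (K : Submodule A (VR × VS)) :
    prodSubmodule A (leftKernel R S K) (rightKernel R S K) ≤ K := by
  rintro ⟨r, s⟩ ⟨hr, hs⟩
  have := K.add_mem ((mem_leftKernel R S).1 hr) ((mem_rightKernel R S).1 hs)
  simpa using this

variable (R S) in
theorem le_prodSubmodule_image (K : Submodule A (VR × VS)) :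
    K ≤ prodSubmodule A (leftImage R S K) (rightImage R S K) := fun v hv =>
  ⟨(mem_leftImage R S).2 ⟨v.2, hv⟩, (mem_rightImage R S).2 ⟨v.1, hv⟩⟩

theorem mem_leftKernel_iff {v : VR × VS} (hv : v ∈ K) :
    v.1 ∈ leftKernel R S K ↔ v ∈ prodSubmodule A (leftKernel R S K) (rightKernel R S K) := by
  refine ⟨fun h => ⟨h, (mem_rightKernel R S).2 ?_⟩, fun h => h.1⟩
  have := K.sub_mem hv ((mem_leftKernel R S).1 h)
  simpa [Prod.sub_def] using this

theorem mem_rightKernel_iff {v : VR × VS} (hv : v ∈ K) :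
    v.2 ∈ rightKernel R S K ↔ v ∈ prodSubmodule A (leftKernel R S K) (rightKernel R S K) := by
  refine ⟨fun h => ⟨(mem_leftKernel R S).2 ?_, h⟩, fun h => h.2⟩
  have := K.sub_mem hv ((mem_rightKernel R S).1 h)
  simpa [Prod.sub_def] using this

variable (R S) in
theorem relLength_prodSubmodule_kernel_left (K : Submodule A (VR × VS)) :
    relLength (prodSubmodule A (leftKernel R S K) (rightKernel R S K)) K =
      relLength (leftKernel R S K) (leftImage R S K) := by
  refine (relLength_eq_of_linearMap (F' := (leftKernel R S K).restrictScalars A)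
    (G' := (leftImage R S K).restrictScalars A) (LinearMap.fst A VR VS)
    (fun v hv => (mem_leftImage R S).2 ⟨_, hv⟩) (fun y hy => ?_) fun v hv =>
      mem_leftKernel_iff (R := R) (S := S) hv).trans
    (relLength_restrictScalars (IsFiberProduct.surjective_left S) _ _)
  obtain ⟨s, hs⟩ := (mem_leftImage R S).1 hy
  exact ⟨(y, s), hs, rfl⟩

variable (R S) in
theorem relLength_prodSubmodule_kernel_right (K : Submodule A (VR × VS)) :
    relLength (prodSubmodule A (leftKernel R S K) (rightKernel R S K)) K =
      relLength (rightKernel R S K) (rightImage R S K) := by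
  refine (relLength_eq_of_linearMap (F' := (rightKernel R S K).restrictScalars A)
    (G' := (rightImage R S K).restrictScalars A) (LinearMap.snd A VR VS)
    (fun v hv => (mem_rightImage R S).2 ⟨_, hv⟩) (fun y hy => ?_) fun v hv =>
      mem_rightKernel_iff (R := R) (S := S) hv).trans
    (relLength_restrictScalars (IsFiberProduct.surjective_right R) _ _)
  obtain ⟨r, hr⟩ := (mem_rightImage R S).1 hy
  exact ⟨(r, y), hr, rfl⟩

/-- The square of `K` is a product if one of its components comes from the kernel. -/
theorem mul_self_eq_prodSubmodule
    (h : leftKernel R S K * leftImage R S K = leftImage R S K * leftImage R S K ∨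
      rightKernel R S K * rightImage R S K = rightImage R S K * rightImage R S K) :
    K * K = prodSubmodule A (leftImage R S K * leftImage R S K)
      (rightImage R S K * rightImage R S K) := by
  rw [← leftImage_mul, ← rightImage_mul] at *
  refine le_antisymm (le_prodSubmodule_image R S _) ?_
  have hl := leftKernel_mul_leftImage_le R S K
  have hr := rightKernel_mul_rightImage_le R S K
  refine le_trans (prodSubmodule_mono ?_ ?_) (prodSubmodule_kernel_le R S (K * K))
  · rcases h with h | h
    · exact h ▸ hl
    · intro x hx
      obtain ⟨s, hs⟩ := (mem_leftImage R S).1 hx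
      exact ((mem_rightKernel_iff hs).1 (hr (h ▸ (mem_rightImage R S).2 ⟨x, hs⟩))).1
  · rcases h with h | h
    · intro x hx
      obtain ⟨r, hr⟩ := (mem_rightImage R S).1 hx
      exact ((mem_leftKernel_iff hr).1 (hl (h ▸ (mem_leftImage R S).2 ⟨x, hr⟩))).2
    · exact h ▸ hr

end FiberProduct

theorem relLength_top {A M : Type*} [CommRing A] [AddCommGroup M] [Module A M]
    (F : Submodule A M) : relLength F ⊤ = Module.length A (M ⧸ F) :=
  relLength_eq_length_of_ker (F.mkQ ∘ₗ Submodule.subtype ⊤)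
    (F.mkQ_surjective.comp fun x => ⟨⟨x, trivial⟩, rfl⟩) fun _ => Submodule.Quotient.mk_eq_zero F

/-- For a regular `c ∈ 𝔪`, Nakayama gives `c⁻¹K ⊄ K`, and a socle element of `c⁻¹K` modulo `K` is
the required one. -/
theorem IsRegularFractional.not_socleHull_le {A V : Type*} [CommRing A] [CommRing V] [Algebra A V]
    [IsLocalRing A] [IsNoetherianRing A] [IsOneDimExtension A V] {K : Submodule A V}
    (hK : IsRegularFractional K) : ¬ _root_.socleHull K ≤ K := by
  obtain ⟨c, hc, hc'⟩ := IsOneDimExtension.exists_mem (A := A) (V := V)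
  obtain ⟨u, hu⟩ := IsOneDimExtension.isUnit (V := V) c hc'
  have h1 : IsRegularFractional (Submodule.span A {((u⁻¹ : Vˣ) : V)}) :=
    IsRegularFractional.one.span_inv (hu ▸ algebraMap_mem_one c)
  have h2 : ¬ Submodule.span A {((u⁻¹ : Vˣ) : V)} * K ≤ K := by
    intro h
    have h3 : K ≤ IsLocalRing.maximalIdeal A • K := by
      intro x hx
      have h4 : ((u⁻¹ : Vˣ) : V) * x ∈ K := h (mem_scale.2 (by simpa using hx))
      have h5 : x = c • (((u⁻¹ : Vˣ) : V) * x) := by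
        rw [Algebra.smul_def, ← hu, ← mul_assoc, Units.mul_inv, one_mul]
      rw [h5]
      exact Submodule.smul_mem_smul hc h4
    have h4 := Submodule.eq_bot_of_le_smul_of_le_jacobson_bot _ K
      (Module.Finite.iff_fg.1 hK.fg) h3 (IsLocalRing.maximalIdeal_le_jacobson _)
    obtain ⟨w, hw, hw'⟩ := hK.2
    rw [h4, Submodule.mem_bot] at hw
    rw [hw, isUnit_zero_iff] at hw'
    have h6 : (0 : A) = 1 := IsOneDimExtension.injective (A := A) (V := V) (by
      rw [map_one, map_zero, hw'])
    exact zero_ne_one h6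
  obtain ⟨e, -, he, he'⟩ := exists_socle_element h2 (relLength_ne_top hK (h1.mul hK))
  exact fun h => he (h (mem_socleHull.2 he'))

theorem isNoetherian_of_surjective_algebraMap {A R : Type*} [CommRing A] [CommRing R] [Algebra A R]
    [IsNoetherianRing R]
    (h : Function.Surjective (algebraMap A R)) : IsNoetherian A R := by
  refine ⟨fun N => ?_⟩
  obtain ⟨s, hs⟩ := IsNoetherian.noetherian (extendSubmodule h N)
  refine ⟨s, ?_⟩
  rw [← Submodule.restrictScalars_span A R h, hs]
  rfl

section FiberProduct

variable {A R S : Type*} [CommRing A] [CommRing R] [CommRing S] [IsLocalRing R] [IsLocalRing S]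
  [Algebra A R] [Algebra A S]

theorem IsFiberProduct.symm [h : IsFiberProduct A R S] : IsFiberProduct A S R where
  surjective_left := h.surjective_right
  surjective_right := h.surjective_left
  exists_left s hs := let ⟨a, h1, h2⟩ := h.exists_right s hs; ⟨a, h2, h1⟩
  exists_right r hr := let ⟨a, h1, h2⟩ := h.exists_left r hr; ⟨a, h2, h1⟩
  eq_zero a h1 h2 := h.eq_zero a h2 h1

theorem IsFiberProduct.isNoetherianRing [IsFiberProduct A R S] [IsNoetherianRing R]
    [IsNoetherianRing S] : IsNoetherianRing A := by
  have := isNoetherian_of_surjective_algebraMap (IsFiberProduct.surjective_left (A := A) (R := R) S)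
  have := isNoetherian_of_surjective_algebraMap
    (IsFiberProduct.surjective_right (A := A) (S := S) R)
  refine isNoetherian_of_injective
    ((Algebra.linearMap A R).prod (Algebra.linearMap A S)) ?_
  rw [injective_iff_map_eq_zero]
  intro a ha
  exact IsFiberProduct.eq_zero (R := R) (S := S) a (congrArg Prod.fst ha) (congrArg Prod.snd ha)

/-- An element `r` killed by the image of `a` need not lift with second component zero, but `rx`
with `x ∈ 𝔪_R` regular does, and `(rx, 0)` is killed by `a`. -/
theorem IsFiberProduct.mem_nonZeroDivisors (VR : Type*) [CommRing VR] [Algebra R VR]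
    [IsOneDimExtension R VR] [IsFiberProduct A R S] {a : A}
    (ha : a ∈ nonZeroDivisors A) : algebraMap A R a ∈ nonZeroDivisors R := by
  rw [mem_nonZeroDivisors_iff_right] at ha ⊢
  intro r hr
  obtain ⟨x, hx, hx'⟩ := IsOneDimExtension.exists_mem (A := R) (V := VR)
  obtain ⟨b, hb, hb'⟩ := IsFiberProduct.exists_left (A := A) (S := S) (r * x) (Ideal.mul_mem_left _ _ hx)
  have h1 : b = 0 := by
    apply ha
    apply IsFiberProduct.eq_zero (R := R) (S := S)
    · rw [map_mul, hb, mul_right_comm, hr, zero_mul]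
    · rw [map_mul, hb', zero_mul]
  rw [h1, map_zero] at hb
  exact (mem_nonZeroDivisors_iff_right.1 hx') r hb.symm

theorem IsFiberProduct.mem_nonZeroDivisors_of [IsFiberProduct A R S] {a : A}
    (h : algebraMap A R a ∈ nonZeroDivisors R) (h' : algebraMap A S a ∈ nonZeroDivisors S) :
    a ∈ nonZeroDivisors A := by
  rw [mem_nonZeroDivisors_iff_right] at *
  intro b hb
  apply IsFiberProduct.eq_zero (R := R) (S := S)
  · exact h _ (by rw [← map_mul, hb, map_zero])
  · exact h' _ (by rw [← map_mul, hb, map_zero])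

theorem IsFiberProduct.exists_algebraMap_eq [IsFiberProduct A R S] {r : R} {s : S}
    (hr : r ∈ IsLocalRing.maximalIdeal R) (hs : s ∈ IsLocalRing.maximalIdeal S) :
    ∃ a, algebraMap A R a = r ∧ algebraMap A S a = s := by
  obtain ⟨a, ha, ha'⟩ := IsFiberProduct.exists_left (A := A) (S := S) r hr
  obtain ⟨b, hb, hb'⟩ := IsFiberProduct.exists_right (A := A) (R := R) s hs
  exact ⟨a + b, by rw [map_add, ha, hb, add_zero], by rw [map_add, ha', hb', zero_add]⟩

variable (R S) in
theorem IsFiberProduct.exists_mem_nonZeroDivisors [IsLocalRing A] [IsFiberProduct A R S]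
    (VR VS : Type*) [CommRing VR] [CommRing VS] [Algebra R VR] [Algebra S VS]
    [IsOneDimExtension R VR] [IsOneDimExtension S VS] :
    ∃ a ∈ IsLocalRing.maximalIdeal A, algebraMap A R a ∈ nonZeroDivisors R ∧
      algebraMap A S a ∈ nonZeroDivisors S := by
  obtain ⟨x, hx, hx'⟩ := IsOneDimExtension.exists_mem (A := R) (V := VR)
  obtain ⟨y, hy, hy'⟩ := IsOneDimExtension.exists_mem (A := S) (V := VS)
  obtain ⟨a, rfl, rfl⟩ := IsFiberProduct.exists_algebraMap_eq (A := A) hx hy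
  exact ⟨a, (mem_maximalIdeal_iff_of_surjective
    (IsFiberProduct.surjective_left (A := A) (R := R) S) a).2 hx, hx', hy'⟩

theorem IsFiberProduct.isFiniteLength [IsLocalRing A] [IsFiberProduct A R S]
    (VR VS : Type*) [CommRing VR] [CommRing VS] [Algebra R VR] [Algebra S VS]
    [IsOneDimExtension R VR] [IsOneDimExtension S VS] {b : A}
    (hb : b ∈ nonZeroDivisors A) : IsFiniteLength A (A ⧸ Ideal.span {b}) := by
  have := IsFiberProduct.symm (A := A) (R := R) (S := S)
  obtain ⟨x, hx, hxR, hxS⟩ := IsFiberProduct.exists_mem_nonZeroDivisors (A := A) R S VR VS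
  have hbR := mul_mem (IsFiberProduct.mem_nonZeroDivisors (S := S) VR hb) hxR
  have hbS := mul_mem (IsFiberProduct.mem_nonZeroDivisors (S := R) VS hb) hxS
  have hR := IsFiberProduct.surjective_left (A := A) (R := R) S
  have hS := IsFiberProduct.surjective_right (A := A) (S := S) R
  let φ : A →ₗ[A] R × S := (Algebra.linearMap A R).prod (Algebra.linearMap A S)
  have hφ : Function.Injective φ := by
    rw [injective_iff_map_eq_zero]
    intro a ha
    exact IsFiberProduct.eq_zero (R := R) (S := S) a (congrArg Prod.fst ha) (congrArg Prod.snd ha)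
  rw [← Module.length_ne_top_iff, ← relLength_top, ← relLength_map φ hφ]
  have h1 := relLength_prodSubmodule A hR hS
    (le_top : Ideal.span {algebraMap A R b * algebraMap A R x} ≤ (⊤ : Ideal R))
    (le_top : Ideal.span {algebraMap A S b * algebraMap A S x} ≤ (⊤ : Ideal S))
  have h2 : relLength (prodSubmodule A (Ideal.span {algebraMap A R b * algebraMap A R x})
      (Ideal.span {algebraMap A S b * algebraMap A S x}))
      (prodSubmodule A (⊤ : Ideal R) (⊤ : Ideal S)) ≠ ⊤ := by
    rw [h1, relLength_top, relLength_top]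
    have h3 := Module.length_ne_top_iff.2 (IsOneDimExtension.isFiniteLength (V := VR) _ hbR)
    have h4 := Module.length_ne_top_iff.2 (IsOneDimExtension.isFiniteLength (V := VS) _ hbS)
    simp [h3, h4]
  -- The image of `bA` contains `bxR × bxS`, since every pair in `𝔪_R × 𝔪_S` comes from `A`. So
  -- `A/b` has at most the length of `R/bx × S/bx`.
  refine ne_top_of_le_ne_top h2 ((relLength_anti_left ?_).trans (relLength_mono_right ?_))
  · rintro ⟨r, s⟩ ⟨hr, hs⟩
    obtain ⟨r', rfl⟩ := Ideal.mem_span_singleton'.1 hr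
    obtain ⟨s', rfl⟩ := Ideal.mem_span_singleton'.1 hs
    have hxR := (mem_maximalIdeal_iff_of_surjective hR x).1 hx
    have hxS := (mem_maximalIdeal_iff_of_surjective hS x).1 hx
    obtain ⟨a, ha, ha'⟩ := IsFiberProduct.exists_algebraMap_eq (A := A)
      (Ideal.mul_mem_left _ r' hxR) (Ideal.mul_mem_left _ s' hxS)
    refine ⟨a * b, Ideal.mem_span_singleton'.2 ⟨a, rfl⟩, Prod.ext ?_ ?_⟩
    · change algebraMap A R (a * b) = _
      rw [map_mul, ha]; ring
    · change algebraMap A S (a * b) = _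
      rw [map_mul, ha']; ring
  · exact fun _ _ => ⟨trivial, trivial⟩

variable {VR VS : Type*} [CommRing VR] [CommRing VS] [Algebra R VR] [Algebra S VS]
  [IsOneDimExtension R VR] [IsOneDimExtension S VS]

variable [Algebra A VR] [Algebra A VS] [IsScalarTower A R VR] [IsScalarTower A S VS]

variable (A R S VR VS) in
theorem IsFiberProduct.isOneDimExtension [IsLocalRing A] [IsFiberProduct A R S] :
    IsOneDimExtension A (VR × VS) where
  injective := by
    rw [injective_iff_map_eq_zero]
    intro a ha
    rw [Prod.algebraMap_apply, IsScalarTower.algebraMap_apply A R VR,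
      IsScalarTower.algebraMap_apply A S VS, Prod.mk_eq_zero,
      map_eq_zero_iff _ (IsOneDimExtension.injective (A := R) (V := VR)),
      map_eq_zero_iff _ (IsOneDimExtension.injective (A := S) (V := VS))] at ha
    exact IsFiberProduct.eq_zero (R := R) (S := S) a ha.1 ha.2
  isUnit b hb := by
    have := IsFiberProduct.symm (A := A) (R := R) (S := S)
    rw [Prod.algebraMap_apply, IsScalarTower.algebraMap_apply A R VR,
      IsScalarTower.algebraMap_apply A S VS, Prod.isUnit_iff]
    exact ⟨IsOneDimExtension.isUnit _ (IsFiberProduct.mem_nonZeroDivisors (S := S) VR hb),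
      IsOneDimExtension.isUnit _ (IsFiberProduct.mem_nonZeroDivisors (S := R) VS hb)⟩
  isFiniteLength b hb := IsFiberProduct.isFiniteLength (R := R) (S := S) VR VS hb
  exists_mem := by
    obtain ⟨x, hx, hxR, hxS⟩ := IsFiberProduct.exists_mem_nonZeroDivisors (A := A) R S VR VS
    exact ⟨x, hx, IsFiberProduct.mem_nonZeroDivisors_of hxR hxS⟩

end FiberProduct

/-- This adds the exceptional case `K = 𝔪`, `K : 𝔪 = A`, and records that failure of `KL = L²`
forces `p = 1`. -/
theorem HasTypeOne.hasTypeOne_one_or_isFractionalGoto' {A V : Type*} [CommRing A] [CommRing V]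
    [Algebra A V] [IsLocalRing A] [IsNoetherianRing A] [IsOneDimExtension A V]
    [Infinite (IsLocalRing.ResidueField A)] {K : Submodule A V} (hK : HasTypeOne K)
    (hK' : IsRegularFractional K) (h1 : 1 ∈ socleHull K)
    (hL : socleHull K * socleHull K * socleHull K = socleHull K * socleHull K) {p : ℕ}
    (hp : relLength K (socleHull K * socleHull K) = p) :
    0 < p ∧ ((HasTypeOne (1 : Submodule A V) ∧ p = 1) ∨ IsFractionalGoto A V p) ∧
      (K * socleHull K = socleHull K * socleHull K ∨ p = 1) := by
  refine ⟨?_, ?_⟩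
  · have := relLength_mono_right (F := K) (mul_le_of_one_mem (G := socleHull K) h1)
    have hK1 : relLength K (socleHull K) = 1 := hK
    rw [hp, hK1] at this
    exact_mod_cast this
  · rcases hK.mul_socleHull_eq_or hK' hL with h | ⟨h, -, h'⟩
    · exact ⟨hK.hasTypeOne_one_or_isFractionalGoto hK' h1 hL h hp, Or.inl h⟩
    · have hp1 : p = 1 := by
        have hLL : socleHull K * socleHull K = socleHull K := by rw [h, one_mul]
        have hK1 : relLength K (socleHull K) = 1 := hK
        rw [hLL, hK1] at hp
        exact_mod_cast hp.symm
      exact ⟨Or.inl ⟨h', hp1⟩, Or.inr hp1⟩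

section FiberProduct

variable {A R S VR VS : Type*} [CommRing A] [CommRing R] [CommRing S] [CommRing VR] [CommRing VS]
  [IsLocalRing A] [IsLocalRing R] [IsLocalRing S]
  [Algebra A R] [Algebra A S] [Algebra A VR] [Algebra A VS] [Algebra R VR] [Algebra S VS]
  [IsScalarTower A R VR] [IsScalarTower A S VS] [IsFiberProduct A R S]

variable (A) in
theorem prodSubmodule_socleHull_le (F : Submodule R VR) (G : Submodule S VS) :
    prodSubmodule A (socleHull F) (socleHull G) ≤ socleHull (prodSubmodule A F G) := by
  rintro ⟨r, s⟩ ⟨hr, hs⟩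
  refine mem_socleHull.2 fun a ha => ⟨?_, ?_⟩
  · have h := mem_socleHull.1 hr _ ((mem_maximalIdeal_iff_of_surjective
      (IsFiberProduct.surjective_left (A := A) (R := R) S) a).1 ha)
    rwa [algebraMap_smul] at h
  · have h := mem_socleHull.1 hs _ ((mem_maximalIdeal_iff_of_surjective
      (IsFiberProduct.surjective_right (A := A) (S := S) R) a).1 ha)
    rwa [algebraMap_smul] at h

variable (R S) in
theorem fst_mem_socleHull {K : Submodule A (VR × VS)} {v : VR × VS} (hv : v ∈ socleHull K) :
    v.1 ∈ socleHull (leftKernel R S K) := by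
  refine mem_socleHull.2 fun r hr => ?_
  obtain ⟨a, rfl, ha⟩ := IsFiberProduct.exists_left (A := A) (S := S) r hr
  have h1 := mem_socleHull.1 hv a ((mem_maximalIdeal_iff_of_surjective
      (IsFiberProduct.surjective_left (A := A) (R := R) S) a).2 hr)
  have h2 : a • v = ((algebraMap A R a) • v.1, (0 : VS)) := by
    refine Prod.ext (by simp) ?_
    rw [Prod.smul_snd, ← algebraMap_smul S a v.2, ha, zero_smul]
  rwa [h2] at h1

variable (R S) in
theorem snd_mem_socleHull {K : Submodule A (VR × VS)} {v : VR × VS} (hv : v ∈ socleHull K) :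
    v.2 ∈ socleHull (rightKernel R S K) := by
  refine mem_socleHull.2 fun s hs => ?_
  obtain ⟨a, ha, rfl⟩ := IsFiberProduct.exists_right (A := A) (R := R) s hs
  have h1 := mem_socleHull.1 hv a ((mem_maximalIdeal_iff_of_surjective
      (IsFiberProduct.surjective_right (A := A) (S := S) R) a).2 hs)
  have h2 : a • v = ((0 : VR), (algebraMap A S a) • v.2) := by
    refine Prod.ext ?_ (by simp)
    rw [Prod.smul_fst, ← algebraMap_smul R a v.1, ha, zero_smul]
  rwa [h2] at h1

variable (R S) in
-- Multiplying by `(r, 0)` with `r ∈ 𝔪_R` isolates the first component of an element of `K : 𝔪_A`,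
-- and likewise on the right; so the glueing of `K` is invisible to `K : 𝔪_A`.
theorem socleHull_eq_prodSubmodule (K : Submodule A (VR × VS)) :
    socleHull K = prodSubmodule A (socleHull (leftKernel R S K)) (socleHull (rightKernel R S K)) :=
  le_antisymm (fun _ hv => ⟨fst_mem_socleHull R S hv, snd_mem_socleHull R S hv⟩)
    ((prodSubmodule_socleHull_le A _ _).trans fun _ hv => mem_socleHull.2 fun a ha =>
      prodSubmodule_kernel_le R S K (mem_socleHull.1 hv a ha))

variable (R S) in
theorem leftImage_le_socleHull (K : Submodule A (VR × VS)) :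
    leftImage R S K ≤ socleHull (leftKernel R S K) := fun _ hr =>
  let ⟨_, hs⟩ := (mem_leftImage R S).1 hr
  fst_mem_socleHull R S (le_socleHull K hs)

variable (R S) in
theorem rightImage_le_socleHull (K : Submodule A (VR × VS)) :
    rightImage R S K ≤ socleHull (rightKernel R S K) := fun _ hr =>
  let ⟨_, hs⟩ := (mem_rightImage R S).1 hr
  snd_mem_socleHull R S (le_socleHull K hs)

variable [IsOneDimExtension R VR] [IsOneDimExtension S VS]

variable (R S) in
theorem IsRegularFractional.leftKernel {K : Submodule A (VR × VS)}
    (hK : IsRegularFractional K) (h1 : 1 ∈ K) : IsRegularFractional (leftKernel R S K) := by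
  obtain ⟨⟨b, hb, hbK⟩, -⟩ := hK
  obtain ⟨x, hx, hx'⟩ := IsOneDimExtension.exists_mem (A := R) (V := VR)
  refine ⟨⟨algebraMap A R b, IsFiberProduct.mem_nonZeroDivisors (S := S) VR hb, fun r hr => ?_⟩,
    algebraMap R VR x, ?_, IsOneDimExtension.isUnit x hx'⟩
  · obtain ⟨c, hc⟩ := Submodule.mem_one.1 (hbK _ hr)
    have h2 := congrArg Prod.fst hc
    rw [Prod.algebraMap_apply, IsScalarTower.algebraMap_apply A R VR] at h2
    rw [algebraMap_smul]
    exact Submodule.mem_one.2 ⟨_, h2⟩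
  · obtain ⟨a, rfl, ha⟩ := IsFiberProduct.exists_left (A := A) (S := S) x hx
    have h2 := K.smul_mem a h1
    have h3 : a • (1 : VR × VS) = (algebraMap R VR (algebraMap A R a), 0) := by
      rw [← Algebra.algebraMap_eq_smul_one, Prod.algebraMap_apply,
        IsScalarTower.algebraMap_apply A R VR, IsScalarTower.algebraMap_apply A S VS, ha, map_zero]
    rwa [h3] at h2

variable (R S) in
theorem IsRegularFractional.rightKernel {K : Submodule A (VR × VS)}
    (hK : IsRegularFractional K) (h1 : 1 ∈ K) : IsRegularFractional (rightKernel R S K) := by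
  have := IsFiberProduct.symm (A := A) (R := R) (S := S)
  obtain ⟨⟨b, hb, hbK⟩, -⟩ := hK
  obtain ⟨x, hx, hx'⟩ := IsOneDimExtension.exists_mem (A := S) (V := VS)
  refine ⟨⟨algebraMap A S b, IsFiberProduct.mem_nonZeroDivisors (S := R) VS hb, fun r hr => ?_⟩,
    algebraMap S VS x, ?_, IsOneDimExtension.isUnit x hx'⟩
  · obtain ⟨c, hc⟩ := Submodule.mem_one.1 (hbK _ hr)
    have h2 := congrArg Prod.snd hc
    rw [Prod.algebraMap_apply, IsScalarTower.algebraMap_apply A S VS] at h2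
    rw [algebraMap_smul]
    exact Submodule.mem_one.2 ⟨_, h2⟩
  · obtain ⟨a, ha, rfl⟩ := IsFiberProduct.exists_right (A := A) (R := R) x hx
    have h2 := K.smul_mem a h1
    have h3 : a • (1 : VR × VS) = (0, algebraMap S VS (algebraMap A S a)) := by
      rw [← Algebra.algebraMap_eq_smul_one, Prod.algebraMap_apply,
        IsScalarTower.algebraMap_apply A R VR, IsScalarTower.algebraMap_apply A S VS, ha, map_zero]
    rwa [h3] at h2

variable (A) in
theorem IsRegularFractional.prodSubmodule {F : Submodule R VR} {G : Submodule S VS}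
    (hF : IsRegularFractional F) (hG : IsRegularFractional G) :
    IsRegularFractional (prodSubmodule A F G) := by
  obtain ⟨⟨b, hb, hbF⟩, u, hu, hu'⟩ := hF
  obtain ⟨⟨c, hc, hcG⟩, w, hw, hw'⟩ := hG
  obtain ⟨x, hx, hx'⟩ := IsOneDimExtension.exists_mem (A := R) (V := VR)
  obtain ⟨y, hy, hy'⟩ := IsOneDimExtension.exists_mem (A := S) (V := VS)
  obtain ⟨a, ha, ha'⟩ := IsFiberProduct.exists_algebraMap_eq (A := A)
    (Ideal.mul_mem_left _ b hx) (Ideal.mul_mem_left _ c hy)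
  refine ⟨⟨a, IsFiberProduct.mem_nonZeroDivisors_of (R := R) (S := S) (ha ▸ mul_mem hb hx')
    (ha' ▸ mul_mem hc hy'), ?_⟩, (u, w), ⟨hu, hw⟩, Prod.isUnit_iff.2 ⟨hu', hw'⟩⟩
  rintro ⟨r, s⟩ ⟨hr, hs⟩
  obtain ⟨r', hr'⟩ := Submodule.mem_one.1 (hbF r hr)
  obtain ⟨s', hs'⟩ := Submodule.mem_one.1 (hcG s hs)
  obtain ⟨d, hd, hd'⟩ := IsFiberProduct.exists_algebraMap_eq (A := A)
    (Ideal.mul_mem_left _ r' hx) (Ideal.mul_mem_left _ s' hy)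
  refine Submodule.mem_one.2 ⟨d, ?_⟩
  rw [Prod.algebraMap_apply, IsScalarTower.algebraMap_apply A R VR,
    IsScalarTower.algebraMap_apply A S VS, hd, hd', map_mul, map_mul, hr', hs']
  refine Prod.ext ?_ ?_
  · change b • r * algebraMap R VR x = a • r
    rw [← algebraMap_smul R a r, ha, mul_comm, ← Algebra.smul_def, mul_comm, mul_smul]
  · change c • s * algebraMap S VS y = a • s
    rw [← algebraMap_smul S a s, ha', mul_comm, ← Algebra.smul_def, mul_comm, mul_smul]

theorem IsRegularFractional.relLength_socleHull_ne_zero {B V : Type*} [CommRing B] [CommRing V]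
    [Algebra B V] [IsLocalRing B] [IsNoetherianRing B] [IsOneDimExtension B V] {K : Submodule B V}
    (hK : IsRegularFractional K) : 1 ≤ relLength K (_root_.socleHull K) :=
  Order.one_le_iff_ne_zero.2 fun h => hK.not_socleHull_le (relLength_eq_zero_iff.1 h)

variable [IsNoetherianRing R] [IsNoetherianRing S]

/-- The components of a canonical fractional ideal of a fiber product. -/
theorem HasTypeOne.components {K : Submodule A (VR × VS)} (hK : HasTypeOne K)
    (hK' : IsRegularFractional K) (h1 : 1 ∈ K) :
    HasTypeOne (leftKernel R S K) ∧ HasTypeOne (rightKernel R S K) ∧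
      leftImage R S K = socleHull (leftKernel R S K) ∧
      rightImage R S K = socleHull (rightKernel R S K) := by
  have hl := hK'.leftKernel R S h1
  have hr := hK'.rightKernel R S h1
  have e1 := relLength_add (prodSubmodule_kernel_le R S K) (le_socleHull K)
  rw [show relLength K (socleHull K) = 1 from hK] at e1
  rw [socleHull_eq_prodSubmodule R S K, relLength_prodSubmodule A
    (IsFiberProduct.surjective_left S) (IsFiberProduct.surjective_right R)
    (le_socleHull _) (le_socleHull _)] at e1
  have e2 := relLength_add (leftKernel_le_leftImage R S K) (leftImage_le_socleHull R S K)
  have e3 := relLength_add (rightKernel_le_rightImage R S K) (rightImage_le_socleHull R S K)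
  have e4 := relLength_prodSubmodule_kernel_left R S K
  have e5 := relLength_prodSubmodule_kernel_right R S K
  have f1 := relLength_ne_top hl hl.socleHull
  have f2 := relLength_ne_top hr hr.socleHull
  have g1 := hl.relLength_socleHull_ne_zero
  have g2 := hr.relLength_socleHull_ne_zero
  rw [HasTypeOne, HasTypeOne]
  -- Here `a`, `b` are the lengths of `L_F/F`, `L_G/G`, and `c` is that of `K/(F × G)`, which equals
  -- the length of either projection of `K` modulo the kernel. The defects of the projections are
  -- `d` and `e`. The equations give `c + d + e = 1`, and `a, b ≥ 1` exclude `c = 0`.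
  have key : ∀ a b c d e : ℕ∞, a ≠ ⊤ → b ≠ ⊤ → 1 ≤ a → 1 ≤ b → a + b = c + 1 → a = c + d →
      b = c + e → a = 1 ∧ b = 1 ∧ d = 0 ∧ e = 0 := by
    intro a b c d e ha hb ha1 hb1 h h' h''
    have hc : c ≠ ⊤ := ne_top_of_le_ne_top ha (h' ▸ le_self_add)
    have hd : d ≠ ⊤ := ne_top_of_le_ne_top ha (h' ▸ le_add_self)
    have he : e ≠ ⊤ := ne_top_of_le_ne_top hb (h'' ▸ le_add_self)
    lift a to ℕ using ha
    lift b to ℕ using hb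
    lift c to ℕ using hc
    lift d to ℕ using hd
    lift e to ℕ using he
    norm_cast at *
    omega
  rw [← e4] at e2
  rw [← e5] at e3
  obtain ⟨k1, k2, k3, k4⟩ := key _ _ _ _ _ f1 f2 g1 g2 e1 e2 e3
  exact ⟨k1, k2, eq_of_relLength_eq_zero (leftImage_le_socleHull R S K) k3,
    eq_of_relLength_eq_zero (rightImage_le_socleHull R S K) k4⟩

/-- The Goto property for a fiber product from normalized canonical fractional ideals of its
components. -/
theorem isFractionalGoto_fiberProduct {F : Submodule R VR} {G : Submodule S VS}
    (hF' : IsRegularFractional F) (hG' : IsRegularFractional G) (hF : HasTypeOne F)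
    (hG : HasTypeOne G) (h1F : 1 ∈ socleHull F) (h1F' : 1 ∉ F) (h1G : 1 ∈ socleHull G)
    (h1G' : 1 ∉ G)
    (hFF : socleHull F * socleHull F * (socleHull F * socleHull F) = socleHull F * socleHull F)
    (hGG : socleHull G * socleHull G * (socleHull G * socleHull G) = socleHull G * socleHull G)
    (h : F * socleHull F = socleHull F * socleHull F ∨ G * socleHull G = socleHull G * socleHull G)
    {p q n : ℕ} (hp : relLength F (socleHull F * socleHull F) = p)
    (hq : relLength G (socleHull G * socleHull G) = q) (hpq : p + q = n + 1) :
    IsFractionalGoto A (VR × VS) n := by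
  set P := prodSubmodule A F G with hPdef
  set K := P ⊔ Submodule.span A {(1 : VR × VS)} with hKdef
  have h1P : (1 : VR × VS) ∉ P := fun h => h1F' h.1
  have h1K : (1 : VR × VS) ∈ K :=
    (le_sup_right : _ ≤ K) (Submodule.mem_span_singleton_self _)
  have hsoc : (1 : VR × VS) ∈ socleHull P := prodSubmodule_socleHull_le A F G ⟨h1F, h1G⟩
  have hPK : relLength P K = 1 := relLength_sup_span_singleton h1P (mem_socleHull.1 hsoc)
  have hKle : K ≤ prodSubmodule A (socleHull F) (socleHull G) :=
    sup_le (prodSubmodule_mono (le_socleHull F) (le_socleHull G))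
      ((Submodule.span_singleton_le_iff_mem _ _).2 ⟨h1F, h1G⟩)
  have hK' : IsRegularFractional K :=
    (hF'.prodSubmodule A hG').of_le_of_le (hF'.socleHull.prodSubmodule A hG'.socleHull)
      le_sup_left hKle
  have hkl : leftKernel R S K = F := by
    refine le_antisymm (fun x hx => ?_) fun x hx => (mem_leftKernel R S).2
      ((le_sup_left : P ≤ K) ⟨hx, G.zero_mem⟩)
    obtain ⟨y, hy, z, hz, hyz⟩ := Submodule.mem_sup.1 ((mem_leftKernel R S).1 hx)
    obtain ⟨a, rfl⟩ := Submodule.mem_span_singleton.1 hz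
    by_cases ha : a ∈ IsLocalRing.maximalIdeal A
    · have h2 := P.add_mem hy (mem_socleHull.1 hsoc a ha)
      rw [hyz] at h2
      exact h2.1
    -- A unit coefficient `a` would put `1` into `G`, because the second component of the sum
    -- vanishes.
    · exfalso
      have ha' := not_not.1 (mt (IsLocalRing.mem_maximalIdeal a).2 ha)
      have h2 : y.2 + a • (1 : VS) = 0 := congrArg Prod.snd hyz
      have h3 : a • (1 : VS) ∈ G.restrictScalars A := by
        rw [eq_neg_of_add_eq_zero_right h2]
        exact neg_mem hy.2
      exact h1G' ((Submodule.smul_mem_iff_of_isUnit _ ha').1 h3)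
  have hkr : rightKernel R S K = G := by
    refine le_antisymm (fun x hx => ?_) fun x hx => (mem_rightKernel R S).2
      ((le_sup_left : P ≤ K) ⟨F.zero_mem, hx⟩)
    obtain ⟨y, hy, z, hz, hyz⟩ := Submodule.mem_sup.1 ((mem_rightKernel R S).1 hx)
    obtain ⟨a, rfl⟩ := Submodule.mem_span_singleton.1 hz
    by_cases ha : a ∈ IsLocalRing.maximalIdeal A
    · have h2 := P.add_mem hy (mem_socleHull.1 hsoc a ha)
      rw [hyz] at h2
      exact h2.2
    · exfalso
      have ha' := not_not.1 (mt (IsLocalRing.mem_maximalIdeal a).2 ha)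
      have h2 : y.1 + a • (1 : VR) = 0 := congrArg Prod.fst hyz
      have h3 : a • (1 : VR) ∈ F.restrictScalars A := by
        rw [eq_neg_of_add_eq_zero_right h2]
        exact neg_mem hy.1
      exact h1F' ((Submodule.smul_mem_iff_of_isUnit _ ha').1 h3)
  have hsK : socleHull K = prodSubmodule A (socleHull F) (socleHull G) := by
    rw [socleHull_eq_prodSubmodule R S K, hkl, hkr]
  -- The projection contains `1 ∉ F`, and nothing lies strictly between `F` and `F : 𝔪`.
  have hil : leftImage R S K = socleHull F := by
    have h2 := leftKernel_le_leftImage R S K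
    have h3 := leftImage_le_socleHull R S K
    rw [hkl] at h2 h3
    refine (eq_or_eq_of_relLength_eq_one h2 h3 hF).resolve_left fun h4 => h1F' ?_
    rw [h4]
    exact (mem_leftImage R S).2 ⟨1, h1K⟩
  have hir : rightImage R S K = socleHull G := by
    have h2 := rightKernel_le_rightImage R S K
    have h3 := rightImage_le_socleHull R S K
    rw [hkr] at h2 h3
    refine (eq_or_eq_of_relLength_eq_one h2 h3 hG).resolve_left fun h4 => h1G' ?_
    rw [h4]
    exact (mem_rightImage R S).2 ⟨1, h1K⟩
  have hR := IsFiberProduct.surjective_left (A := A) (R := R) S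
  have hS := IsFiberProduct.surjective_right (A := A) (S := S) R
  have hKK : K * K = prodSubmodule A (socleHull F * socleHull F) (socleHull G * socleHull G) := by
    rw [mul_self_eq_prodSubmodule (R := R) (S := S) (by rwa [hkl, hkr, hil, hir]), hil, hir]
  have one_add_inj : ∀ {a : ℕ∞} {m : ℕ}, 1 + a = 1 + (m : ℕ∞) → a = m := fun h =>
    ENat.add_right_injective_of_ne_top (by decide) h
  refine ⟨K, h1K, hK', ?_, ?_, ?_⟩
  -- Modulo `P` the hull `L_F × L_G` has length two and `K` has length one.
  · have h2 := relLength_add (le_sup_left : P ≤ K) (le_socleHull K)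
    rw [hPK, hsK, hPdef, relLength_prodSubmodule A hR hS (le_socleHull F) (le_socleHull G), hF,
      hG] at h2
    rw [HasTypeOne, hsK]
    exact_mod_cast one_add_inj (m := 1) (h2.symm.trans (by norm_num))
  · refine le_antisymm ?_ (mul_le_of_one_mem h1K)
    calc K * K * K ≤ K * K * (K * K) := mul_le_mul_right (mul_le_of_one_mem h1K) _
      _ ≤ K * K := by
        rw [hKK]
        refine (prodSubmodule_mul_le _ _ _ _).trans ?_
        rw [hFF, hGG]
  · have h2 := relLength_add (le_sup_left : P ≤ K) (mul_le_of_one_mem h1K)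
    rw [hPK, hKK, hPdef, relLength_prodSubmodule A hR hS
      ((le_socleHull F).trans (mul_le_of_one_mem h1F))
      ((le_socleHull G).trans (mul_le_of_one_mem h1G)), hp, hq] at h2
    rw [hKK]
    refine one_add_inj (h2.symm.trans ?_)
    rw [add_comm 1]
    exact_mod_cast hpq

variable [Infinite (IsLocalRing.ResidueField R)] [Infinite (IsLocalRing.ResidueField S)]

/-- The Goto property passes from a fiber product to its components. -/
theorem IsFractionalGoto.of_fiberProduct {n : ℕ} (hn : 2 ≤ n)
    (h : IsFractionalGoto A (VR × VS) n) :
    ∃ p q : ℕ, 0 < p ∧ 0 < q ∧ p + q = n + 1 ∧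
      ((HasTypeOne (1 : Submodule R VR) ∧ p = 1) ∨ IsFractionalGoto R VR p) ∧
      ((HasTypeOne (1 : Submodule S VS) ∧ q = 1) ∨ IsFractionalGoto S VS q) := by
  obtain ⟨K, h1, hK', hK, hKK, hlen⟩ := h
  obtain ⟨hl, hr, hil, hir⟩ := hK.components (R := R) (S := S) hK' h1
  have hl' := hK'.leftKernel R S h1
  have hr' := hK'.rightKernel R S h1
  have h1l : (1 : VR) ∈ socleHull (leftKernel R S K) := hil ▸ (mem_leftImage R S).2 ⟨1, h1⟩
  have h1r : (1 : VS) ∈ socleHull (rightKernel R S K) := hir ▸ (mem_rightImage R S).2 ⟨1, h1⟩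
  have hKl := leftImage_mul R S (K * K) K
  rw [hKK, leftImage_mul, hil] at hKl
  have hKr := rightImage_mul R S (K * K) K
  rw [hKK, rightImage_mul, hir] at hKr
  have hP1 : relLength (prodSubmodule A (leftKernel R S K) (rightKernel R S K)) K = 1 := by
    rw [relLength_prodSubmodule_kernel_left, hil]
    exact hl
  have hlel := (le_socleHull (leftKernel R S K)).trans (mul_le_of_one_mem h1l)
  have hler := (le_socleHull (rightKernel R S K)).trans (mul_le_of_one_mem h1r)
  have hPlen : relLength (prodSubmodule A (leftKernel R S K) (rightKernel R S K)) (K * K) =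
      1 + n := by
    rw [relLength_add (prodSubmodule_kernel_le R S K) (mul_le_of_one_mem h1), hP1, hlen]
  have hsum := relLength_prodSubmodule A (IsFiberProduct.surjective_left (R := R) S)
    (IsFiberProduct.surjective_right (S := S) R) hlel hler
  obtain ⟨p, hp⟩ := ENat.ne_top_iff_exists.1
    (relLength_ne_top hl' (hl'.socleHull.mul hl'.socleHull))
  obtain ⟨q, hq⟩ := ENat.ne_top_iff_exists.1
    (relLength_ne_top hr' (hr'.socleHull.mul hr'.socleHull))
  obtain ⟨hp0, hR⟩ := hl.hasTypeOne_one_or_isFractionalGoto' hl' h1l hKl.symm hp.symm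
  obtain ⟨hq0, hS⟩ := hr.hasTypeOne_one_or_isFractionalGoto' hr' h1r hKr.symm hq.symm
  refine ⟨p, q, hp0, hq0, ?_, hR.1, hS.1⟩
  by_cases hc : leftKernel R S K * socleHull (leftKernel R S K) =
        socleHull (leftKernel R S K) * socleHull (leftKernel R S K) ∨
      rightKernel R S K * socleHull (rightKernel R S K) =
        socleHull (rightKernel R S K) * socleHull (rightKernel R S K)
  · have h2 := mul_self_eq_prodSubmodule (R := R) (S := S) (K := K) (by rwa [hil, hir])
    rw [h2, hil, hir, hsum, ← hp, ← hq] at hPlen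
    have : p + q = 1 + n := by exact_mod_cast hPlen
    omega
  -- If the equality fails on both sides, then `p = q = 1`, while `K² ⊆ L_F² × L_G²` still gives `1
  -- + n ≤ p + q`; this contradicts `n ≥ 2`.
  · push Not at hc
    have hp1 := hR.2.resolve_left hc.1
    have hq1 := hS.2.resolve_left hc.2
    have h2 := relLength_mono_right
      (F := prodSubmodule A (leftKernel R S K) (rightKernel R S K))
      (le_prodSubmodule_image R S (K * K))
    rw [leftImage_mul, rightImage_mul, hPlen, hil, hir, hsum, ← hp, ← hq] at h2
    have : 1 + n ≤ p + q := by exact_mod_cast h2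
    omega

theorem isFractionalGoto_fiberProduct_iff {n : ℕ} (hn : 2 ≤ n) :
    IsFractionalGoto A (VR × VS) n ↔
      (HasTypeOne (1 : Submodule R VR) ∧ IsFractionalGoto S VS n) ∨
      (IsFractionalGoto R VR n ∧ HasTypeOne (1 : Submodule S VS)) ∨
      (∃ p q : ℕ, 0 < p ∧ 0 < q ∧ p + q = n + 1 ∧ IsFractionalGoto R VR p ∧
        IsFractionalGoto S VS q) := by
  constructor
  · intro h
    obtain ⟨p, q, hp, hq, hpq, ⟨h1, rfl⟩ | h1, ⟨h2, rfl⟩ | h2⟩ := h.of_fiberProduct (R := R) (S := S) hn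
    -- Two Gorenstein components would give `p = q = 1`, hence `n = 1`.
    · omega
    · obtain rfl : q = n := by omega
      exact Or.inl ⟨h1, h2⟩
    · obtain rfl : p = n := by omega
      exact Or.inr (Or.inl ⟨h1, h2⟩)
    · exact Or.inr (Or.inr ⟨p, q, hp, hq, hpq, h1, h2⟩)
  · rintro (⟨h1, h2⟩ | ⟨h1, h2⟩ | ⟨p, q, hp, hq, hpq, h1, h2⟩)
    · obtain ⟨F, a1, a2, a3, a4, a5, a6⟩ := h1.exists_normalized_of_one
      obtain ⟨G, b1, b2, b3, b4, b5, b6, b7⟩ := h2.exists_normalized (by omega)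
      -- The Goto component supplies the equality `GL = L²`, which the Gorenstein one may lack.
      exact isFractionalGoto_fiberProduct a1 b1 a2 b2 a3 a4 b3 b4 a5 b5 (Or.inr b6)
        (p := 1) (by exact_mod_cast a6) b7 (add_comm _ _)
    · obtain ⟨F, a1, a2, a3, a4, a5, a6, a7⟩ := h1.exists_normalized (by omega)
      obtain ⟨G, b1, b2, b3, b4, b5, b6⟩ := h2.exists_normalized_of_one
      exact isFractionalGoto_fiberProduct a1 b1 a2 b2 a3 a4 b3 b4 a5 b5 (Or.inl a6)
        a7 (q := 1) (by exact_mod_cast b6) rfl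
    · obtain ⟨F, a1, a2, a3, a4, a5, a6, a7⟩ := h1.exists_normalized hp
      obtain ⟨G, b1, b2, b3, b4, b5, b6, b7⟩ := h2.exists_normalized hq
      exact isFractionalGoto_fiberProduct a1 b1 a2 b2 a3 a4 b3 b4 a5 b5 (Or.inl a6) a7 b7 hpq

end FiberProduct

/-! ### Homomorphisms into `N / xN` and their lengths -/

open scoped Pointwise in
theorem smul_quotSMulTop {A M : Type*} [CommRing A] [AddCommGroup M] [Module A M] (x : A)
    (m : QuotSMulTop x M) : x • m = 0 :=
  Module.mem_annihilator.1 (QuotSMulTop.mem_annihilator M x) m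

section HomLength

open scoped Pointwise

variable {A : Type*} [CommRing A]

theorem length_le_add_of_exact {M N P : Type*} [AddCommGroup M] [AddCommGroup N] [AddCommGroup P]
    [Module A M] [Module A N] [Module A P] {f : N →ₗ[A] M} {g : M →ₗ[A] P}
    (hf : Function.Injective f) (h : Function.Exact f g) :
    Module.length A M ≤ Module.length A N + Module.length A P := by
  rw [Module.length_eq_add_of_exact f g.rangeRestrict hf g.surjective_rangeRestrict
    (fun x => by rw [← h x, Subtype.ext_iff]; rfl)]
  exact add_le_add_right (Module.length_le_of_injective _ (Submodule.subtype_injective _)) _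

theorem exact_lcomp_mkQ_lcomp_subtype {M E : Type*} [AddCommGroup M] [AddCommGroup E] [Module A M]
    [Module A E] (N : Submodule A M) :
    Function.Exact (LinearMap.lcomp A E N.mkQ) (LinearMap.lcomp A E N.subtype) := by
  intro φ
  constructor
  · intro h
    exact ⟨N.liftQ φ fun n hn => LinearMap.congr_fun h ⟨n, hn⟩, by ext; rfl⟩
  · rintro ⟨ψ, rfl⟩
    ext n
    have : N.mkQ (n : M) = 0 := (Submodule.Quotient.mk_eq_zero N).2 n.2
    change ψ (N.mkQ (n : M)) = 0
    rw [this, map_zero]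

theorem lcomp_mkQ_injective {M E : Type*} [AddCommGroup M] [AddCommGroup E] [Module A M]
    [Module A E] (N : Submodule A M) : Function.Injective (LinearMap.lcomp A E N.mkQ) :=
  fun _ _ h => (LinearMap.cancel_right N.mkQ_surjective).1 h

theorem isFiniteLength_quotSMulTop {x : A} (hx : IsFiniteLength A (A ⧸ Ideal.span {x}))
    (M : Type*) [AddCommGroup M] [Module A M] [Module.Finite A M] :
    IsFiniteLength A (QuotSMulTop x M) := by
  refine isFiniteLength_of_smul_eq_zero hx fun m => ?_
  exact smul_quotSMulTop x m

theorem length_hom_quotSMulTop {x : A} (M N : Type*) [AddCommGroup M] [Module A M]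
    [AddCommGroup N] [Module A N] :
    Module.length A (M →ₗ[A] QuotSMulTop x N) =
      Module.length A (QuotSMulTop x M →ₗ[A] QuotSMulTop x N) := by
  refine (LinearEquiv.ofBijective (LinearMap.lcomp A (QuotSMulTop x N)
    (x • (⊤ : Submodule A M)).mkQ) ⟨lcomp_mkQ_injective _, fun φ => ?_⟩).length_eq.symm
  refine (exact_lcomp_mkQ_lcomp_subtype (x • (⊤ : Submodule A M)) φ).1 ?_
  ext ⟨m, hm⟩
  obtain ⟨m, -, rfl⟩ := hm
  change φ (x • m) = 0
  rw [map_smul]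
  exact smul_quotSMulTop x _

/-- Reduction modulo `x` keeps `0 → F → P → P/F → 0` exact on the left because `x` is regular on the
cokernel. -/
theorem length_quotSMulTop_eq_add {x : A} {P : Type*} [AddCommGroup P] [Module A P]
    (F : Submodule A P) (hF : IsSMulRegular (P ⧸ F) x) :
    Module.length A (QuotSMulTop x P) =
      Module.length A (QuotSMulTop x F) + Module.length A (QuotSMulTop x (P ⧸ F)) := by
  refine Module.length_eq_add_of_exact (QuotSMulTop.map x F.subtype) (QuotSMulTop.map x F.mkQ) ?_
    (QuotSMulTop.map_surjective x F.mkQ_surjective)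
    (QuotSMulTop.map_exact x (LinearMap.exact_subtype_mkQ F) F.mkQ_surjective)
  have h := QuotSMulTop.map_first_exact_on_four_term_exact_of_isSMulRegular_last
    (f₁ := (0 : F →ₗ[A] F)) (f₂ := F.subtype) (f₃ := F.mkQ) (r := x)
    (by intro y; simp [eq_comm]) (LinearMap.exact_subtype_mkQ F) hF
  rw [injective_iff_map_eq_zero]
  intro y hy
  obtain ⟨z, rfl⟩ := (h y).1 hy
  simp

variable [IsLocalRing A]

theorem nonempty_equiv_residueField {M : Type*} [AddCommGroup M] [Module A M]
    [IsSimpleModule A M] : Nonempty (M ≃ₗ[A] IsLocalRing.ResidueField A) := by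
  obtain ⟨I, hI, ⟨e⟩⟩ := isSimpleModule_iff_quot_maximal.1 ‹IsSimpleModule A M›
  obtain rfl := IsLocalRing.eq_maximalIdeal hI
  exact ⟨e⟩

/-- Induction along a composition series: each simple factor is the residue field and adds at most
one. -/
theorem length_hom_le {E : Type*} [AddCommGroup E] [Module A E]
    (hE : Module.length A (IsLocalRing.ResidueField A →ₗ[A] E) ≤ 1)
    {M : Type*} [AddCommGroup M] [Module A M] (hM : IsFiniteLength A M) :
    Module.length A (M →ₗ[A] E) ≤ Module.length A M := by
  induction hM with
  | of_subsingleton =>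
    rw [Module.length_eq_zero]
    exact zero_le
  | @of_simple_quotient M _ _ N _ _ ih =>
    obtain ⟨e⟩ := nonempty_equiv_residueField (A := A) (M := M ⧸ N)
    refine (length_le_add_of_exact (lcomp_mkQ_injective N)
      (exact_lcomp_mkQ_lcomp_subtype N)).trans ?_
    rw [Module.length_eq_add_of_exact (R := A) N.subtype N.mkQ N.subtype_injective N.mkQ_surjective
      (LinearMap.exact_subtype_mkQ N), add_comm, Module.length_eq_one A (M ⧸ N)]
    refine add_le_add ih ?_
    exact (LinearEquiv.length_eq (e.congrLeft E A)).trans_le hE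

variable [IsNoetherianRing A]

/-- If `E = N / x N` has simple socle and the length of `A / x`, then homomorphisms into `E`
extend along inclusions with `x`-regular cokernel. -/
theorem lcomp_subtype_surjective_quotSMulTop {x : A} {N P : Type*} [AddCommGroup N] [Module A N]
    [Module.Finite A N] [AddCommGroup P] [Module A P] [Module.Finite A P] [Module.Free A P]
    (hx : IsFiniteLength A (A ⧸ Ideal.span {x}))
    (hN : Module.length A (QuotSMulTop x N) = Module.length A (QuotSMulTop x A))
    (hk : Module.length A (IsLocalRing.ResidueField A →ₗ[A] QuotSMulTop x N) ≤ 1)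
    (F : Submodule A P) (hF : IsSMulRegular (P ⧸ F) x) :
    Function.Surjective (LinearMap.lcomp A (QuotSMulTop x N) F.subtype) := by
  have hle : ∀ (M : Type _) [AddCommGroup M] [Module A M] [Module.Finite A M],
      Module.length A (M →ₗ[A] QuotSMulTop x N) ≤ Module.length A (QuotSMulTop x M) := by
    intro M _ _ _
    rw [length_hom_quotSMulTop]
    exact length_hom_le hk (isFiniteLength_quotSMulTop hx M)
  have e := (Module.Free.chooseBasis A P).equivFun
  have hP : Module.length A (P →ₗ[A] QuotSMulTop x N) = Module.length A (QuotSMulTop x P) := by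
    have h1 : Module.length A (P →ₗ[A] QuotSMulTop x N) =
        Module.length A (Module.Free.ChooseBasisIndex A P → QuotSMulTop x N) :=
      ((Module.Free.chooseBasis A P).constr A).symm.length_eq
    have h2 : Module.length A (QuotSMulTop x P) =
        Module.length A (Module.Free.ChooseBasisIndex A P → QuotSMulTop x A) := by
      rw [((QuotSMulTop.congr x e)).length_eq]
      refine LinearEquiv.length_eq ((Submodule.quotEquivOfEq _ _ ?_).trans
        (Submodule.quotientPi fun _ => x • (⊤ : Submodule A A)))
      ext y
      rw [Submodule.mem_pi]
      constructor
      · rintro ⟨z, -, rfl⟩ i -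
        exact ⟨z i, trivial, rfl⟩
      · intro h
        choose z hz hz' using fun i => h i trivial
        exact ⟨z, trivial, funext hz'⟩
    rw [h1, h2, Module.length_pi_of_fintype, Module.length_pi_of_fintype]
    simp only [hN]
  set ρ := LinearMap.lcomp A (QuotSMulTop x N) F.subtype with hρ
  have h1 : Module.length A (P →ₗ[A] QuotSMulTop x N) =
      Module.length A ((P ⧸ F) →ₗ[A] QuotSMulTop x N) + Module.length A (LinearMap.range ρ) :=
    Module.length_eq_add_of_exact _ ρ.rangeRestrict (lcomp_mkQ_injective F)
      ρ.surjective_rangeRestrict fun φ => by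
        rw [← exact_lcomp_mkQ_lcomp_subtype F φ, Subtype.ext_iff]; rfl
  have hfin := Module.length_ne_top_iff.2 (isFiniteLength_quotSMulTop hx P)
  have hadd := length_quotSMulTop_eq_add F hF
  have hfinF : Module.length A (QuotSMulTop x (P ⧸ F)) ≠ ⊤ :=
    Module.length_ne_top_iff.2 (isFiniteLength_quotSMulTop hx _)
  have hfinF' : Module.length A (QuotSMulTop x F) ≠ ⊤ :=
    Module.length_ne_top_iff.2 (isFiniteLength_quotSMulTop hx _)
  -- With `E = N/xN`, the total `ℓ Hom(P, E) = ℓ(F/xF) + ℓ((P/F)/x(P/F))` is the largest that the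
  -- bounds allow. As `Hom(P/F, E)` takes at most the second summand, the restrictions to `F` have
  -- length at least `ℓ(F/xF) ≥ ℓ Hom(F, E)`.
  have h2 : Module.length A (F →ₗ[A] QuotSMulTop x N) ≤ Module.length A (LinearMap.range ρ) := by
    refine (hle F).trans ?_
    rw [hP, hadd] at h1
    have h3 := hle (P ⧸ F)
    rw [add_comm] at h1
    refine (ENat.add_le_add_iff_left hfinF).1 ?_
    rw [h1]
    exact add_le_add_left h3 _
  have hFin : Module.length A (F →ₗ[A] QuotSMulTop x N) ≠ ⊤ :=
    ne_top_of_le_ne_top hfinF' (hle F)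
  obtain ⟨_, _⟩ := isFiniteLength_iff_isNoetherian_isArtinian.1 (Module.length_ne_top_iff.1 hFin)
  rw [← LinearMap.range_eq_top]
  by_contra h
  exact (Submodule.length_lt h).not_ge h2

/-- If `N / x N` has simple socle and the length of `A / x`, then homomorphisms into `N`
extend along inclusions into free modules with `x`-regular cokernel. -/
theorem lcomp_subtype_surjective {x : A} {N P : Type*} [AddCommGroup N] [Module A N]
    [Module.Finite A N] [AddCommGroup P] [Module A P] [Module.Finite A P] [Module.Free A P]
    (hx : IsFiniteLength A (A ⧸ Ideal.span {x})) (hxm : x ∈ IsLocalRing.maximalIdeal A)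
    (hxN : IsSMulRegular N x)
    (hN : Module.length A (QuotSMulTop x N) = Module.length A (QuotSMulTop x A))
    (hk : Module.length A (IsLocalRing.ResidueField A →ₗ[A] QuotSMulTop x N) ≤ 1)
    (F : Submodule A P) (hF : IsSMulRegular (P ⧸ F) x) :
    Function.Surjective (LinearMap.lcomp A N F.subtype) := by
  -- Nakayama on `Hom(F, N)`: an extension exists modulo `x`, it lifts to `N` since `P` is free, and
  -- the error on `F` is divisible by `x`.
  rw [← LinearMap.range_eq_top, eq_top_iff]
  refine Submodule.le_of_le_smul_of_le_jacobson_bot (I := IsLocalRing.maximalIdeal A)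
    Module.Finite.fg_top (IsLocalRing.maximalIdeal_le_jacobson _) fun φ _ => ?_
  obtain ⟨ψ, hψ⟩ := lcomp_subtype_surjective_quotSMulTop hx hN hk F hF
    ((x • (⊤ : Submodule A N)).mkQ ∘ₗ φ)
  obtain ⟨ψ', hψ'⟩ := Module.projective_lifting_property (x • (⊤ : Submodule A N)).mkQ ψ
    (Submodule.mkQ_surjective _)
  have hmem : ∀ y, (φ - ψ' ∘ₗ F.subtype) y ∈ LinearMap.range (LinearMap.lsmul A N x) := by
    intro y
    have h1 : (x • (⊤ : Submodule A N)).mkQ ((φ - ψ' ∘ₗ F.subtype) y) = 0 := by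
      have h2 := LinearMap.congr_fun hψ y
      have h3 := LinearMap.congr_fun hψ' (y : P)
      change ψ (y : P) = (x • (⊤ : Submodule A N)).mkQ (φ y) at h2
      change (x • (⊤ : Submodule A N)).mkQ (ψ' (y : P)) = ψ (y : P) at h3
      rw [LinearMap.sub_apply, map_sub, ← h2, ← h3]
      exact sub_self _
    obtain ⟨z, -, hz⟩ := (Submodule.Quotient.mk_eq_zero _).1 h1
    exact ⟨z, hz⟩
  let e := LinearEquiv.ofInjective (LinearMap.lsmul A N x) hxN
  let θ : F →ₗ[A] N := e.symm.toLinearMap ∘ₗ (φ - ψ' ∘ₗ F.subtype).codRestrict _ hmem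
  have hθ : φ = ψ' ∘ₗ F.subtype + x • θ := by
    rw [← sub_eq_iff_eq_add']
    ext y
    have h4 : (e (θ y) : N) = (φ - ψ' ∘ₗ F.subtype) y := by simp [θ]
    exact h4.symm
  rw [hθ]
  exact add_mem (Submodule.mem_sup_left ⟨ψ', rfl⟩)
    (Submodule.mem_sup_right (Submodule.smul_mem_smul hxm trivial))

end HomLength

/-! ### Vanishing of `Ext` and injective dimension -/

section ExtVanishing

open Abelian
open scoped Pointwise

variable {A : Type u} [CommRing A]

theorem ext_eq_zero_of_shortExact_of_injective {S : ShortComplex (ModuleCat.{u} A)}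
    (hS : S.ShortExact) [Injective S.X₂] {Y : ModuleCat.{u} A} {n : ℕ}
    (h : ∀ e : Ext Y S.X₁ (n + 2), e = 0) (e : Ext Y S.X₃ (n + 1)) : e = 0 := by
  obtain ⟨e', rfl⟩ := Ext.covariant_sequence_exact₃ Y hS e rfl (h _)
  rw [Ext.eq_zero_of_injective e', Ext.zero_comp]

theorem ext_eq_zero_of_shortExact_of_projective {S : ShortComplex (ModuleCat.{u} A)}
    (hS : S.ShortExact) [Projective S.X₂] {Y : ModuleCat.{u} A} {n : ℕ}
    (h : ∀ e : Ext S.X₁ Y (n + 1), e = 0) (e : Ext S.X₃ Y (n + 2)) : e = 0 := by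
  obtain ⟨e', rfl⟩ := Ext.contravariant_sequence_exact₃ hS Y e (Ext.eq_zero_of_projective _)
    (show 1 + (n + 1) = n + 2 by omega)
  rw [h e', Ext.comp_zero]

/-- Baer's criterion: a module has injective dimension at most one if `Ext ^ 2` from cyclic
modules vanishes. -/
theorem hasInjectiveDimensionLE_one_of_ext_quotient {N : ModuleCat.{u} A}
    (h : ∀ (I : Ideal A) (e : Ext (ModuleCat.of A (A ⧸ I)) N 2), e = 0) :
    HasInjectiveDimensionLE N 1 := by
  let S : ShortComplex (ModuleCat.{u} A) :=
    ShortComplex.mk (Injective.ι N) (Limits.cokernel.π (Injective.ι N)) (by simp)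
  have hS : S.ShortExact :=
    { exact := ShortComplex.exact_cokernel _ }
  have hinj : Injective S.X₂ := inferInstanceAs (Injective (Injective.under N))
  -- The first cosyzygy has vanishing `Ext¹` from cyclic modules by dimension shifting, which is
  -- Baer's extension property.
  have hbaer : Module.Baer A S.X₃ := by
    rw [Module.Baer.iff_surjective]
    intro I φ
    have hT := LinearMap.shortExact_shortComplexKer (f := I.mkQ) I.mkQ_surjective
    let ι : LinearMap.ker I.mkQ →ₗ[A] I := Submodule.inclusion (by rw [Submodule.ker_mkQ])
    obtain ⟨e, he⟩ := Ext.contravariant_sequence_exact₁ hT S.X₃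
      (Ext.mk₀ (ModuleCat.ofHom (φ ∘ₗ ι))) (add_zero 1)
      (ext_eq_zero_of_shortExact_of_injective hS (fun e => h I e) _)
    obtain ⟨ψ, rfl⟩ := Ext.mk₀_bijective _ _ |>.2 e
    rw [Ext.mk₀_comp_mk₀] at he
    have h1 := (Ext.mk₀_bijective _ _).1 he
    refine ⟨ψ.hom, ?_⟩
    ext x
    exact LinearMap.congr_fun (congrArg ModuleCat.Hom.hom h1)
      ⟨x, by rw [Submodule.ker_mkQ]; exact x.2⟩
  have h3 : Injective S.X₃ :=
    Module.injective_object_of_injective_module (inj := hbaer.injective)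
  exact (hS.hasInjectiveDimensionLT_X₃_iff 0 hinj).1 inferInstance

/-- If `x` is regular on `N` and annihilates `M`, then there are no homomorphisms `M → N`. -/
theorem hom_eq_zero_of_isSMulRegular {M N : Type*} [AddCommGroup M] [Module A M] [AddCommGroup N]
    [Module A N] {x : A} (hxN : IsSMulRegular N x) (hxM : ∀ m : M, x • m = 0) (φ : M →ₗ[A] N) :
    φ = 0 := by
  ext m
  apply hxN
  change x • φ m = x • 0
  rw [← map_smul, hxM, map_zero, smul_zero]

theorem ext_zero_eq_zero {M N : Type u} [AddCommGroup M] [Module A M] [AddCommGroup N]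
    [Module A N] {x : A} (hxN : IsSMulRegular N x) (hxM : ∀ m : M, x • m = 0)
    (e : Ext (ModuleCat.of A M) (ModuleCat.of A N) 0) : e = 0 := by
  obtain ⟨φ, rfl⟩ := (Ext.mk₀_bijective _ _).2 e
  have : φ = 0 := by
    ext1
    exact hom_eq_zero_of_isSMulRegular hxN hxM φ.hom
  rw [this, Ext.mk₀_zero]

theorem smul_ext_eq_zero {M N : Type u} [AddCommGroup M] [Module A M] [AddCommGroup N]
    [Module A N] {x : A} (hxM : ∀ m : M, x • m = 0) {n : ℕ}
    (e : Ext (ModuleCat.of A M) (ModuleCat.of A N) n) : x • e = 0 := by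
  have h1 : x • (𝟙 (ModuleCat.of A M)) = 0 := by
    ext m
    exact hxM m
  have h2 : x • e = (Ext.mk₀ (x • (𝟙 (ModuleCat.of A M)))).comp e (zero_add n) := by
    rw [Ext.mk₀_smul, Ext.smul_comp, Ext.mk₀_id_comp]
  rw [h2, h1, Ext.mk₀_zero, Ext.zero_comp]

/-- If `x` is regular on `N` and annihilates `M`, then `Ext ^ 1 (M, N) = Hom (M, N / x N)`. -/
theorem length_ext_one_eq {M N : Type u} [AddCommGroup M] [Module A M] [AddCommGroup N]
    [Module A N] {x : A} (hxN : IsSMulRegular N x) (hxM : ∀ m : M, x • m = 0) :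
    Module.length A (Ext (ModuleCat.of A M) (ModuleCat.of A N) 1) =
      Module.length A (M →ₗ[A] QuotSMulTop x N) := by
  have hS : (ModuleCat.smulShortComplex (ModuleCat.of A N) x).ShortExact :=
    IsSMulRegular.smulShortComplex_shortExact (M := ModuleCat.of A N) hxN
  -- The connecting map of `0 → N → N → N/xN → 0` is injective since `Hom(M, N) = 0`, and surjective
  -- since `x` kills `Ext¹(M, N)`.
  have h1 : Function.Bijective (hS.extClass.postcompOfLinear A (ModuleCat.of A M)
      (zero_add 1)) := by
    constructor
    · rw [injective_iff_map_eq_zero]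
      intro e he
      obtain ⟨e', rfl⟩ := Ext.covariant_sequence_exact₃ _ hS e (zero_add 1) he
      have h0 : e' = 0 := ext_zero_eq_zero hxN hxM e'
      rw [h0, Ext.zero_comp]
    · intro e
      refine Ext.covariant_sequence_exact₁ _ hS e ?_ (zero_add 1)
      exact (Ext.smul_eq_comp_mk₀ e x).symm.trans (smul_ext_eq_zero hxM e)
  exact (LinearEquiv.ofBijective _ h1).length_eq.symm.trans
    (Ext.linearEquiv₀.trans ModuleCat.homLinearEquiv).length_eq

section

variable [IsLocalRing A] [IsNoetherianRing A] {x : A} {N : Type u} [AddCommGroup N] [Module A N]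
  [Module.Finite A N]

/-- In degree one this is the extension of maps from the syzygy to the free module. Higher degrees
shift down, because a syzygy inside a free module is again `x`-regular. -/
theorem ext_eq_zero_of_isSMulRegular (hx : IsFiniteLength A (A ⧸ Ideal.span {x}))
    (hxm : x ∈ IsLocalRing.maximalIdeal A) (hxA : x ∈ nonZeroDivisors A)
    (hxN : IsSMulRegular N x)
    (hN : Module.length A (QuotSMulTop x N) = Module.length A (QuotSMulTop x A))
    (hk : Module.length A (IsLocalRing.ResidueField A →ₗ[A] QuotSMulTop x N) ≤ 1)
    {n : ℕ} {F : Type u} [AddCommGroup F] [Module A F] [Module.Finite A F]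
    (hF : IsSMulRegular F x) (e : Ext (ModuleCat.of A F) (ModuleCat.of A N) (n + 1)) : e = 0 := by
  induction n generalizing F with
  | zero =>
    obtain ⟨P, _, _, _, _, f, hf⟩ := Module.exists_finite_presentation A F
    have hS := LinearMap.shortExact_shortComplexKer hf
    have hproj : Projective f.shortComplexKer.X₂ :=
      inferInstanceAs (Projective (ModuleCat.of A P))
    obtain ⟨e', rfl⟩ := Ext.contravariant_sequence_exact₃ hS (ModuleCat.of A N) e
      (Ext.eq_zero_of_projective _) (add_zero 1)
    obtain ⟨φ, rfl⟩ := (Ext.mk₀_bijective _ _).2 e'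
    have hker : IsSMulRegular (P ⧸ LinearMap.ker f) x :=
      ((f.quotKerEquivOfSurjective hf).isSMulRegular_congr x).2 hF
    obtain ⟨ψ, hψ⟩ := lcomp_subtype_surjective hx hxm hxN hN hk (LinearMap.ker f) hker φ.hom
    have h1 : φ = f.shortComplexKer.f ≫ ModuleCat.ofHom ψ := by
      ext1
      exact hψ.symm
    rw [h1, ← Ext.mk₀_comp_mk₀, ← Ext.comp_assoc_of_second_deg_zero, hS.extClass_comp, Ext.zero_comp]
  | succ n ih =>
    obtain ⟨P, _, _, _, _, f, hf⟩ := Module.exists_finite_presentation A F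
    have hproj : Projective f.shortComplexKer.X₂ :=
      inferInstanceAs (Projective (ModuleCat.of A P))
    refine ext_eq_zero_of_shortExact_of_projective (LinearMap.shortExact_shortComplexKer hf)
      (fun e => ih (F := LinearMap.ker f) ?_ e) e
    have hP : IsSMulRegular P x := by
      have hA : IsSMulRegular A x := fun a b h => by
        exact (mul_cancel_left_mem_nonZeroDivisors hxA).1 h
      have := (Module.Free.chooseBasis A P).equivFun
      refine (this.isSMulRegular_congr x).2 fun a b h => ?_
      funext i
      exact hA (congrFun h i)
    intro a b h
    exact Subtype.ext (hP (congrArg Subtype.val h))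

/-- `A/I` need not be `x`-regular but its syzygy `I` is, so vanishing starts one degree later. -/
theorem ext_quotient_eq_zero (hx : IsFiniteLength A (A ⧸ Ideal.span {x}))
    (hxm : x ∈ IsLocalRing.maximalIdeal A) (hxA : x ∈ nonZeroDivisors A)
    (hxN : IsSMulRegular N x)
    (hN : Module.length A (QuotSMulTop x N) = Module.length A (QuotSMulTop x A))
    (hk : Module.length A (IsLocalRing.ResidueField A →ₗ[A] QuotSMulTop x N) ≤ 1)
    {n : ℕ} (I : Ideal A) (e : Ext (ModuleCat.of A (A ⧸ I)) (ModuleCat.of A N) (n + 2)) :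
    e = 0 := by
  have hproj : Projective (I.mkQ).shortComplexKer.X₂ :=
    inferInstanceAs (Projective (ModuleCat.of A A))
  refine ext_eq_zero_of_shortExact_of_projective (LinearMap.shortExact_shortComplexKer
    (f := I.mkQ) I.mkQ_surjective) (fun e => ext_eq_zero_of_isSMulRegular hx hxm hxA hxN hN hk
      (F := LinearMap.ker I.mkQ) ?_ e) e
  intro a b h
  exact Subtype.ext ((mul_cancel_left_mem_nonZeroDivisors hxA).1 (congrArg Subtype.val h))

end

end ExtVanishing

/-! ### Finite injective dimension forces type one -/

section FiniteInjectiveDimension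

open Abelian
open scoped Pointwise

variable {A : Type u} [CommRing A]

/-- The short exact sequence `0 → N → M → M / N → 0`. -/
abbrev submoduleShortComplex {M : Type u} [AddCommGroup M] [Module A M] (N : Submodule A M) :
    ShortComplex (ModuleCat.{u} A) :=
  ModuleCat.shortComplexOfCompEqZero N.subtype N.mkQ (LinearMap.exact_subtype_mkQ N).linearMap_comp_eq_zero

theorem shortExact_submoduleShortComplex {M : Type u} [AddCommGroup M] [Module A M]
    (N : Submodule A M) : (submoduleShortComplex N).ShortExact where
  exact := ModuleCat.shortComplex_exact _ (LinearMap.exact_subtype_mkQ N)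
  mono_f := (ModuleCat.mono_iff_injective _).2 N.subtype_injective
  epi_g := (ModuleCat.epi_iff_surjective _).2 N.mkQ_surjective

theorem ext_eq_zero_of_linearEquiv {M M' : Type u} [AddCommGroup M] [Module A M] [AddCommGroup M']
    [Module A M'] (f : M ≃ₗ[A] M') {N : ModuleCat.{u} A} {n : ℕ}
    (h : ∀ e : Ext (ModuleCat.of A M) N n, e = 0) (e : Ext (ModuleCat.of A M') N n) : e = 0 := by
  have h1 : (Ext.mk₀ f.symm.toModuleIso.hom).comp
      ((Ext.mk₀ f.toModuleIso.hom).comp e (zero_add n)) (zero_add n) = e := by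
    rw [← Ext.comp_assoc_of_second_deg_zero, Ext.mk₀_comp_mk₀]
    have : f.symm.toModuleIso.hom ≫ f.toModuleIso.hom = 𝟙 _ := by
      ext m
      exact f.apply_symm_apply m
    rw [this, Ext.mk₀_id_comp]
  rw [← h1, h ((Ext.mk₀ f.toModuleIso.hom).comp e (zero_add n)), Ext.comp_zero]

theorem ext_quotSMulTop_eq_zero {x : A} (hxA : IsSMulRegular A x) {N : ModuleCat.{u} A} {n : ℕ}
    (e : Ext (ModuleCat.of A (QuotSMulTop x A)) N (n + 2)) : e = 0 := by
  have hS : (ModuleCat.smulShortComplex (ModuleCat.of A A) x).ShortExact :=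
    IsSMulRegular.smulShortComplex_shortExact (M := ModuleCat.of A A) hxA
  have h1 : Projective (ModuleCat.smulShortComplex (ModuleCat.of A A) x).X₁ :=
    inferInstanceAs (Projective (ModuleCat.of A A))
  have h2 : Projective (ModuleCat.smulShortComplex (ModuleCat.of A A) x).X₂ :=
    inferInstanceAs (Projective (ModuleCat.of A A))
  exact ext_eq_zero_of_shortExact_of_projective hS (fun e => Ext.eq_zero_of_projective e) e

variable [IsLocalRing A]

/-- The vanishing of `Ext` from the residue field implies the vanishing of `Ext` from modules
of finite length. -/
theorem ext_eq_zero_of_isFiniteLength {N : ModuleCat.{u} A} {n : ℕ}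
    (h : ∀ e : Ext (ModuleCat.of A (IsLocalRing.ResidueField A)) N n, e = 0) {M : Type u}
    [AddCommGroup M] [Module A M] (hM : IsFiniteLength A M) (e : Ext (ModuleCat.of A M) N n) :
    e = 0 := by
  induction hM with
  | @of_subsingleton M _ _ _ =>
    have h0 : Limits.IsZero (ModuleCat.of A M) := ModuleCat.isZero_of_subsingleton _
    rw [← Ext.mk₀_id_comp e, h0.eq_of_src (𝟙 _) 0, Ext.mk₀_zero, Ext.zero_comp]
  | @of_simple_quotient M _ _ L _ _ ih =>
    obtain ⟨f⟩ := nonempty_equiv_residueField (A := A) (M := M ⧸ L)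
    obtain ⟨e', rfl⟩ := Ext.contravariant_sequence_exact₂ (shortExact_submoduleShortComplex L) N e
      (ih _)
    have h0 : e' = 0 := ext_eq_zero_of_linearEquiv f.symm h e'
    rw [h0, Ext.comp_zero]

/-- With vanishing in the two neighbouring degrees, `Ext^(n+1)(–, N)` is exact on modules of finite
length, so its length is additive along a composition series. -/
theorem length_ext_eq_mul {N : ModuleCat.{u} A} {n : ℕ}
    (h : ∀ e : Ext (ModuleCat.of A (IsLocalRing.ResidueField A)) N n, e = 0)
    (h' : ∀ e : Ext (ModuleCat.of A (IsLocalRing.ResidueField A)) N (n + 2), e = 0) {M : Type u}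
    [AddCommGroup M] [Module A M] (hM : IsFiniteLength A M) :
    Module.length A (Ext (ModuleCat.of A M) N (n + 1)) = Module.length A M *
      Module.length A (Ext (ModuleCat.of A (IsLocalRing.ResidueField A)) N (n + 1)) := by
  induction hM with
  | @of_subsingleton M _ _ _ =>
    have h0 : Limits.IsZero (ModuleCat.of A M) := ModuleCat.isZero_of_subsingleton _
    have : Subsingleton (Ext (ModuleCat.of A M) N (n + 1)) := by
      refine subsingleton_of_forall_eq 0 fun e => ?_
      rw [← Ext.mk₀_id_comp e, h0.eq_of_src (𝟙 _) 0, Ext.mk₀_zero, Ext.zero_comp]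
    rw [Module.length_eq_zero, Module.length_eq_zero, zero_mul]
  | @of_simple_quotient M _ _ L _ hL ih =>
    obtain ⟨f⟩ := nonempty_equiv_residueField (A := A) (M := M ⧸ L)
    have hS := shortExact_submoduleShortComplex L
    have h1 : Module.length A (Ext (ModuleCat.of A (M ⧸ L)) N (n + 1)) =
        Module.length A (Ext (ModuleCat.of A (IsLocalRing.ResidueField A)) N (n + 1)) := by
      refine (LinearEquiv.ofBijective ((Ext.mk₀ f.toModuleIso.hom).precompOfLinear A N
        (zero_add (n + 1))) ?_).length_eq.symm
      refine Function.bijective_iff_has_inverse.2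
        ⟨(Ext.mk₀ f.toModuleIso.inv).precompOfLinear A N (zero_add (n + 1)), fun e => ?_,
          fun e => ?_⟩
      · change (Ext.mk₀ f.toModuleIso.inv).comp ((Ext.mk₀ f.toModuleIso.hom).comp e (zero_add _)) (zero_add _) = e
        rw [← Ext.comp_assoc_of_second_deg_zero, Ext.mk₀_comp_mk₀, Iso.inv_hom_id, Ext.mk₀_id_comp]
      · change (Ext.mk₀ f.toModuleIso.hom).comp ((Ext.mk₀ f.toModuleIso.inv).comp e (zero_add _)) (zero_add _) = e
        rw [← Ext.comp_assoc_of_second_deg_zero, Ext.mk₀_comp_mk₀, Iso.hom_inv_id, Ext.mk₀_id_comp]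
    have h5 : Module.length A (Ext (ModuleCat.of A M) N (n + 1)) =
        Module.length A (Ext (ModuleCat.of A (M ⧸ L)) N (n + 1)) +
          Module.length A (Ext (ModuleCat.of A L) N (n + 1)) := by
      let φ := (Ext.mk₀ (submoduleShortComplex L).g).precompOfLinear A N (zero_add (n + 1))
      let ψ := (Ext.mk₀ (submoduleShortComplex L).f).precompOfLinear A N (zero_add (n + 1))
      refine Module.length_eq_add_of_exact φ ψ ?_ ?_ ?_
      · rw [injective_iff_map_eq_zero]
        intro e he
        obtain ⟨e', rfl⟩ := Ext.contravariant_sequence_exact₃ hS N e he (add_comm 1 n)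
        have h0 : e' = 0 := ext_eq_zero_of_isFiniteLength h hL e'
        rw [h0, Ext.comp_zero]
      · intro e
        exact Ext.contravariant_sequence_exact₁ hS N e (show 1 + (n + 1) = n + 2 by omega)
          (ext_eq_zero_of_linearEquiv f.symm h' _)
      · intro e
        constructor
        · exact Ext.contravariant_sequence_exact₂ hS N e
        · rintro ⟨e', rfl⟩
          change (Ext.mk₀ (submoduleShortComplex L).f).comp
            ((Ext.mk₀ (submoduleShortComplex L).g).comp e' (zero_add _)) (zero_add _) = 0
          rw [← Ext.comp_assoc_of_second_deg_zero, Ext.mk₀_comp_mk₀, ShortComplex.zero, Ext.mk₀_zero,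
            Ext.zero_comp]
    rw [h5, h1, ih, Module.length_eq_add_of_exact (R := A) L.subtype L.mkQ L.subtype_injective
      L.mkQ_surjective (LinearMap.exact_subtype_mkQ L), Module.length_eq_one A (M ⧸ L), add_mul,
      one_mul, add_comm]

theorem exists_submodule_equiv_residueField {M : Type*} [AddCommGroup M] [Module A M] [Nontrivial M]
    (hM : IsFiniteLength A M) :
    ∃ L : Submodule A M, Nonempty (L ≃ₗ[A] IsLocalRing.ResidueField A) := by
  obtain ⟨_, _⟩ := isFiniteLength_iff_isNoetherian_isArtinian.1 hM
  obtain ⟨L, hL, -⟩ := (eq_bot_or_exists_atom_le (⊤ : Submodule A M)).resolve_left top_ne_bot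
  have : IsSimpleModule A L := isSimpleModule_iff_isAtom.2 hL
  exact ⟨L, nonempty_equiv_residueField⟩

theorem nontrivial_quotSMulTop {x : A} (hxm : x ∈ IsLocalRing.maximalIdeal A) :
    Nontrivial (QuotSMulTop x A) := by
  rw [Submodule.Quotient.nontrivial_iff]
  intro h
  obtain ⟨y, -, hy⟩ := h.ge (trivial : (1 : A) ∈ ⊤)
  exact (IsLocalRing.mem_maximalIdeal x).1 hxm (IsUnit.of_mul_eq_one y hy)

theorem ext_residueField_eq_zero {x : A} (hxA : IsSMulRegular A x)
    (hx : IsFiniteLength A (QuotSMulTop x A)) (hxm : x ∈ IsLocalRing.maximalIdeal A)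
    {N : ModuleCat.{u} A} {i : ℕ} (hN : HasInjectiveDimensionLE N i) {n : ℕ}
    (e : Ext (ModuleCat.of A (IsLocalRing.ResidueField A)) N (n + 2)) : e = 0 := by
  -- Descending induction on the degree, `k` bounding the distance to the range where finite
  -- injective dimension gives vanishing. The residue field embeds in `A/x`, whose `Ext` vanishes
  -- from degree two on, and the cokernel has finite length.
  obtain ⟨k, hk⟩ : ∃ k, i + 1 ≤ n + 2 + k := ⟨i + 1, by omega⟩
  induction k generalizing n with
  | zero => exact Ext.eq_zero_of_hasInjectiveDimensionLT e (i + 1) hk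
  | succ k ih =>
    have := nontrivial_quotSMulTop hxm
    obtain ⟨L, ⟨f⟩⟩ := exists_submodule_equiv_residueField hx
    refine ext_eq_zero_of_linearEquiv f (fun e => ?_) e
    obtain ⟨e', rfl⟩ := Ext.contravariant_sequence_exact₁ (shortExact_submoduleShortComplex L) N e
      (show 1 + (n + 2) = (n + 1) + 2 by omega)
      (ext_eq_zero_of_isFiniteLength (fun e => ih e (by omega))
        (hx.of_surjective L.mkQ_surjective) _)
    have h0 : e' = 0 := ext_quotSMulTop_eq_zero hxA e'
    rw [h0, Ext.comp_zero]

/-- A one-dimensional local ring of finite injective dimension has type one. -/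
theorem length_hom_residueField_eq_one {x : A} (hxA : IsSMulRegular A x)
    (hx : IsFiniteLength A (QuotSMulTop x A)) (hxm : x ∈ IsLocalRing.maximalIdeal A) {i : ℕ}
    (hA : HasInjectiveDimensionLE (ModuleCat.of A A) i) :
    Module.length A (IsLocalRing.ResidueField A →ₗ[A] QuotSMulTop x A) = 1 := by
  have hk : ∀ m : IsLocalRing.ResidueField A, x • m = 0 := by
    intro m
    rw [Algebra.smul_def, IsLocalRing.ResidueField.algebraMap_eq,
      (IsLocalRing.residue_eq_zero_iff x).2 hxm, zero_mul]
  have h1 := length_ext_eq_mul (N := ModuleCat.of A A) (n := 0)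
    (fun e => ext_zero_eq_zero hxA hk e)
    (fun e => ext_residueField_eq_zero hxA hx hxm hA e) hx
  -- `Ext¹(A/x, A)` is `A/x`, so multiplicativity reads `ℓ(A/x) = ℓ(A/x) · ℓ(Ext¹(k, A))`, and the
  -- finite nonzero factor cancels.
  have h2 : Module.length A (Ext (ModuleCat.of A (QuotSMulTop x A)) (ModuleCat.of A A) 1) =
      Module.length A (QuotSMulTop x A) := by
    rw [length_ext_one_eq hxA (smul_quotSMulTop x), ← length_hom_quotSMulTop]
    exact (LinearMap.ringLmapEquivSelf A A (QuotSMulTop x A)).length_eq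
  rw [zero_add, h2, length_ext_one_eq hxA hk] at h1
  have := nontrivial_quotSMulTop hxm
  have h3 : Module.length A (QuotSMulTop x A) ≠ ⊤ := Module.length_ne_top_iff.2 hx
  have h4 : Module.length A (QuotSMulTop x A) ≠ 0 := (Module.length_pos (R := A)).ne'
  generalize Module.length A (QuotSMulTop x A) = a at h1 h3 h4
  generalize Module.length A (IsLocalRing.ResidueField A →ₗ[A] QuotSMulTop x A) = b at h1 ⊢
  lift a to ℕ using h3
  have hb : b ≠ ⊤ := by
    rintro rfl
    rw [ENat.mul_top h4] at h1
    exact ENat.natCast_ne_top a h1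
  lift b to ℕ using hb
  norm_cast at *
  exact (Nat.eq_of_mul_eq_mul_left (Nat.pos_of_ne_zero h4) (by rw [mul_one]; exact h1)).symm

end FiniteInjectiveDimension

/-! ### Canonical modules and Gorenstein rings through type one -/

section Canonical

open scoped Pointwise

/-- The socle of `M`, as the module of homomorphisms from the residue field. -/
theorem length_hom_residueField_eq {A M : Type*} [CommRing A] [IsLocalRing A] [AddCommGroup M]
    [Module A M] {T : Submodule A M}
    (hT : ∀ m, m ∈ T ↔ ∀ r ∈ IsLocalRing.maximalIdeal A, r • m = 0) :
    Module.length A (IsLocalRing.ResidueField A →ₗ[A] M) = Module.length A T := by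
  let φ : (IsLocalRing.ResidueField A →ₗ[A] M) →ₗ[A] T :=
    (LinearMap.applyₗ (1 : IsLocalRing.ResidueField A) : _ →ₗ[A] M).codRestrict T fun h => by
      refine (hT _).2 fun r hr => ?_
      change r • h 1 = 0
      rw [← map_smul, Algebra.smul_def, IsLocalRing.ResidueField.algebraMap_eq,
        (IsLocalRing.residue_eq_zero_iff r).2 hr, zero_mul, map_zero]
  refine (LinearEquiv.ofBijective φ ⟨?_, ?_⟩).length_eq
  · rw [injective_iff_map_eq_zero]
    intro h hh
    have h1 : h 1 = 0 := congrArg Subtype.val hh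
    ext k
    obtain ⟨a, rfl⟩ := IsLocalRing.residue_surjective k
    rw [← IsLocalRing.ResidueField.algebraMap_eq, Algebra.algebraMap_eq_smul_one, map_smul, h1,
      smul_zero]
    rfl
  · rintro ⟨m, hm⟩
    refine ⟨Submodule.liftQ (IsLocalRing.maximalIdeal A) (LinearMap.toSpanSingleton A M m)
      fun r hr => (hT m).1 hm r hr, Subtype.ext ?_⟩
    exact one_smul A m

variable {A : Type u} {V : Type v} [CommRing A] [CommRing V] [Algebra A V]

theorem length_quotSMulTop_eq_relLength {x : A} {w : Vˣ} (hw : (w : V) = algebraMap A V x)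
    (K : Submodule A V) :
    Module.length A (QuotSMulTop x K) = relLength (Submodule.span A {(w : V)} * K) K := by
  symm
  refine relLength_eq_length_of_ker (x • (⊤ : Submodule A K)).mkQ (Submodule.mkQ_surjective _)
    fun g => ?_
  rw [Submodule.mkQ_apply, Submodule.Quotient.mk_eq_zero, Submodule.mem_span_singleton_mul]
  constructor
  · rintro ⟨k, -, rfl⟩
    exact ⟨k, k.2, by rw [hw, ← Algebra.smul_def]; rfl⟩
  · rintro ⟨k, hk, hk'⟩
    refine ⟨⟨k, hk⟩, trivial, Subtype.ext ?_⟩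
    rw [← hk', hw, ← Algebra.smul_def]
    rfl

theorem length_hom_congr {x : A} {N N' : Type*} [AddCommGroup N] [Module A N] [AddCommGroup N']
    [Module A N'] (e : N ≃ₗ[A] N') (M : Type*) [AddCommGroup M] [Module A M] :
    Module.length A (M →ₗ[A] QuotSMulTop x N) = Module.length A (M →ₗ[A] QuotSMulTop x N') :=
  (LinearEquiv.congrRight (QuotSMulTop.congr x e)).length_eq

variable [IsLocalRing A]

theorem smul_residueField_eq_zero {x : A} (hxm : x ∈ IsLocalRing.maximalIdeal A)
    (m : IsLocalRing.ResidueField A) : x • m = 0 := by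
  rw [Algebra.smul_def, IsLocalRing.ResidueField.algebraMap_eq,
    (IsLocalRing.residue_eq_zero_iff x).2 hxm, zero_mul]

/-- Multiplication by `x` carries `K : 𝔪` onto the socle of `K/xK`, and its kernel is `K`. -/
theorem length_hom_residueField_quotSMulTop {x : A} (hxm : x ∈ IsLocalRing.maximalIdeal A) {w : Vˣ}
    (hw : (w : V) = algebraMap A V x) (K : Submodule A V) :
    Module.length A (IsLocalRing.ResidueField A →ₗ[A] QuotSMulTop x K) =
      relLength K (socleHull K) := by
  let ψ : socleHull K →ₗ[A] QuotSMulTop x K := (x • (⊤ : Submodule A K)).mkQ ∘ₗ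
    ((LinearMap.lsmul A V x).comp (socleHull K).subtype).codRestrict K
      fun v => mem_socleHull.1 v.2 x hxm
  have hx : ∀ {v v' : V}, x • v = x • v' → v = v' := by
    intro v v' h
    rw [Algebra.smul_def, Algebra.smul_def, ← hw] at h
    exact w.isUnit.mul_left_cancel h
  rw [length_hom_residueField_eq (T := LinearMap.range ψ)]
  · refine (relLength_eq_length_of_ker ψ.rangeRestrict ψ.surjective_rangeRestrict
      fun v => ?_).symm
    rw [Subtype.ext_iff]
    refine (Submodule.Quotient.mk_eq_zero _).trans ⟨?_, fun h => ?_⟩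
    · rintro ⟨k, -, hk⟩
      have h1 : (k : V) = v := hx (congrArg Subtype.val hk)
      exact h1 ▸ k.2
    · exact ⟨⟨v, h⟩, trivial, rfl⟩
  · intro m
    constructor
    · rintro ⟨v, rfl⟩ r hr
      rw [← map_smul]
      exact (Submodule.Quotient.mk_eq_zero _).2
        ⟨⟨r • v, mem_socleHull.1 v.2 r hr⟩, trivial, rfl⟩
    · obtain ⟨k, rfl⟩ := Submodule.Quotient.mk_surjective _ m
      intro h
      have hk : ∀ r ∈ IsLocalRing.maximalIdeal A, ∃ k' : K, x • (k' : V) = r • (k : V) := by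
        intro r hr
        obtain ⟨k', -, hk'⟩ := (Submodule.Quotient.mk_eq_zero (x • (⊤ : Submodule A K))
          (x := r • k)).1 (h r hr)
        exact ⟨k', congrArg Subtype.val hk'⟩
      have hxv : x • (((w⁻¹ : Vˣ) : V) * k) = k := by
        rw [Algebra.smul_def, ← hw, ← mul_assoc, Units.mul_inv, one_mul]
      refine ⟨⟨((w⁻¹ : Vˣ) : V) * k, mem_socleHull.2 fun r hr => ?_⟩, ?_⟩
      · obtain ⟨k', hk'⟩ := hk r hr
        rw [← hxv, smul_comm] at hk'
        rw [← hx hk']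
        exact k'.2
      · exact congrArg (Submodule.Quotient.mk (p := x • (⊤ : Submodule A K))) (Subtype.ext hxv)

variable [IsOneDimExtension A V]

theorem isSMulRegular_submodule {x : A} (hx : x ∈ nonZeroDivisors A) (K : Submodule A V) :
    IsSMulRegular K x := by
  obtain ⟨w, hw⟩ := IsOneDimExtension.isUnit (V := V) x hx
  intro a b h
  refine Subtype.ext (w.isUnit.mul_left_cancel ?_)
  rw [hw, ← Algebra.smul_def, ← Algebra.smul_def]
  exact congrArg Subtype.val h

variable (A V) in
/-- `A` as a submodule of an extension. -/
noncomputable def oneEquiv : A ≃ₗ[A] (1 : Submodule A V) :=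
  (LinearEquiv.ofInjective (Algebra.linearMap A V) IsOneDimExtension.injective).trans
    (LinearEquiv.ofEq _ _ Submodule.one_eq_range.symm)

variable [IsNoetherianRing A]

variable (V) in
theorem length_quotSMulTop_eq_of_linearEquiv {x : A} (hx : x ∈ nonZeroDivisors A)
    {K : Submodule A V} (hK : IsRegularFractional K) {N : Type*} [AddCommGroup N] [Module A N]
    (e : N ≃ₗ[A] K) :
    Module.length A (QuotSMulTop x N) = Module.length A (QuotSMulTop x A) := by
  obtain ⟨w, hw⟩ := IsOneDimExtension.isUnit (V := V) x hx
  rw [(QuotSMulTop.congr x e).length_eq, (QuotSMulTop.congr x (oneEquiv A V)).length_eq,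
    length_quotSMulTop_eq_relLength hw, length_quotSMulTop_eq_relLength hw,
    relLength_scale_self hw hK .one]

/-- Gorenstein local rings of dimension one are those of type one. -/
theorem isGorensteinLocalRing_iff : IsGorensteinLocalRing A ↔ HasTypeOne (1 : Submodule A V) := by
  obtain ⟨x, hxm, hx⟩ := IsOneDimExtension.exists_mem (A := A) (V := V)
  obtain ⟨w, hw⟩ := IsOneDimExtension.isUnit (V := V) x hx
  have hfin := IsOneDimExtension.isFiniteLength (V := V) x hx
  have hxA : IsSMulRegular A x := fun a b h => (mul_cancel_left_mem_nonZeroDivisors hx).1 h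
  have h1 : Module.length A (IsLocalRing.ResidueField A →ₗ[A] QuotSMulTop x A) =
      relLength 1 (socleHull (1 : Submodule A V)) := by
    rw [length_hom_congr (oneEquiv A V), length_hom_residueField_quotSMulTop hxm hw]
  rw [HasTypeOne, ← h1]
  constructor
  · rintro ⟨-, -, i, hi⟩
    exact length_hom_residueField_eq_one hxA (isFiniteLength_quotSMulTop hfin A) hxm hi
  · intro h
    exact ⟨inferInstance, inferInstance, 1, hasInjectiveDimensionLE_one_of_ext_quotient
      fun I e => ext_quotient_eq_zero hfin hxm hx hxA rfl h.le I e⟩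

end Canonical

section CanonicalModule

open scoped Pointwise

variable {A : Type u} {V : Type v} [CommRing A] [CommRing V] [Algebra A V]
  [IsCohenMacaulayLocalRing A] [IsOneDimExtension A V]

/-- Canonical modules of one-dimensional rings are fractional modules of type one. -/
theorem isCanonicalModule_iff (hdim : ringKrullDim A = 1) {K : Submodule A V}
    (hK : IsRegularFractional K) {N : Type u} [AddCommGroup N] [Module A N]
    (e : N ≃ₗ[A] K) : IsCanonicalModule A N ↔ HasTypeOne K := by
  obtain ⟨x, hxm, hx⟩ := IsOneDimExtension.exists_mem (A := A) (V := V)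
  obtain ⟨w, hw⟩ := IsOneDimExtension.isUnit (V := V) x hx
  have hfin := IsOneDimExtension.isFiniteLength (V := V) x hx
  have hxN : IsSMulRegular N x := (e.isSMulRegular_congr x).2 (isSMulRegular_submodule hx K)
  have := hK.fg
  have hN : Module.Finite A N := Module.Finite.equiv e.symm
  have h1 : Module.length A (IsLocalRing.ResidueField A →ₗ[A] QuotSMulTop x N) =
      relLength K (socleHull K) := by
    rw [length_hom_congr e, length_hom_residueField_quotSMulTop hxm hw]
  have h2 := length_ext_one_eq hxN (smul_residueField_eq_zero hxm)
  rw [h1] at h2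
  rw [HasTypeOne, ← h2, IsCanonicalModule, hdim]
  constructor
  · rintro ⟨-, h⟩
    exact (h 1).trans (if_pos rfl)
  · intro h
    refine ⟨hN, fun i => ?_⟩
    match i with
    | 0 =>
      have : Subsingleton (Abelian.Ext (ModuleCat.of A (IsLocalRing.ResidueField A))
          (ModuleCat.of A N) 0) :=
        subsingleton_of_forall_eq 0 fun e => ext_zero_eq_zero hxN (smul_residueField_eq_zero hxm) e
      rw [Module.length_eq_zero, if_neg (by simp)]
    | 1 => exact h.trans (if_pos rfl).symm
    | i + 2 =>
      have : Subsingleton (Abelian.Ext (ModuleCat.of A (IsLocalRing.ResidueField A))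
          (ModuleCat.of A N) (i + 2)) :=
        subsingleton_of_forall_eq 0 fun e' => ext_quotient_eq_zero hfin hxm hx hxN
          (length_quotSMulTop_eq_of_linearEquiv V hx hK e) (by rw [h1, ← h2]; exact h.le)
          (IsLocalRing.maximalIdeal A) e'
      rw [Module.length_eq_zero, if_neg (by
        intro hi
        have h3 : i + 2 = 1 := by exact_mod_cast hi
        omega)]

end CanonicalModule

/-! ### Sally modules generated in degree one -/

theorem sub_mem_of_mk_eq {T M : Type*} [CommRing T] [AddCommGroup M] [Module T M]
    {N P : Submodule T M} {x y : N}
    (h : (Submodule.Quotient.mk x : SubmoduleQuotient N P) = Submodule.Quotient.mk y) :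
    (x : M) - y ∈ P :=
  (Submodule.Quotient.eq (P.submoduleOf N)).1 h

theorem mk_eq_zero_iff_mem {T M : Type*} [CommRing T] [AddCommGroup M] [Module T M]
    {N P : Submodule T M} {x : N} :
    (Submodule.Quotient.mk x : SubmoduleQuotient N P) = 0 ↔ (x : M) ∈ P :=
  Submodule.Quotient.mk_eq_zero (P.submoduleOf N)

section Sally

variable {A : Type u} [CommRing A] {Q I : Ideal A}

theorem monomial_mem_sallyNumerator {i : ℕ} {y : A} (hy : y ∈ I ^ (i + 1)) :
    monomial i y ∈ sallyNumerator Q I := by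
  rw [pow_succ'] at hy
  refine Submodule.smul_induction_on hy (fun x hx z hz => ?_) fun x y hx hy => ?_
  · refine Submodule.subset_span ⟨x, hx, monomial i z, reesAlgebra.monomial_mem.2 hz, ?_⟩
    rw [C_mul_monomial, smul_eq_mul]
  · rw [map_add]
    exact add_mem hx hy

theorem coeff_mem_of_mem_sallyNumerator (hQ : Q ≤ I) {p : A[X]} (hp : p ∈ sallyNumerator Q I)
    (i : ℕ) : p.coeff i ∈ I ^ (i + 1) := by
  induction hp using Submodule.span_induction generalizing i with
  | mem p h =>
    obtain ⟨x, hx, r, hr, rfl⟩ := h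
    rw [coeff_C_mul, pow_succ']
    exact Ideal.mul_mem_mul hx (hr i)
  | zero => simp
  | add p q _ _ hp hq =>
    rw [coeff_add]
    exact add_mem (hp i) (hq i)
  | smul t p _ hp =>
    rw [Subalgebra.smul_def, smul_eq_mul, coeff_mul]
    refine sum_mem fun j hj => ?_
    rw [← Finset.HasAntidiagonal.mem_antidiagonal.1 hj, add_assoc, pow_add]
    exact Ideal.mul_mem_mul (Ideal.pow_right_mono hQ _ (t.2 _)) (hp _)

theorem coeff_mem_of_mem_sallyDenominator {p : A[X]} (hp : p ∈ sallyDenominator Q I)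
    (i : ℕ) : p.coeff i ∈ Q ^ i * I := by
  induction hp using Submodule.span_induction generalizing i with
  | mem p h =>
    obtain ⟨x, hx, rfl⟩ := h
    rw [coeff_C]
    split_ifs with h
    · rw [h, pow_zero, one_mul]
      exact hx
    · exact zero_mem _
  | zero => simp
  | add p q _ _ hp hq =>
    rw [coeff_add]
    exact add_mem (hp i) (hq i)
  | smul t p _ hp =>
    rw [Subalgebra.smul_def, smul_eq_mul, coeff_mul]
    refine sum_mem fun j hj => ?_
    rw [← Finset.HasAntidiagonal.mem_antidiagonal.1 hj, pow_add, mul_assoc]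
    exact Ideal.mul_mem_mul (t.2 _) (hp _)

theorem monomial_mem_sallyDenominator {i : ℕ} {y : A} (hy : y ∈ Q ^ i * I) :
    monomial i y ∈ sallyDenominator Q I := by
  refine Submodule.smul_induction_on hy (fun x hx z hz => ?_) fun x y hx hy => ?_
  · have h : monomial i (x * z) =
        (⟨monomial i x, reesAlgebra.monomial_mem.2 hx⟩ : reesAlgebra Q) • (C z : A[X]) := by
      rw [Subalgebra.smul_def, smul_eq_mul, monomial_mul_C]
    rw [smul_eq_mul, h]
    exact Submodule.smul_mem _ _ (Submodule.subset_span ⟨z, hz, rfl⟩)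
  · rw [map_add]
    exact add_mem hx hy

theorem SallyGeneratedInDegreeOne.pow_three_eq (hQ : Q ≤ I) (h : SallyGeneratedInDegreeOne Q I) :
    I ^ 3 = Q * I ^ 2 := by
  refine le_antisymm (fun y hy => ?_) ?_
  · have key : ∀ s : SallyModule Q I, s ∈ Submodule.span (reesAlgebra Q) (sallyDegreeOne Q I) →
        ∃ p : sallyNumerator Q I, Submodule.Quotient.mk p = s ∧
          (p : A[X]).coeff 2 ∈ Q * I ^ 2 := by
      intro s hs
      induction hs using Submodule.span_induction with
      | mem s hs =>
        obtain ⟨x, hx, hx', rfl⟩ := hs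
        exact ⟨_, rfl, by simp [coeff_monomial]⟩
      | zero => exact ⟨0, rfl, by simp⟩
      | add s s' _ _ hs hs' =>
        obtain ⟨p, rfl, hp⟩ := hs
        obtain ⟨q, rfl, hq⟩ := hs'
        exact ⟨p + q, rfl, by simpa using add_mem hp hq⟩
      | smul t s _ hs =>
        obtain ⟨p, rfl, hp⟩ := hs
        refine ⟨t • p, rfl, ?_⟩
        have h0 := coeff_mem_of_mem_sallyNumerator hQ p.2 0
        have h1 := coeff_mem_of_mem_sallyNumerator hQ p.2 1
        have h2 := t.2 1
        have h3 := t.2 2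
        rw [zero_add, pow_one] at h0
        rw [pow_one] at h2
        have h4 : Q ^ 2 * I ≤ Q * I ^ 2 := by
          rw [pow_two, pow_two, mul_assoc]
          exact Ideal.mul_mono_right (Ideal.mul_mono_left hQ)
        change ((t : A[X]) * (p : A[X])).coeff 2 ∈ _
        rw [coeff_mul, Finset.Nat.sum_antidiagonal_succ, Finset.Nat.sum_antidiagonal_succ,
          Finset.Nat.antidiagonal_zero, Finset.sum_singleton]
        exact add_mem (Ideal.mul_mem_left _ _ hp)
          (add_mem (Ideal.mul_mem_mul h2 h1) (h4 (Ideal.mul_mem_mul h3 h0)))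
    obtain ⟨p, hp, hp'⟩ := key (Submodule.Quotient.mk ⟨monomial 2 y, monomial_mem_sallyNumerator hy⟩)
      (h ▸ Submodule.mem_top)
    have h1 := sub_mem_of_mk_eq hp
    have h2 := coeff_mem_of_mem_sallyDenominator h1 2
    rw [coeff_sub, coeff_monomial_same] at h2
    have h3 : Q ^ 2 * I ≤ Q * I ^ 2 := by
      rw [pow_two, pow_two, mul_assoc]
      exact Ideal.mul_mono_right (Ideal.mul_mono_left hQ)
    have h4 := sub_mem hp' (h3 h2)
    rwa [sub_sub_cancel] at h4
  · rw [pow_succ' I 2]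
    exact Ideal.mul_mono_left hQ

theorem sallyGeneratedInDegreeOne_of_pow_three_eq (hQ : Q ≤ I) (h : I ^ 3 = Q * I ^ 2) :
    SallyGeneratedInDegreeOne Q I := by
  have hpow : ∀ j : ℕ, I ^ (j + 2) = Q ^ j * I ^ 2 := by
    intro j
    induction j with
    | zero => rw [pow_zero, one_mul]
    | succ j ih =>
      rw [show j + 1 + 2 = j + 2 + 1 by omega, pow_succ' I (j + 2), ih, mul_left_comm,
        ← pow_succ' I 2, h, ← mul_assoc, pow_succ Q]
  -- Each homogeneous component is treated separately: degree zero vanishes in the quotient, and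
  -- degree `j + 1` is `Q^j I²` by the power formula.
  let G : A[X] → Prop := fun p => ∃ h : p ∈ sallyNumerator Q I,
    (Submodule.Quotient.mk ⟨p, h⟩ : SallyModule Q I) ∈
      Submodule.span (reesAlgebra Q) (sallyDegreeOne Q I)
  have hadd : ∀ p q, G p → G q → G (p + q) := fun p q ⟨hp, hp'⟩ ⟨hq, hq'⟩ =>
    ⟨add_mem hp hq, add_mem hp' hq'⟩
  have hsmul : ∀ (t : reesAlgebra Q) (p : A[X]), G p → G (t • p) := fun t p ⟨hp, hp'⟩ =>
    ⟨Submodule.smul_mem _ t hp, Submodule.smul_mem _ t hp'⟩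
  have hzero : G 0 := ⟨zero_mem _, zero_mem _⟩
  have h1 : ∀ x ∈ I ^ 2, G (monomial 1 x) := fun x hx =>
    ⟨monomial_mem_sallyNumerator hx, Submodule.subset_span ⟨x, hx, _, rfl⟩⟩
  have h2 : ∀ i, ∀ x ∈ I ^ (i + 1), G (monomial i x) := by
    intro i x hx
    match i with
    | 0 =>
      refine ⟨monomial_mem_sallyNumerator hx, ?_⟩
      have h3 : monomial 0 x ∈ sallyDenominator Q I :=
        monomial_mem_sallyDenominator (by simpa using hx)
      have h4 : (Submodule.Quotient.mk ⟨monomial 0 x, monomial_mem_sallyNumerator hx⟩ :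
          SallyModule Q I) = 0 :=
        mk_eq_zero_iff_mem.2 h3
      rw [h4]
      exact zero_mem _
    | j + 1 =>
      rw [show j + 1 + 1 = j + 2 by omega, hpow] at hx
      refine Submodule.smul_induction_on hx (fun y hy z hz => ?_) fun y z hy hz => ?_
      · have h : monomial (j + 1) (y * z) =
            (⟨monomial j y, reesAlgebra.monomial_mem.2 hy⟩ : reesAlgebra Q) •
              (monomial 1 z : A[X]) := by
          rw [Subalgebra.smul_def, smul_eq_mul, monomial_mul_monomial]
        rw [smul_eq_mul, h]
        exact hsmul _ _ (h1 z hz)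
      · rw [map_add]
        exact hadd _ _ hy hz
  rw [SallyGeneratedInDegreeOne, eq_top_iff]
  intro s _
  obtain ⟨p, rfl⟩ := Submodule.Quotient.mk_surjective _ s
  have h3 : G (p : A[X]) := by
    rw [as_sum_support (p : A[X])]
    exact Finset.sum_induction _ G hadd hzero
      fun i _ => h2 i _ (coeff_mem_of_mem_sallyNumerator hQ p.2 i)
  exact h3.2

end Sally

/-! ### Rees algebras of principal ideals as polynomial rings -/

section ReesPrincipal

variable {A : Type u} [CommRing A] {a : A}

variable (a) in
/-- The algebra homomorphism from polynomials to the Rees algebra of a principal ideal. -/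
noncomputable def toReesPrincipal : A[X] →ₐ[A] reesAlgebra (Ideal.span {a}) :=
  aeval ⟨monomial 1 a, reesAlgebra.monomial_mem.2 (by
    rw [pow_one]
    exact Ideal.mem_span_singleton_self a)⟩

theorem coe_toReesPrincipal_monomial (i : ℕ) (r : A) :
    (toReesPrincipal a (monomial i r) : A[X]) = monomial i (r * a ^ i) := by
  rw [toReesPrincipal, aeval_monomial, Subalgebra.coe_mul, Subalgebra.coe_pow, monomial_pow,
    one_mul, Subalgebra.coe_algebraMap, algebraMap_eq, C_mul_monomial]

theorem coeff_toReesPrincipal (p : A[X]) (i : ℕ) :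
    (toReesPrincipal a p : A[X]).coeff i = p.coeff i * a ^ i := by
  induction p using Polynomial.induction_on' with
  | add p q hp hq => rw [map_add, Subalgebra.coe_add, coeff_add, coeff_add, hp, hq, add_mul]
  | monomial n r =>
    rw [coe_toReesPrincipal_monomial, coeff_monomial, coeff_monomial]
    split_ifs with h
    · rw [h]
    · rw [zero_mul]

theorem toReesPrincipal_bijective (ha : a ∈ nonZeroDivisors A) :
    Function.Bijective (toReesPrincipal a) := by
  constructor
  · intro p q h
    ext i
    have h1 := congrArg (fun t : reesAlgebra (Ideal.span {a}) => (t : A[X]).coeff i) h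
    simp only [coeff_toReesPrincipal] at h1
    exact (mul_cancel_right_mem_nonZeroDivisors (pow_mem ha i)).1 h1
  · intro t
    have h : ∀ i, ∃ p, (toReesPrincipal a p : A[X]) = monomial i ((t : A[X]).coeff i) := by
      intro i
      have h1 := t.2 i
      rw [Ideal.span_singleton_pow, Ideal.mem_span_singleton'] at h1
      obtain ⟨r, hr⟩ := h1
      exact ⟨monomial i r, by rw [coe_toReesPrincipal_monomial, hr]⟩
    choose p hp using h
    refine ⟨∑ i ∈ (t : A[X]).support, p i, Subtype.ext ?_⟩
    rw [map_sum, AddSubmonoidClass.coe_finsetSum]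
    simp only [hp]
    exact (as_sum_support (t : A[X])).symm

variable (a) in
/-- The Rees algebra of a principal ideal generated by a nonzerodivisor is a polynomial ring. -/
noncomputable def reesPrincipalEquiv (ha : a ∈ nonZeroDivisors A) :
    A[X] ≃ₐ[A] reesAlgebra (Ideal.span {a}) :=
  AlgEquiv.ofBijective (toReesPrincipal a) (toReesPrincipal_bijective ha)

theorem flat_reesAlgebra (ha : a ∈ nonZeroDivisors A) :
    Module.Flat A (reesAlgebra (Ideal.span {a})) :=
  Module.Flat.of_linearEquiv (reesPrincipalEquiv a ha).symm.toLinearEquiv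

theorem isPrime_map_algebraMap_of_algEquiv {B C : Type*} [CommRing B] [CommRing C] [Algebra A B]
    [Algebra A C] (e : B ≃ₐ[A] C) {P : Ideal A} (h : (P.map (algebraMap A B)).IsPrime) :
    (P.map (algebraMap A C)).IsPrime := by
  have h1 : (P.map (algebraMap A B)).map (e : B ≃+* C) = P.map (algebraMap A C) := by
    rw [← AlgHom.comp_algebraMap (e : B →ₐ[A] C), ← Ideal.map_map]
    rfl
  rw [← h1]
  exact Ideal.map_isPrime_of_equiv (e : B ≃+* C)

theorem isPrime_map_maximalIdeal [IsLocalRing A] (ha : a ∈ nonZeroDivisors A) :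
    ((IsLocalRing.maximalIdeal A).map
      (algebraMap A (reesAlgebra (Ideal.span {a})))).IsPrime :=
  isPrime_map_algebraMap_of_algEquiv (reesPrincipalEquiv a ha)
    (Ideal.isPrime_map_C_of_isPrime (P := IsLocalRing.maximalIdeal A))

end ReesPrincipal

/-! ### Rank of the Sally module -/

section LocalizedLength

open TensorProduct

/-- `A → T_𝔭` is flat and local, and `𝔪T_𝔭` is the maximal ideal; so base change to `T_𝔭` preserves
length. -/
theorem length_localizedModule_eq {A : Type*} {T : Type*} {W S : Type*} [CommRing A] [IsLocalRing A]
    [CommRing T] [Algebra A T] [Module.Flat A T] [AddCommGroup W] [Module A W] [AddCommGroup S]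
    [Module T S] (e : T ⊗[A] W ≃ₗ[T] S)
    (hp : ((IsLocalRing.maximalIdeal A).map (algebraMap A T)).IsPrime) :
    Module.length (Localization.AtPrime ((IsLocalRing.maximalIdeal A).map (algebraMap A T)))
      (LocalizedModule ((IsLocalRing.maximalIdeal A).map (algebraMap A T)).primeCompl S) =
        Module.length A W := by
  set p := (IsLocalRing.maximalIdeal A).map (algebraMap A T) with hpdef
  let B := Localization.AtPrime p
  have hflat : Module.Flat T B := IsLocalization.flat B p.primeCompl
  have hflat' : Module.Flat A B := Module.Flat.trans A T B
  have hlocal : IsLocalHom (algebraMap A B) := by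
    constructor
    intro r hr
    by_contra h
    rw [IsScalarTower.algebraMap_apply A T B, IsLocalization.AtPrime.isUnit_to_map_iff B p] at hr
    exact hr (Ideal.mem_map_of_mem _ ((IsLocalRing.mem_maximalIdeal r).2 h))
  have hmax : (IsLocalRing.maximalIdeal A).map (algebraMap A B) = IsLocalRing.maximalIdeal B := by
    rw [IsScalarTower.algebraMap_eq A T B, ← Ideal.map_map]
    exact Localization.AtPrime.map_eq_maximalIdeal
  have h1 : Module.length B (B ⊗[A] W) = Module.length A W := by
    rw [IsLocalRing.length_baseChange A B W, hmax]
    have : IsSimpleModule B (B ⧸ IsLocalRing.maximalIdeal B) :=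
      isSimpleModule_iff_isCoatom.2 (IsLocalRing.maximalIdeal.isMaximal B).out
    rw [Module.length_eq_one B (B ⧸ IsLocalRing.maximalIdeal B), mul_one]
  rw [← h1]
  exact ((LocalizedModule.equivTensorProduct p.primeCompl S).trans
    ((e.symm.baseChange T B _ _).trans
      (AlgebraTensorModule.cancelBaseChange A T B B W))).length_eq

theorem exists_tensor_lift {A T L M : Type*} [CommRing A] [CommRing T] [Algebra A T]
    [AddCommGroup L] [Module A L] [AddCommGroup M] [Module A M] [Module T M] [IsScalarTower A T M]
    {F G : Submodule A L} {N P : Submodule T M} (φ : L →ₗ[A] M) (hG : ∀ y ∈ G, φ y ∈ N)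
    (hF : ∀ y ∈ F, φ y ∈ P) :
    ∃ Φ : T ⊗[A] SubmoduleQuotient G F →ₗ[T] SubmoduleQuotient N P,
      ∀ (t : T) (y : G), Φ (t ⊗ₜ Submodule.Quotient.mk y) =
        Submodule.Quotient.mk (t • ⟨φ y, hG y y.2⟩) := by
  let ψ : SubmoduleQuotient G F →ₗ[A] SubmoduleQuotient N P :=
    (F.submoduleOf G).liftQ (((P.submoduleOf N).mkQ.restrictScalars A) ∘ₗ
      (φ.comp G.subtype).codRestrict (N.restrictScalars A) fun y => hG y y.2) fun y hy =>
        mk_eq_zero_iff_mem.2 (hF y hy)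
  exact ⟨ψ.liftBaseChange T, fun t y => LinearMap.liftBaseChange_tmul _ _ _ _⟩

end LocalizedLength

section SallyRank

open TensorProduct

variable {A : Type u} [CommRing A] {a : A} {I : Ideal A}

theorem exists_sum_tmul_eq (ha : a ∈ nonZeroDivisors A) {W : Type*} [AddCommGroup W] [Module A W]
    (z : reesAlgebra (Ideal.span {a}) ⊗[A] W) :
    ∃ c : ℕ →₀ W, (c.sum fun i w => toReesPrincipal a (monomial i 1) ⊗ₜ[A] w) = z := by
  obtain ⟨c, hc⟩ := TensorProduct.eq_repr_basis_left
    ((Polynomial.basisMonomials A).map (reesPrincipalEquiv a ha).toLinearEquiv) z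
  refine ⟨c, hc ▸ Finsupp.sum_congr fun i _ => ?_⟩
  rw [Module.Basis.map_apply, coe_basisMonomials]
  rfl

/-- If the Sally module is generated in degree one, then it is `T ⊗ I ^ 2 / a I`, where `T` is the
Rees algebra of the principal ideal generated by `a`. -/
theorem nonempty_tensor_equiv_sallyModule (ha : a ∈ nonZeroDivisors A)
    (hgen : SallyGeneratedInDegreeOne (Ideal.span {a}) I) :
    Nonempty (reesAlgebra (Ideal.span {a}) ⊗[A] SubmoduleQuotient (I ^ 2) (Ideal.span {a} * I)
      ≃ₗ[reesAlgebra (Ideal.span {a})] SallyModule (Ideal.span {a}) I) := by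
  obtain ⟨Φ, hΦ⟩ := exists_tensor_lift (T := reesAlgebra (Ideal.span {a}))
    (F := Ideal.span {a} * I) (G := I ^ 2)
    (N := sallyNumerator (Ideal.span {a}) I) (P := sallyDenominator (Ideal.span {a}) I)
    (monomial 1 : A →ₗ[A] A[X]) (fun y hy => monomial_mem_sallyNumerator hy)
    (fun y hy => monomial_mem_sallyDenominator (by rwa [pow_one]))
  refine ⟨LinearEquiv.ofBijective Φ ⟨?_, ?_⟩⟩
  · rw [injective_iff_map_eq_zero]
    intro z hz
    obtain ⟨c, rfl⟩ := exists_sum_tmul_eq ha z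
    have hlift : ∀ i, ∃ y : ↥(I ^ 2), Submodule.Quotient.mk y = c i :=
      fun i => Submodule.Quotient.mk_surjective _ (c i)
    choose y hy using hlift
    have h1 : Φ (c.sum fun i w => toReesPrincipal a (monomial i 1) ⊗ₜ[A] w) =
        Submodule.Quotient.mk (∑ i ∈ c.support, toReesPrincipal a (monomial i 1) •
          (⟨monomial 1 (y i : A), monomial_mem_sallyNumerator (y i).2⟩ :
            sallyNumerator (Ideal.span {a}) I)) := by
      rw [Finsupp.sum, map_sum, ← Submodule.mkQ_apply, map_sum]
      refine Finset.sum_congr rfl fun i _ => ?_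
      rw [← hy i, hΦ]
      rfl
    rw [h1] at hz
    have h2 := mk_eq_zero_iff_mem.1 hz
    have h3 : ((∑ i ∈ c.support, toReesPrincipal a (monomial i 1) •
          (⟨monomial 1 (y i : A), monomial_mem_sallyNumerator (y i).2⟩ :
            sallyNumerator (Ideal.span {a}) I) : sallyNumerator (Ideal.span {a}) I) : A[X]) =
        ∑ i ∈ c.support, monomial (i + 1) (a ^ i * y i) := by
      rw [AddSubmonoidClass.coe_finsetSum]
      refine Finset.sum_congr rfl fun i _ => ?_
      rw [Submodule.coe_smul, Subalgebra.smul_def, smul_eq_mul, coe_toReesPrincipal_monomial,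
        monomial_mul_monomial, one_mul]
    rw [h3] at h2
    have h4 : ∀ i ∈ c.support, c i = 0 := by
      intro i hi
      -- The coefficient of `t^(i+1)` reads `a^i y_i ∈ a^(i+1) I`; cancelling `a^i` gives `y_i ∈
      -- aI`.
      have h5 := coeff_mem_of_mem_sallyDenominator h2 (i + 1)
      rw [finsetSum_coeff, Finset.sum_eq_single i (fun j _ hj => by
        rw [coeff_monomial, if_neg (by omega)]) (fun h => absurd hi h), coeff_monomial_same,
        Ideal.span_singleton_pow, Ideal.mem_span_singleton_mul] at h5
      obtain ⟨x, hx, hx'⟩ := h5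
      rw [pow_succ, mul_assoc] at hx'
      have h6 := (mul_cancel_left_mem_nonZeroDivisors (pow_mem ha i)).1 hx'
      rw [← hy i]
      refine mk_eq_zero_iff_mem.2 ?_
      rw [← h6]
      exact Ideal.mul_mem_mul (Ideal.mem_span_singleton_self a) hx
    exact Finset.sum_eq_zero fun i hi => by rw [h4 i hi]; exact tmul_zero _ _
  · rw [← LinearMap.range_eq_top, eq_top_iff, ← hgen, Submodule.span_le]
    rintro _ ⟨x, hx, h, rfl⟩
    exact ⟨1 ⊗ₜ Submodule.Quotient.mk ⟨x, hx⟩, by rw [hΦ, one_smul]⟩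

variable [IsLocalRing A]

/-- The rank of a Sally module that is generated in degree one. -/
theorem sallyRankEq_iff (ha : a ∈ nonZeroDivisors A)
    (hgen : SallyGeneratedInDegreeOne (Ideal.span {a}) I) {n : ℕ} :
    SallyRankEq (Ideal.span {a}) I n ↔ relLength (Ideal.span {a} * I) (I ^ 2) = n := by
  obtain ⟨e⟩ := nonempty_tensor_equiv_sallyModule ha hgen
  have := flat_reesAlgebra ha
  have hp := isPrime_map_maximalIdeal ha
  have h := length_localizedModule_eq e hp
  rw [relLength, ← h]
  exact ⟨fun ⟨_, h⟩ => h, fun h => ⟨hp, h⟩⟩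

end SallyRank

/-! ### One-dimensional Cohen–Macaulay rings -/

section OneDimensional

variable {A : Type*} [CommRing A]

theorem isArtinianRing_of_isFiniteLength_quotient {I : Ideal A} (h : IsFiniteLength A (A ⧸ I)) :
    IsArtinianRing (A ⧸ I) := by
  have := (isFiniteLength_iff_isNoetherian_isArtinian.1 h).2
  exact isArtinian_of_tower A this

theorem IsCohenMacaulayLocalRing.isOneDimExtension [IsCohenMacaulayLocalRing A]
    (hdim : ringKrullDim A = 1) : IsOneDimExtension A (FractionRing A) where
  injective := IsFractionRing.injective A _
  isUnit b hb := IsLocalization.map_units (FractionRing A) ⟨b, hb⟩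
  isFiniteLength b hb := by
    have : IsNoetherianRing A := inferInstance
    have h := ringKrullDim_quotient_succ_le_of_nonZeroDivisor hb
    rw [hdim] at h
    have h1 : ringKrullDim (A ⧸ Ideal.span {b}) ≤ (0 : ℕ) := by
      generalize ringKrullDim (A ⧸ Ideal.span {b}) = x at h
      induction x with
      | bot => exact bot_le
      | coe x =>
        have h1 : x + 1 ≤ 0 + 1 := by exact_mod_cast h
        exact_mod_cast (ENat.add_le_add_iff_right ENat.one_ne_top).1 h1
    have h2 : IsArtinianRing (A ⧸ Ideal.span {b}) :=
      isArtinianRing_iff_krullDimLE_zero.2 (Ring.krullDimLE_iff.2 h1)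
    refine isFiniteLength_iff_isNoetherian_isArtinian.2 ⟨inferInstance, ?_⟩
    exact isArtinian_of_surjective_algebraMap (R := A ⧸ Ideal.span {b})
      Ideal.Quotient.mk_surjective
  exists_mem := by
    obtain ⟨rs, h1, h2, h3⟩ := IsCohenMacaulayLocalRing.exists_isRegular (A := A)
    rw [hdim] at h3
    have h4 : rs.length = 1 := by exact_mod_cast h3
    obtain ⟨b, rfl⟩ := List.length_eq_one_iff.1 h4
    refine ⟨b, h2 b (by simp), ?_⟩
    have h5 := ((RingTheory.Sequence.isRegular_cons_iff A b []).1 h1).1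
    refine mem_nonZeroDivisors_iff_right.2 fun x hx => h5 ?_
    change b * x = b * 0
    rw [mul_comm, hx, mul_zero]

variable [IsLocalRing A]

theorem radical_eq_maximalIdeal_of_isFiniteLength {I : Ideal A} (hI : I ≠ ⊤)
    (h : IsFiniteLength A (A ⧸ I)) : I.radical = IsLocalRing.maximalIdeal A := by
  have h1 := isArtinianRing_of_isFiniteLength_quotient h
  have h2 : ∀ P : Ideal A, P.IsPrime → I ≤ P → P = IsLocalRing.maximalIdeal A := by
    intro P hP hIP
    have h3 : IsArtinianRing (A ⧸ P) :=
      (Ideal.Quotient.factor_surjective hIP).isArtinianRing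
    have h4 := (Ideal.Quotient.isDomain_iff_prime P).2 hP
    exact IsLocalRing.eq_maximalIdeal
      (Ideal.Quotient.maximal_of_isField P (IsArtinianRing.isField_of_isDomain _))
  refine le_antisymm ?_ ?_
  · refine ((IsLocalRing.maximalIdeal.isMaximal A).isPrime.radical_le_iff).2 ?_
    exact IsLocalRing.le_maximalIdeal hI
  · rw [Ideal.radical_eq_sInf]
    exact le_sInf fun P hP => (h2 P hP.2 hP.1).ge

theorem mem_nonZeroDivisors_of_radical_eq {a b : A}
    (ha : (Ideal.span {a}).radical = IsLocalRing.maximalIdeal A)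
    (hb : b ∈ IsLocalRing.maximalIdeal A) (hb' : b ∈ nonZeroDivisors A) :
    a ∈ nonZeroDivisors A := by
  rw [← ha] at hb
  obtain ⟨k, hk⟩ := hb
  obtain ⟨c, hc⟩ := Ideal.mem_span_singleton'.1 hk
  have h := pow_mem hb' k
  rw [← hc] at h
  exact (mul_mem_nonZeroDivisors.1 h).2

variable (A) in
-- A regular `b ∈ 𝔪` with `A/b` Artinian pins the dimension to one and is itself the regular
-- sequence. This applies to the fiber product.
theorem isCohenMacaulayLocalRing_of_isOneDimExtension (V : Type*) [CommRing V] [Algebra A V]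
    [IsOneDimExtension A V] [IsNoetherianRing A] :
    IsCohenMacaulayLocalRing A ∧ ringKrullDim A = 1 := by
  obtain ⟨b, hb, hb'⟩ := IsOneDimExtension.exists_mem (A := A) (V := V)
  have hne : Ideal.span {b} ≠ ⊤ := by
    intro h
    rw [Ideal.span_singleton_eq_top] at h
    exact hb h
  have := Ideal.Quotient.nontrivial_iff.2 hne
  have hart := isArtinianRing_of_isFiniteLength_quotient
    (IsOneDimExtension.isFiniteLength (V := V) b hb')
  have h0 : ringKrullDim (A ⧸ Ideal.span {b}) = 0 := by
    rw [← ringKrullDimZero_iff_ringKrullDim_eq_zero]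
    exact isArtinianRing_iff_krullDimLE_zero.1 hart
  have hdim : ringKrullDim A = 1 := by
    refine le_antisymm ?_ ?_
    · have h := ringKrullDim_le_ringKrullDim_quotient_add_card {b} (by
        simpa [IsLocalRing.ringJacobson_eq_maximalIdeal] using hb)
      rwa [Finset.coe_singleton, Finset.card_singleton, h0, Nat.cast_one, zero_add] at h
    · have h := ringKrullDim_quotient_succ_le_of_nonZeroDivisor hb'
      simpa [h0] using h
  refine ⟨⟨[b], ?_, by simpa using hb, by simp [hdim]⟩, hdim⟩
  rw [RingTheory.Sequence.isRegular_iff, RingTheory.Sequence.isWeaklyRegular_cons_iff]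
  refine ⟨⟨fun x y h => (mul_cancel_left_mem_nonZeroDivisors hb').1 h, .nil _ _⟩, ?_⟩
  rw [Ideal.ofList_singleton, smul_eq_mul, Ideal.mul_top]
  exact hne.symm

end OneDimensional

/-! ### From Goto rings to fractional ideals and back -/

section CoeSubmodule

variable {A : Type u} {V : Type v} [CommRing A] [CommRing V] [Algebra A V] [IsLocalRing A]
  [IsOneDimExtension A V]

variable (V) in
/-- An ideal of `A` as a submodule of an extension. -/
noncomputable def idealEquivCoeSubmodule (I : Ideal A) :
    I ≃ₗ[A] IsLocalization.coeSubmodule V I :=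
  Submodule.equivMapOfInjective (Algebra.linearMap A V) IsOneDimExtension.injective I

variable (V) in
theorem coeSubmodule_injective_of_isOneDimExtension :
    Function.Injective (IsLocalization.coeSubmodule V : Ideal A → Submodule A V) :=
  Submodule.map_injective_of_injective (f := Algebra.linearMap A V) IsOneDimExtension.injective

variable (V) in
theorem relLength_coeSubmodule (I J : Ideal A) :
    relLength (IsLocalization.coeSubmodule V I) (IsLocalization.coeSubmodule V J) =
      relLength I J :=
  relLength_map (Algebra.linearMap A V) IsOneDimExtension.injective

theorem isRegularFractional_coeSubmodule {I : Ideal A} {a : A} (ha : a ∈ nonZeroDivisors A)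
    (haI : a ∈ I) : IsRegularFractional (IsLocalization.coeSubmodule V I) := by
  refine ⟨⟨1, one_mem _, ?_⟩, algebraMap A V a, ⟨a, haI, rfl⟩, IsOneDimExtension.isUnit a ha⟩
  rintro _ ⟨x, -, rfl⟩
  rw [one_smul]
  exact algebraMap_mem_one x

end CoeSubmodule

section GotoBridge

variable {A : Type u} {V : Type v} [CommRing A] [CommRing V] [Algebra A V]
  [IsCohenMacaulayLocalRing A] [IsOneDimExtension A V]

theorem IsGotoRing.isFractionalGoto (hdim : ringKrullDim A = 1) {n : ℕ} (h : IsGotoRing n A) :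
    IsFractionalGoto A V n := by
  obtain ⟨_, I, ⟨-, hIK⟩, d, a, ⟨hd, ha⟩, haI, hrank, hgen⟩ := h
  obtain rfl : d = 0 := by
    rw [hdim] at hd
    have : 1 = d + 1 := by exact_mod_cast hd
    omega
  obtain ⟨c, hc⟩ : ∃ c, a 0 = c := ⟨_, rfl⟩
  rw [hc] at haI
  have hQ : Set.range a = {c} := by
    ext x
    simp [Fin.exists_fin_one, hc, eq_comm]
  rw [hQ] at ha hrank hgen
  have hQI : Ideal.span {c} ≤ I := (Ideal.span_singleton_le_iff_mem _).2 haI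
  rw [sup_eq_left.2 hQI] at hrank hgen
  obtain ⟨x, hxm, hx⟩ := IsOneDimExtension.exists_mem (A := A) (V := V)
  have hc' := mem_nonZeroDivisors_of_radical_eq ha hxm hx
  obtain ⟨u, hu⟩ := IsOneDimExtension.isUnit (V := V) c hc'
  have hpow := hgen.pow_three_eq hQI
  rw [sallyRankEq_iff hc' hgen, ← relLength_coeSubmodule V] at hrank
  have hreg := isRegularFractional_coeSubmodule (V := V) hc' haI
  have htype := (isCanonicalModule_iff hdim hreg (idealEquivCoeSubmodule V I)).1 hIK
  have hpow' := congrArg (IsLocalization.coeSubmodule V) hpow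
  have huI : (u : V) ∈ IsLocalization.coeSubmodule V I := hu ▸ ⟨c, haI, rfl⟩
  simp only [pow_succ, pow_zero, one_mul, IsLocalization.coeSubmodule_mul,
    IsLocalization.coeSubmodule_span_singleton, ← hu] at hpow' hrank
  -- `K = c⁻¹I`; then `I³ = cI²` becomes `K³ = K²`, and `I²/cI` becomes `c²K²/c²K`.
  obtain ⟨K, hK⟩ : ∃ K : Submodule A V,
      K = Submodule.span A {((u⁻¹ : Vˣ) : V)} * IsLocalization.coeSubmodule V I := ⟨_, rfl⟩
  have hIK : IsLocalization.coeSubmodule V I = Submodule.span A {(u : V)} * K := by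
    rw [hK, ← mul_assoc, span_unit_mul_span_inv, one_mul]
  refine ⟨K, ?_, hK ▸ (hreg.span_inv huI).mul hreg, hK ▸ htype.scale _, ?_, ?_⟩
  · rw [hK, mem_scale]
    simpa using huI
  · rw [hIK] at hpow'
    refine scale_cancel (u := u) (scale_cancel (u := u) (scale_cancel (u := u) ?_))
    ring_nf at hpow' ⊢
    exact hpow'
  · rw [hIK] at hrank
    rw [← hrank, ← relLength_scale u, ← relLength_scale u]
    congr 1
    ring

theorem IsFractionalGoto.isGotoRing (hdim : ringKrullDim A = 1) {n : ℕ}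
    (h : IsFractionalGoto A V n) : IsGotoRing n A := by
  obtain ⟨K, h1, hK, htype, hpow, hlen⟩ := h
  obtain ⟨b, hb, hbK⟩ := hK.1
  obtain ⟨x, hxm, hx⟩ := IsOneDimExtension.exists_mem (A := A) (V := V)
  -- The denominator `b` alone gives `bK ⊆ A`; the extra factor `x ∈ 𝔪` makes `cK` a proper ideal.
  -- It contains `c` because `1 ∈ K`.
  obtain ⟨c, hc⟩ : ∃ c, c = x * b := ⟨_, rfl⟩
  have hc' : c ∈ nonZeroDivisors A := hc ▸ mul_mem hx hb
  have hcm : c ∈ IsLocalRing.maximalIdeal A := hc ▸ Ideal.mul_mem_right _ _ hxm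
  obtain ⟨u, hu⟩ := IsOneDimExtension.isUnit (V := V) c hc'
  obtain ⟨I, hI⟩ : ∃ I : Ideal A,
      I = (Submodule.span A {(u : V)} * K).comap (Algebra.linearMap A V) := ⟨_, rfl⟩
  have hmem : ∀ v ∈ Submodule.span A {(u : V)} * K,
      ∃ r ∈ IsLocalRing.maximalIdeal A, algebraMap A V r = v := by
    intro v hv
    obtain ⟨z, hz, rfl⟩ := Submodule.mem_span_singleton_mul.1 hv
    obtain ⟨r, hr⟩ := Submodule.mem_one.1 (hbK z hz)
    refine ⟨x * r, Ideal.mul_mem_right _ _ hxm, ?_⟩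
    rw [map_mul, hr, hu, hc, map_mul, Algebra.smul_def, mul_assoc]
  have hIK : IsLocalization.coeSubmodule V I = Submodule.span A {(u : V)} * K := by
    rw [hI]
    refine Submodule.map_comap_eq_self fun v hv => ?_
    obtain ⟨r, -, hr⟩ := hmem v hv
    exact ⟨r, hr⟩
  have hIm : I ≤ IsLocalRing.maximalIdeal A := by
    intro y hy
    obtain ⟨r, hr, hry⟩ := hmem (algebraMap A V y) (hI ▸ hy : y ∈ Submodule.comap _ _)
    exact (IsOneDimExtension.injective hry) ▸ hr
  have hItop : I ≠ ⊤ := fun h =>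
    (IsLocalRing.maximalIdeal.isMaximal A).ne_top (top_le_iff.1 (h ▸ hIm))
  have hcI : c ∈ I := by
    rw [hI, Submodule.mem_comap, mem_scale, Algebra.linearMap_apply, ← hu, Units.inv_mul]
    exact h1
  have hQI : Ideal.span {c} ≤ I := (Ideal.span_singleton_le_iff_mem _).2 hcI
  have hne : Ideal.span {c} ≠ ⊤ := fun h => hItop (top_le_iff.1 (h ▸ hQI))
  have hreg : IsRegularFractional (IsLocalization.coeSubmodule V I) :=
    isRegularFractional_coeSubmodule hc' hcI
  have hpow' : I ^ 3 = Ideal.span {c} * I ^ 2 := by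
    refine coeSubmodule_injective_of_isOneDimExtension V ?_
    simp only [pow_succ, pow_zero, one_mul, IsLocalization.coeSubmodule_mul,
      IsLocalization.coeSubmodule_span_singleton, ← hu, hIK]
    have h2 := congrArg (Submodule.span A {(u : V)} ^ 3 * ·) hpow
    ring_nf at h2 ⊢
    exact h2
  have hgen := sallyGeneratedInDegreeOne_of_pow_three_eq hQI hpow'
  have hrange : Set.range (fun _ : Fin 1 => c) = {c} := Set.range_const
  refine ⟨inferInstance, I, ⟨hItop, ?_⟩, 0, fun _ => c, ⟨by simpa using hdim, ?_⟩, hcI, ?_⟩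
  · refine (isCanonicalModule_iff hdim hreg (idealEquivCoeSubmodule V I)).2 ?_
    rw [hIK]
    exact htype.scale u
  · rw [hrange]
    exact radical_eq_maximalIdeal_of_isFiniteLength hne
      (IsOneDimExtension.isFiniteLength (V := V) c hc')
  · rw [hrange, sup_eq_left.2 hQI]
    refine ⟨(sallyRankEq_iff hc' hgen).2 ?_, hgen⟩
    rw [← relLength_coeSubmodule V, ← hlen]
    simp only [pow_succ, pow_zero, one_mul, IsLocalization.coeSubmodule_mul,
      IsLocalization.coeSubmodule_span_singleton, ← hu, hIK]
    conv_rhs => rw [← relLength_scale u, ← relLength_scale u]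
    congr 1
    ring

theorem isGotoRing_iff (hdim : ringKrullDim A = 1) {n : ℕ} :
    IsGotoRing n A ↔ IsFractionalGoto A V n :=
  ⟨fun h => h.isFractionalGoto hdim, fun h => h.isGotoRing hdim⟩

end GotoBridge

/-! ### The fiber product theorem -/

theorem ker_eq_maximalIdeal_of_surjective {R k : Type*} [CommRing R] [IsLocalRing R] [Field k]
    {f : R →+* k} (hf : Function.Surjective f) : RingHom.ker f = IsLocalRing.maximalIdeal R :=
  IsLocalRing.eq_maximalIdeal (RingHom.ker_isMaximal_of_surjective f hf)

theorem infinite_residueField_of_surjective {R k : Type*} [CommRing R] [IsLocalRing R] [Field k]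
    [Infinite k] {f : R →+* k} (hf : Function.Surjective f) :
    Infinite (IsLocalRing.ResidueField R) :=
  ((Ideal.quotEquivOfEq (ker_eq_maximalIdeal_of_surjective hf).symm).trans
    (RingHom.quotientKerEquivOfSurjective hf)).toEquiv.infinite_iff.2 inferInstance

theorem theorem6p1 {R : Type u} {S : Type v} {k : Type w} [CommRing R] [CommRing S] [Field k]
    [IsCohenMacaulayLocalRing R] [IsCohenMacaulayLocalRing S] [Infinite k]
    (hR : ringKrullDim R = 1) (hS : ringKrullDim S = 1)
    (f : R →+* k) (hf : Function.Surjective f) (g : S →+* k) (hg : Function.Surjective g)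
    (n : ℕ) (hn : 2 ≤ n) :
    IsGotoRing n (f.pullback g) ↔
      (IsGorensteinLocalRing R ∧ IsGotoRing n S) ∨
      (IsGotoRing n R ∧ IsGorensteinLocalRing S) ∨
      (∃ p q : ℕ, 0 < p ∧ 0 < q ∧ p + q = n + 1 ∧ IsGotoRing p R ∧ IsGotoRing q S) := by
  have := IsCohenMacaulayLocalRing.isOneDimExtension hR
  have := IsCohenMacaulayLocalRing.isOneDimExtension hS
  have := infinite_residueField_of_surjective hf
  have := infinite_residueField_of_surjective hg
  have hfk : ∀ r, f r = 0 ↔ r ∈ IsLocalRing.maximalIdeal R := fun r => by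
    rw [← ker_eq_maximalIdeal_of_surjective hf, RingHom.mem_ker]
  have hgk : ∀ s, g s = 0 ↔ s ∈ IsLocalRing.maximalIdeal S := fun s => by
    rw [← ker_eq_maximalIdeal_of_surjective hg, RingHom.mem_ker]
  have : IsLocalHom g := hg.isLocalHom g
  have : IsLocalRing (f.pullback g) := RingHom.isLocalRing_pullback f g
  let _ : Algebra (f.pullback g) R := (f.pullbackFst g).toAlgebra
  let _ : Algebra (f.pullback g) S := (f.pullbackSnd g).toAlgebra
  have : IsFiberProduct (f.pullback g) R S :=
    { surjective_left := RingHom.surjective_pullbackFst_of_surjective f g hg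
      surjective_right := RingHom.surjective_pullbackSnd_of_surjective f g hf
      exists_left := fun r hr =>
        ⟨⟨(r, 0), by simpa [RingHom.mem_eqLocus] using (hfk r).2 hr⟩, rfl, rfl⟩
      exists_right := fun s hs =>
        ⟨⟨(0, s), by simpa [RingHom.mem_eqLocus] using ((hgk s).2 hs).symm⟩, rfl, rfl⟩
      eq_zero := fun a h1 h2 => Subtype.ext (Prod.ext h1 h2) }
  have : IsNoetherianRing (f.pullback g) := IsFiberProduct.isNoetherianRing (R := R) (S := S)
  have : IsOneDimExtension (f.pullback g) (FractionRing R × FractionRing S) :=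
    IsFiberProduct.isOneDimExtension (f.pullback g) R S (FractionRing R) (FractionRing S)
  obtain ⟨_, hdim⟩ := isCohenMacaulayLocalRing_of_isOneDimExtension (f.pullback g)
    (FractionRing R × FractionRing S)
  rw [isGotoRing_iff (V := FractionRing R × FractionRing S) hdim,
    isFractionalGoto_fiberProduct_iff (R := R) (S := S) hn]
  simp only [isGotoRing_iff (V := FractionRing R) hR, isGotoRing_iff (V := FractionRing S) hS,
    isGorensteinLocalRing_iff (V := FractionRing R), isGorensteinLocalRing_iff (V := FractionRing S)]
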